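/- **Setting.** An episodic time-inhomogeneous MDP has state space $\mathcal S$, action space $\mathcal A$ (both non-empty), horizon $H\ge 1$, transition probabilities $\mathbb P_h(\cdot\mid s,a)$ (discrete distributions on $\mathcal S$, $h\in[H]$), and initial distribution $\mu$. For a reward $r=\{r_h\}$ and a deterministic policy $\pi=\{\pi_h:\mathcal S\to\mathcal A\}$, $V_h^\pi(s;r)$ is the expected sum of the rewards of stages $h,\dots,H$ started from $s$, and $V_h^*=\sup_\pi V_h^\pi$. Write $z=(s,a)$. $\mathcal F=\{\mathcal F_h\}_{h\in[H]}$ is a family of classes of functions $\mathcal S\times\mathcal A\to[0,L]$ with finite sup-norm covers of every radius $\eta>0$. $N_{\mathcal F}(\eta)$ is the maximum over $h$ of the sup-norm covering numbers of $\mathcal F_h$ (centres in $\mathcal F_h$). $\mathcal F$ is *complete* for $\mathbb P$ if for all $h$, $V:\mathcal S\to[0,1]$ and $r:\mathcal S\times\mathcal A\to[0,1]$ the functions $(s,a)\mapsto\mathbb E_{s'\sim\mathbb P_h(\cdot|s,a)}[r(s,a)+V(s')]$ and $(s,a)\mapsto\mathbb E_{s'\sim\mathbb P_h(\cdot|s,a)}[(r(s,a)+V(s'))^2]$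 belong to $\mathcal F_h$. Assume $\mathcal F$ is complete for at least one transition kernel. Fix $\lambda>0$ and let $$D_{\mathcal F_h}^2(z;z_{[t]},\sigma_{[t]})=\sup_{f_1,f_2\in\mathcal F_h}\frac{(f_1(z)-f_2(z))^2}{\sum_{i\le t}\sigma_i^{-2}(f_1(z_i)-f_2(z_i))^2+\lambda},\qquad \dim_{\alpha,K}(\mathcal F_h)=\sup_{z_{[K]},\,\sigma_{[K]}\ge\alpha}\ \sum_{i=1}^K\min\Big(1,\tfrac1{\sigma_i^2}D_{\mathcal F_h}^2(z_i;z_{[i-1]},\sigma_{[i-1]})\Big),$$ $\dim_{\alpha,K}(\mathcal F)=H^{-1}\sum_h\dim_{\alpha,K}(\mathcal F_h)$. A bonus oracle returns functions $\overline D_{\mathcal F_h}$ with $D_{\mathcal F_h}\le\overline D_{\mathcal F_h}\le C\,D_{\mathcal F_h}$ for all data with positive $\sigma_i$; $\mathcal B$ is the class of all functions it can return, $N_{\mathcal B}(\eta)$ its sup-norm covering number (assumed finite for every radius), and $N_{\mathcal V}(\eta)=N_{\mathcal F}(\eta/2)\,N_{\mathcal B}(\eta/(4\beta^E))$. **GFA-RFE**,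 with inputs $\varepsilon,\beta^E,\beta^P$ and $\alpha=1/\sqrt H$, $\gamma=\sqrt{\log N_{\mathcal V}(\varepsilon)}$ (argmins over $\mathcal F_h$ are attained, ties in argmin and argmax are broken by a fixed rule). *Exploration.* In episode $k=1,\dots,K$ put $V_{k,H+1}=0$ and for $h=H,\dots,1$ let $b_{k,h}=2\beta^E\overline D_{\mathcal F_h}(\cdot;z_{[k-1],h},\bar\sigma_{[k-1],h})$, $r_{k,h}=\min\{b_{k,h}/2,1\}$, $\hat f_{k,h}\in\arg\min_{f\in\mathcal F_h}\sum_{i<k}\bar\sigma_{i,h}^{-2}(f(z_{i,h})-r_{k,h}(z_{i,h})-V_{k,h+1}(s^i_{h+1}))^2$, $Q_{k,h}=\min\{\hat f_{k,h}+b_{k,h},1\}$, $V_{k,h}(s)=\max_aQ_{k,h}(s,a)$, $\pi^k_h(s)\in\arg\max_aQ_{k,h}(s,a)$. Run $\pi^k$ from $s_1^k\sim\mu$, which gives $z_{k,h}=(s_h^k,a_h^k)$ and $s^k_{h+1}$, and set $\bar\sigma_{k,h}=\max\{\gamma\,\overline D_{\mathcal F_h}^{1/2}(z_{k,h};z_{[k-1],h},\bar\sigma_{[k-1],h}),\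 2\sqrt{\log N_{\mathcal V}(\varepsilon)\min\{\hat f_{k,h}(z_{k,h}),1\}},\ \alpha\}$. *Planning*, for a reward $\tilde r$. Put $\hat V_{H+1}=0$ and for $h=H,\dots,1$ let $b_h=\min\{\beta^P\overline D_{\mathcal F_h}(\cdot;z_{[K],h},\bar\sigma_{[K],h}),1\}$, $\hat f_h\in\arg\min_{f\in\mathcal F_h}\sum_{i\le K}\bar\sigma_{i,h}^{-2}(f(z_{i,h})-\tilde r_h(z_{i,h})-\hat V_{h+1}(s^i_{h+1}))^2$, $\hat Q_h=\min\{\hat f_h+b_h,1\}$, $\hat V_h(s)=\max_a\hat Q_h(s,a)$, $\pi_h(s)\in\arg\max_a\hat Q_h(s,a)$; return $\pi$. **Statement.** Let $\varepsilon,\delta\in(0,1)$, $d_{K,\delta}=\max\{\log N_{\mathcal F}(\varepsilon),\dim_{1/\sqrt H,K}(\mathcal F)\}$ and $\ell_K=\log(e+KH/(\varepsilon\delta))$. There are an absolute exponent $p\in\mathbb N$ and a constant $c>0$ depending only on $C,L,\lambda$ such that, with $$T(K)=c\,\ell_K^{\,p}\;\frac{H^4d_{K,\delta}^2}{\varepsilon^2}\;\max\{1,\varepsilon\log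 N_{\mathcal F}(\varepsilon)\}$$ (so $T(K)=\tilde O(H^4d_{K,\delta}^2/\varepsilon^2)$ once $\varepsilon\le 1/\log N_{\mathcal F}(\varepsilon)$), the following holds. 1. There is $K\ge1$ with $T(K)\le K\le 2T(K)$. 2. For every $K\ge1$ with $K\ge T(K)$ there are confidence radii, not depending on the unknown $\mathbb P$ and $\mu$, with $\sqrt{H\log N_{\mathcal V}(\varepsilon)}\le\beta^E\le c\,\ell_K^{\,p}\sqrt{H\log N_{\mathcal V}(\varepsilon)}$ and $\sqrt{H\log N_{\mathcal F}(\varepsilon)}\le\beta^P\le c\,\ell_K^{\,p}\sqrt{H\log N_{\mathcal F}(\varepsilon)}$, such that for every transition kernel $\mathbb P$ for which $\mathcal F$ is complete and every $\mu$, with probability at least $1-\delta$ over $K$ exploration episodes, simultaneously for all rewards $r$ with either $r_h(s,a)\in[0,1]$ for all $h,s,a$, or $r_h\ge0$ and $\sum_{h=1}^Hr_h(s_h,a_h)\le H$ along every possible trajectory, the policy $\pi$ that the planning phase returns for the rescaled reward $\tilde r=r/H$ satisfies $\mathbb E_{s_1\sim\mu}[V_1^*(s_1;r)-V_1^\pi(s_1;r)]\le\varepsilon$.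 -/

import Mathlib

universe u v

namespace GFARFE

noncomputable section

/-- Expectation of a real function under a discrete probability distribution. -/
def expect {X : Type u} (p : PMF X) (f : X → ℝ) : ℝ := ∑' x, (p x).toReal * f x

/-! ### Episodic Markov decision processes

Stages are numbered `0, …, H - 1`; a transition kernel is `P : ℕ → S × A → PMF S`, a reward is
`r : ℕ → S × A → ℝ`, a (deterministic, non-stationary) policy is `π : ℕ → S → A`, and only the
stages `h < H` matter. -/

/-- Law of the state-action pairs met during `n` steps from state `s` at stage `h` under `π`. -/
def trajectory {S : Type u} {A : Type v} (P : ℕ → S × A → PMF S) (π : ℕ → S → A) :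
    ℕ → ℕ → S → PMF (List (S × A))
  | 0, _, _ => PMF.pure []
  | n + 1, h, s =>
      (P h (s, π h s)).bind fun s' =>
        (trajectory P π n (h + 1) s').map fun l => (s, π h s) :: l

/-- Sum of the rewards along a list of state-action pairs that starts at stage `h`. -/
def rewardSum {S : Type u} {A : Type v} (r : ℕ → S × A → ℝ) : ℕ → List (S × A) → ℝ
  | _, [] => 0
  | h, z :: l => r h z + rewardSum r (h + 1) l

/-- The value function `V_h^π(s; r)` of an `H`-stage process. -/
def value {S : Type u} {A : Type v} (H : ℕ) (P : ℕ → S × A → PMF S) (r : ℕ → S × A → ℝ)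
    (π : ℕ → S → A) (h : ℕ) (s : S) : ℝ :=
  expect (trajectory P π (H - h) h s) (rewardSum r h)

/-- The optimal value function `V_h^*(s; r)`. -/
def optValue {S : Type u} {A : Type v} (H : ℕ) (P : ℕ → S × A → PMF S) (r : ℕ → S × A → ℝ)
    (h : ℕ) (s : S) : ℝ :=
  ⨆ π : ℕ → S → A, value H P r π h s

/-- The sequence of states and actions has positive probability under some behaviour. -/
def IsPossible {S : Type u} {A : Type v} (H : ℕ) (P : ℕ → S × A → PMF S) (μ : PMF S)
    (s : ℕ → S) (a : ℕ → A) : Prop :=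
  s 0 ∈ μ.support ∧ ∀ h, h + 1 < H → s (h + 1) ∈ (P h (s h, a h)).support

/-- Admissible rewards: every stage reward lies in `[0, 1]`, or the rewards are non-negative and
the total reward of every possible trajectory is at most `H`. -/
def AdmissibleReward {S : Type u} {A : Type v} (H : ℕ) (P : ℕ → S × A → PMF S) (μ : PMF S)
    (r : ℕ → S × A → ℝ) : Prop :=
  (∀ h < H, ∀ z, 0 ≤ r h z ∧ r h z ≤ 1) ∨
    ((∀ h < H, ∀ z, 0 ≤ r h z) ∧
      ∀ s a, IsPossible H P μ s a → ∑ h ∈ Finset.range H, r h (s h, a h) ≤ H)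

/-! ### Function classes -/

/-- The classes `F_h` consist of functions with values in `[0, L]`. -/
def BoundedClass {S : Type u} {A : Type v} (H : ℕ) (F : ℕ → Set (S × A → ℝ)) (L : ℝ) : Prop :=
  ∀ h < H, ∀ f ∈ F h, ∀ z, 0 ≤ f z ∧ f z ≤ L

/-- Completeness: for all `V : S → [0, 1]` and `r : S × A → [0, 1]`, the first and the second
moment of `r(s, a) + V(s')`, `s' ∼ P_h(· | s, a)`, are members of `F_h`. -/
def Complete {S : Type u} {A : Type v} (H : ℕ) (F : ℕ → Set (S × A → ℝ))
    (P : ℕ → S × A → PMF S) : Prop :=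
  ∀ h < H, ∀ (V : S → ℝ) (r : S × A → ℝ),
    (∀ s, 0 ≤ V s ∧ V s ≤ 1) → (∀ z, 0 ≤ r z ∧ r z ≤ 1) →
    (fun z => expect (P h z) fun s' => r z + V s') ∈ F h ∧
      (fun z => expect (P h z) fun s' => (r z + V s') ^ 2) ∈ F h

/-- `N` is a finite cover of `G` by members of `G`, of radius `η` in the supremum norm. -/
def IsCover {X : Type u} (G : Set (X → ℝ)) (η : ℝ) (N : Finset (X → ℝ)) : Prop :=
  (N : Set (X → ℝ)) ⊆ G ∧ ∀ f ∈ G, ∃ g ∈ N, ∀ x, |f x - g x| ≤ η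

/-- `G` has finite covers of every positive radius. -/
def HasFiniteCovers {X : Type u} (G : Set (X → ℝ)) : Prop :=
  ∀ η > 0, ∃ N, IsCover G η N

/-- The covering number of `G` at radius `η`. -/
def coveringNumber {X : Type u} (G : Set (X → ℝ)) (η : ℝ) : ℕ :=
  sInf {n | ∃ N, IsCover G η N ∧ N.card = n}

/-- `N_F(η)`, the largest of the covering numbers of the `F_h`. -/
def coverF {S : Type u} {A : Type v} (H : ℕ) (F : ℕ → Set (S × A → ℝ)) (η : ℝ) : ℕ :=
  (Finset.range H).sup fun h => coveringNumber (F h) η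

/-- `D_G²(z; z_[t], σ_[t])`, with the data given as the list of the pairs `(z_i, σ_i)`. -/
def uncertaintySq {X : Type u} (G : Set (X → ℝ)) (lam : ℝ) (D : List (X × ℝ)) (z : X) : ℝ :=
  ⨆ f : G × G, (f.1.1 z - f.2.1 z) ^ 2 /
    ((D.map fun x => (f.1.1 x.1 - f.2.1 x.1) ^ 2 / x.2 ^ 2).sum + lam)

/-- The generalized eluder dimension `dim_{α,K}(G)`. -/
def eluderDim {X : Type u} (G : Set (X → ℝ)) (lam α : ℝ) (K : ℕ) : ℝ :=
  ⨆ w : {w : Fin K → X × ℝ // ∀ i, α ≤ (w i).2},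
    ∑ i : Fin K, min 1
      (uncertaintySq G lam ((List.ofFn w.1).take i) (w.1 i).1 / (w.1 i).2 ^ 2)

/-- `dim_{α,K}(F)`, the average of the `dim_{α,K}(F_h)` over the stages. -/
def eluderDimF {S : Type u} {A : Type v} (H : ℕ) (F : ℕ → Set (S × A → ℝ)) (lam α : ℝ)
    (K : ℕ) : ℝ :=
  (∑ h ∈ Finset.range H, eluderDim (F h) lam α K) / H

/-- The bonus oracle approximates the uncertainty `D_{F_h}` up to the factor `C`. -/
def IsBonusOracle {S : Type u} {A : Type v} (H : ℕ) (F : ℕ → Set (S × A → ℝ)) (lam C : ℝ)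
    (Dbar : ℕ → List ((S × A) × ℝ) → S × A → ℝ) : Prop :=
  ∀ h < H, ∀ D : List ((S × A) × ℝ), (∀ x ∈ D, 0 < x.2) → ∀ z,
    √(uncertaintySq (F h) lam D z) ≤ Dbar h D z ∧
      Dbar h D z ≤ C * √(uncertaintySq (F h) lam D z)

/-- The bonus class: all functions that the oracle can return. -/
def bonusClass {S : Type u} {A : Type v} (H : ℕ)
    (Dbar : ℕ → List ((S × A) × ℝ) → S × A → ℝ) : Set (S × A → ℝ) :=
  {b | ∃ h < H, ∃ D : List ((S × A) × ℝ), (∀ x ∈ D, 0 < x.2) ∧ b = Dbar h D}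

/-- `N_V(η) = N_F(η / 2) · N_B(η / (2 β))`, the covering number attached to the optimistic value
functions `s ↦ max_a min (1, f(s, a) + β b(s, a))`, `f ∈ F_h`, `b` in the bonus class. -/
def coverV {S : Type u} {A : Type v} (H : ℕ) (F : ℕ → Set (S × A → ℝ))
    (Dbar : ℕ → List ((S × A) × ℝ) → S × A → ℝ) (β η : ℝ) : ℕ :=
  coverF H F (η / 2) * coveringNumber (bonusClass H Dbar) (η / (2 * β))

/-- The weighted squared loss of `f`; a data point `(z, σ, y)` has weight `1 / σ²`. -/
def weightedLoss {X : Type u} (f : X → ℝ) (D : List (X × ℝ × ℝ)) : ℝ :=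
  (D.map fun x => (f x.1 - x.2.2) ^ 2 / x.2.1 ^ 2).sum

/-- `erm h` returns a minimizer over `F_h` of the weighted squared loss. -/
def IsRegression {S : Type u} {A : Type v} (H : ℕ) (F : ℕ → Set (S × A → ℝ))
    (erm : ℕ → List ((S × A) × ℝ × ℝ) → S × A → ℝ) : Prop :=
  ∀ h < H, ∀ D : List ((S × A) × ℝ × ℝ), (∀ x ∈ D, 0 < x.2.1) →
    erm h D ∈ F h ∧ ∀ f ∈ F h, weightedLoss (erm h D) D ≤ weightedLoss f D

/-- `greedy q` is a maximizer of `q` whenever there is one. -/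
def IsArgmax {A : Type v} (greedy : (A → ℝ) → A) : Prop :=
  ∀ q : A → ℝ, (∃ a₀, ∀ a, q a ≤ q a₀) → ∀ a, q a ≤ q (greedy q)

/-! ### The algorithm GFA-RFE -/

/-- One stage of one recorded episode: the pair `(s_h, a_h)`, the next state `s_{h+1}` and the
weight parameter. -/
structure Sample (S : Type u) (A : Type v) where
  pair : S × A
  next : S
  sd : ℝ

/-- The data set: for every stage the samples of the past episodes, oldest first. -/
abbrev History (S : Type u) (A : Type v) : Type (max u v) := ℕ → List (Sample S A)

/-- The inputs of the algorithm. -/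
structure Input (S : Type u) (A : Type v) where
  /-- number of stages -/
  H : ℕ
  /-- bonus oracle -/
  Dbar : ℕ → List ((S × A) × ℝ) → S × A → ℝ
  /-- weighted regression over the function class of a stage -/
  erm : ℕ → List ((S × A) × ℝ × ℝ) → S × A → ℝ
  /-- choice of a maximizing action -/
  greedy : (A → ℝ) → A
  /-- confidence radius of the exploration phase -/
  betaE : ℝ
  /-- confidence radius of the planning phase -/
  betaP : ℝ
  α : ℝ
  γ : ℝ
  /-- the number `log N_V(ε)` -/
  logNV : ℝ

variable {S : Type u} {A : Type v}

/-- The pairs `(z_i, σ_i)` of the samples of one stage. -/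
def weights (l : List (Sample S A)) : List ((S × A) × ℝ) :=
  l.map fun x => (x.pair, x.sd)

/-- The regression data of one stage, with targets `r(z_i) + V(s'_i)`. -/
def regressionData (l : List (Sample S A)) (r : S × A → ℝ) (V : S → ℝ) :
    List ((S × A) × ℝ × ℝ) :=
  l.map fun x => (x.pair, x.sd, r x.pair + V x.next)

/-- Optimistic value functions computed backwards from the data for reward `r` and bonus `b`:
`V_H = 0` and `V_h(s) = max_a min (f_h(s, a) + b_h(s, a), 1)`, where `f_h` is the weighted
regression of `r_h + V_{h+1}`. -/
def backV (I : Input S A) (D : History S A) (r b : ℕ → S × A → ℝ) (h : ℕ) : S → ℝ :=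
  if h < I.H then
    fun s => ⨆ a, min (I.erm h (regressionData (D h) (r h) (backV I D r b (h + 1))) (s, a)
      + b h (s, a)) 1
  else 0
termination_by I.H - h

/-- The regression function `f_h`. -/
def backF (I : Input S A) (D : History S A) (r b : ℕ → S × A → ℝ) (h : ℕ) : S × A → ℝ :=
  I.erm h (regressionData (D h) (r h) (backV I D r b (h + 1)))

/-- The optimistic action value function. -/
def backQ (I : Input S A) (D : History S A) (r b : ℕ → S × A → ℝ) (h : ℕ) (z : S × A) : ℝ :=
  min (backF I D r b h z + b h z) 1

/-- The greedy policy with respect to the optimistic action value function. -/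
def backPolicy (I : Input S A) (D : History S A) (r b : ℕ → S × A → ℝ) (h : ℕ) (s : S) : A :=
  I.greedy fun a => backQ I D r b h (s, a)

/-- Exploration bonus `2 β^E D̄`. -/
def exploreBonus (I : Input S A) (D : History S A) (h : ℕ) (z : S × A) : ℝ :=
  2 * I.betaE * I.Dbar h (weights (D h)) z

/-- Intrinsic reward: half the bonus, cut off at `1`. -/
def exploreReward (I : Input S A) (D : History S A) (h : ℕ) (z : S × A) : ℝ :=
  min (exploreBonus I D h z / 2) 1

/-- Exploration policy after the data `D`. -/
def explorePolicy (I : Input S A) (D : History S A) : ℕ → S → A :=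
  backPolicy I D (exploreReward I D) (exploreBonus I D)

/-- The weight parameter given to the pair `z` at stage `h` of the episode that follows `D`:
`max {γ D̄^{1/2}, 2 (log N_V · min {f, 1})^{1/2}, α}`. -/
def exploreSd (I : Input S A) (D : History S A) (h : ℕ) (z : S × A) : ℝ :=
  max (I.γ * √(I.Dbar h (weights (D h)) z))
    (max (2 * √(I.logNV * min (backF I D (exploreReward I D) (exploreBonus I D) h z) 1)) I.α)

/-- Run `n` stages from stage `h` and state `s` with policy `π`, and append to the data `D`, at
every stage, the new sample with weight parameter `sd`. -/
def runStages (P : ℕ → S × A → PMF S) (π : ℕ → S → A) (sd : ℕ → S × A → ℝ) :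
    ℕ → ℕ → S → History S A → PMF (History S A)
  | 0, _, _, D => PMF.pure D
  | n + 1, h, s, D =>
      (P h (s, π h s)).bind fun s' =>
        runStages P π sd n (h + 1) s'
          (Function.update D h (D h ++ [⟨(s, π h s), s', sd h (s, π h s)⟩]))

/-- The law of the data after the exploration phase of `K` episodes. -/
def exploration (I : Input S A) (P : ℕ → S × A → PMF S) (μ : PMF S) : ℕ → PMF (History S A)
  | 0 => PMF.pure fun _ => []
  | K + 1 =>
      (exploration I P μ K).bind fun D =>
        μ.bind fun s => runStages P (explorePolicy I D) (exploreSd I D) I.H 0 s D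

/-- Planning bonus `min {β^P D̄, 1}`. -/
def planBonus (I : Input S A) (D : History S A) (h : ℕ) (z : S × A) : ℝ :=
  min (I.betaP * I.Dbar h (weights (D h)) z) 1

/-- The policy returned by the planning phase for the data `D` and the reward `r`. -/
def planPolicy (I : Input S A) (D : History S A) (r : ℕ → S × A → ℝ) : ℕ → S → A :=
  backPolicy I D r (planBonus I D)

/-! ### The sample complexity -/

/-- `d_{K,δ} = max {log N_F(ε), dim_{α,K}(F)}` with `α = 1 / √H`. -/
def complexity (H : ℕ) (F : ℕ → Set (S × A → ℝ)) (lam ε : ℝ) (K : ℕ) : ℝ :=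
  max (Real.log (coverF H F ε)) (eluderDimF H F lam (1 / √H) K)

/-- The logarithmic factor `log (e + K H / (ε δ))`. -/
def logFactor (H K : ℕ) (ε δ : ℝ) : ℝ := Real.log (Real.exp 1 + K * H / (ε * δ))

/-- The number of episodes `c · logFactor ^ p · H⁴ d² / ε²`, with the burn-in factor
`max {1, ε log N_F(ε)}`, which equals `1` for all small `ε` (as soon as `ε log N_F(ε) ≤ 1`). -/
def sampleBound (c : ℝ) (p H : ℕ) (F : ℕ → Set (S × A → ℝ)) (lam ε δ : ℝ) (K : ℕ) : ℝ :=
  c * logFactor H K ε δ ^ p * (H ^ 4 * complexity H F lam ε K ^ 2 / ε ^ 2)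
    * max 1 (ε * Real.log (coverF H F ε))

/-- The algorithm with `α = 1 / √H`, `γ = √(log N_V(ε))`, and confidence radii `βE`, `βP`. The
exploration phase adds the bonus `2 βE D̄`, hence `N_V` is taken with `β = 2 βE`. -/
def gfaRfe (H : ℕ) (F : ℕ → Set (S × A → ℝ)) (Dbar : ℕ → List ((S × A) × ℝ) → S × A → ℝ)
    (erm : ℕ → List ((S × A) × ℝ × ℝ) → S × A → ℝ) (greedy : (A → ℝ) → A)
    (ε βE βP : ℝ) : Input S A where
  H := H
  Dbar := Dbar
  erm := erm
  greedy := greedy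
  betaE := βE
  betaP := βP
  α := 1 / √H
  γ := √(Real.log (coverV H F Dbar (2 * βE) ε))
  logNV := Real.log (coverV H F Dbar (2 * βE) ε)

/-- For the data `D`, every admissible reward `r` is planned for successfully: the policy returned
for the rescaled reward `r / H` is `ε`-optimal for `r`, with initial distribution `μ`. -/
def PlansWell (I : Input S A) (P : ℕ → S × A → PMF S) (μ : PMF S) (ε : ℝ)
    (D : History S A) : Prop :=
  ∀ r : ℕ → S × A → ℝ, AdmissibleReward I.H P μ r →
    expect μ (fun s => optValue I.H P r 0 s
      - value I.H P r (planPolicy I D fun h z => r h z / I.H) 0 s) ≤ ε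

end

end GFARFE

/-!
Completeness of `F h` refers to *every* reward with values in `[0, 1]`. For an indicator reward and
the constant continuation value `1`, its second-moment part says that `F h` contains the function
`corner B`, with value `4` on `B` and `1` off it, for every set `B` of state-action pairs. Distinct
corners have sup-norm distance `3`, so a finite cover of small radius needs a centre for each `B`.
Hence `S × A` is finite and `|S × A| * log 2 ≤ log N_F(ε)`: the complexity `d` dominates the number
of state-action pairs, and the whole argument is run with `X = |S × A|`.

*Radius.* The bonuses lie in a bounded part of the finite-dimensional space of functions on `S × A`,
so `log N_V` grows only logarithmically with the radius. This allows one radius `β` of order `√(H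
X)` up to logarithms to be used in both phases, although the condition on the exploration radius
refers to the radius itself.

*Confidence.* For each test function from a finite family, an exponential supermartingale along the
exploration bounds the weighted sums of the noise (`exists_confident_certificate`); on the resulting
event the regression at every stage deviates from its target by at most the bonus, uniformly over
the rewards and the continuation values (`abs_regression_sub_le`).

*From exploration to planning.* The uncertainty shrinks as data accumulate. By optimism in both
phases, the loss of the planned policy, for any admissible reward, is at most a multiple of the
optimistic value `V_{k,1}` of every exploration episode `k`, hence of the average of these values
(`GoodData.regret_le`, `plansWell_of_total_le`).

*Regret.* The sum of the optimistic values is at most a multiple of the sum of the bonuses that were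
collected, plus a martingale term (`total_value_le`). A bonus `β D` is split into `t σ²` and `β² D²
/ (4 t σ²)`. The elliptical potential bounds `∑ min 1 (D² / σ²)` by a multiple of `H X` up to
logarithms, while `σ²` exceeds `1 / H` only by a multiple of bonuses and optimistic values, that is,
of the quantities being bounded; a small `t` absorbs them (`total_value_le_of_small`).
`parameter_choice` checks that `K ≥ T(K)` makes the average of the optimistic values at most of
order `ε`. Since `T` grows polylogarithmically in `K` and is monotone, the first `K` above it
satisfies `K ≤ 2 * T(K)` (`exists_episode_number`).
-/

namespace GFARFE

noncomputable section

/-! ### Expectations under discrete distributions -/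

/-- Expectation of a function with values in `[0, ∞]` under a discrete distribution. -/
def lexpect {X : Type*} (p : PMF X) (g : X → ENNReal) : ENNReal := ∑' x, p x * g x

theorem lexpect_mono {X : Type*} (p : PMF X) {g g' : X → ENNReal}
    (h : ∀ x ∈ p.support, g x ≤ g' x) : lexpect p g ≤ lexpect p g' := by
  refine ENNReal.tsum_le_tsum fun x => ?_
  by_cases hx : p x = 0
  · simp [hx]
  · exact mul_le_mul_right (h x ((p.mem_support_iff x).2 hx)) _

theorem lexpect_pure {X : Type*} (a : X) (g : X → ENNReal) : lexpect (PMF.pure a) g = g a := by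
  classical
  unfold lexpect
  rw [tsum_eq_single a]
  · simp
  · intro b hb; simp [PMF.pure_apply, hb]

theorem lexpect_bind {X Y : Type*} (p : PMF X) (f : X → PMF Y) (g : Y → ENNReal) :
    lexpect (p.bind f) g = lexpect p fun x => lexpect (f x) g := by
  unfold lexpect
  simp only [PMF.bind_apply, ← ENNReal.tsum_mul_right, ← ENNReal.tsum_mul_left]
  rw [ENNReal.tsum_comm]
  simp only [mul_assoc]

theorem lexpect_map {X Y : Type*} (p : PMF X) (f : X → Y) (g : Y → ENNReal) :
    lexpect (p.map f) g = lexpect p fun x => g (f x) := by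
  unfold PMF.map
  rw [lexpect_bind]
  simp [lexpect_pure]

theorem lexpect_const {X : Type*} (p : PMF X) (c : ENNReal) : lexpect p (fun _ => c) = c := by
  unfold lexpect
  rw [ENNReal.tsum_mul_right, p.tsum_coe, one_mul]

theorem lexpect_const_mul {X : Type*} (p : PMF X) (c : ENNReal) (g : X → ENNReal) :
    lexpect p (fun x => c * g x) = c * lexpect p g := by
  unfold lexpect
  rw [← ENNReal.tsum_mul_left]
  exact tsum_congr fun x => by ring

theorem lexpect_add {X : Type*} (p : PMF X) (g g' : X → ENNReal) :
    lexpect p (fun x => g x + g' x) = lexpect p g + lexpect p g' := by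
  unfold lexpect
  rw [← ENNReal.tsum_add]
  exact tsum_congr fun x => by ring

theorem lexpect_finset_sum {X ι : Type*} (p : PMF X) (t : Finset ι) (g : ι → X → ENNReal) :
    lexpect p (fun x => ∑ i ∈ t, g i x) = ∑ i ∈ t, lexpect p (g i) := by
  classical
  induction t using Finset.induction_on with
  | empty => simp [lexpect]
  | insert a t ha ih => simp only [Finset.sum_insert ha, lexpect_add, ih]

/-- If `g ≥ 1` off the set `G`, then `G` has probability at least `1 - E g`. -/
theorem ofReal_one_sub_le_toOuterMeasure {X : Type*} (p : PMF X) (G : Set X) (g : X → ENNReal)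
    (δ : ℝ) (hδ : 0 ≤ δ) (hg : ∀ x ∈ p.support, x ∉ G → 1 ≤ g x)
    (h : lexpect p g ≤ ENNReal.ofReal δ) : ENNReal.ofReal (1 - δ) ≤ p.toOuterMeasure G := by
  have h1 : (1 : ENNReal) ≤ p.toOuterMeasure G + lexpect p g := by
    rw [PMF.toOuterMeasure_apply, lexpect, ← ENNReal.tsum_add, ← p.tsum_coe]
    refine ENNReal.tsum_le_tsum fun x => ?_
    by_cases hx : x ∈ G
    · simp [hx]
    · by_cases h0 : p x = 0
      · simp [h0]
      · have := hg x ((p.mem_support_iff x).2 h0) hx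
        calc p x = 0 + p x * 1 := by simp
          _ ≤ _ := add_le_add (zero_le) (mul_le_mul_right this _)
  rw [ENNReal.ofReal_sub _ hδ, ENNReal.ofReal_one]
  exact tsub_le_iff_right.2 (h1.trans (add_le_add le_rfl h))

theorem expect_const {X : Type*} (p : PMF X) (c : ℝ) : expect p (fun _ => c) = c := by
  unfold expect
  rw [tsum_mul_right, ← ENNReal.tsum_toReal_eq p.apply_ne_top, p.tsum_coe, ENNReal.toReal_one,
    one_mul]

section Finite

variable {X : Type*} [Fintype X]

theorem expect_eq_sum (p : PMF X) (f : X → ℝ) : expect p f = ∑ x, (p x).toReal * f x :=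
  tsum_fintype _

theorem expect_add (p : PMF X) (f g : X → ℝ) :
    expect p (fun x => f x + g x) = expect p f + expect p g := by
  simp only [expect_eq_sum, mul_add, Finset.sum_add_distrib]

theorem expect_const_mul (p : PMF X) (c : ℝ) (f : X → ℝ) :
    expect p (fun x => c * f x) = c * expect p f := by
  simp only [expect_eq_sum, Finset.mul_sum]
  exact Finset.sum_congr rfl fun x _ => by ring

theorem expect_mono (p : PMF X) {f g : X → ℝ} (h : ∀ x ∈ p.support, f x ≤ g x) :
    expect p f ≤ expect p g := by
  simp only [expect_eq_sum]
  refine Finset.sum_le_sum fun x _ => ?_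
  by_cases hx : p x = 0
  · simp [hx]
  · exact mul_le_mul_of_nonneg_left (h x ((p.mem_support_iff x).2 hx)) ENNReal.toReal_nonneg

theorem expect_nonneg (p : PMF X) {f : X → ℝ} (h : ∀ x, 0 ≤ f x) : 0 ≤ expect p f := by
  rw [← expect_const p 0]; exact expect_mono p fun x _ => h x

theorem expect_le_one (p : PMF X) {f : X → ℝ} (h : ∀ x, f x ≤ 1) : expect p f ≤ 1 := by
  rw [← expect_const p 1]; exact expect_mono p fun x _ => h x

theorem lexpect_ofReal (p : PMF X) (f : X → ℝ) (h : ∀ x, 0 ≤ f x) :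
    lexpect p (fun x => ENNReal.ofReal (f x)) = ENNReal.ofReal (expect p f) := by
  rw [lexpect, tsum_fintype, expect_eq_sum,
    ENNReal.ofReal_sum_of_nonneg fun x _ => mul_nonneg ENNReal.toReal_nonneg (h x)]
  refine Finset.sum_congr rfl fun x _ => ?_
  rw [ENNReal.ofReal_mul ENNReal.toReal_nonneg, ENNReal.ofReal_toReal (p.apply_ne_top x)]

/-- Hoeffding's inequality for the moment generating function: the chord of `exp` over `[-a, a]`
gives the bound `cosh a`. -/
theorem expect_exp_le (p : PMF X) (f : X → ℝ) (a : ℝ) (ha : 0 ≤ a) (hf : ∀ x, |f x| ≤ a)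
    (h0 : expect p f = 0) : expect p (fun x => Real.exp (f x)) ≤ Real.exp (a ^ 2 / 2) := by
  rcases ha.eq_or_lt with rfl | ha
  · have : ∀ x, f x = 0 := fun x => abs_nonpos_iff.1 (hf x)
    simp [this, expect_const]
  refine le_trans ?_ (Real.cosh_le_exp_half_sq a)
  have key : ∀ x, Real.exp (f x) ≤ Real.cosh a + Real.sinh a / a * f x := by
    intro x
    have h1 := abs_le.1 (hf x)
    have hc := (convexOn_exp).2 (Set.mem_univ a) (Set.mem_univ (-a))
      (show 0 ≤ (a + f x) / (2 * a) from div_nonneg (by linarith) (by linarith))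
      (show 0 ≤ (a - f x) / (2 * a) from div_nonneg (by linarith) (by linarith))
      (by field_simp; ring)
    simp only [smul_eq_mul] at hc
    have e1 : (a + f x) / (2 * a) * a + (a - f x) / (2 * a) * -a = f x := by field_simp; ring
    rw [e1] at hc
    refine hc.trans (le_of_eq ?_)
    rw [Real.cosh_eq, Real.sinh_eq]
    field_simp
    ring
  calc expect p (fun x => Real.exp (f x))
      ≤ expect p (fun x => Real.cosh a + Real.sinh a / a * f x) := expect_mono p fun x _ => key x
    _ = Real.cosh a := by rw [expect_add, expect_const, expect_const_mul, h0]; ring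

/-- The form of `expect_exp_le` in which it is iterated along a random process. -/
theorem lexpect_exp_sub_le_one (p : PMF X) (f : X → ℝ) (a b : ℝ) (ha : 0 ≤ a)
    (hf : ∀ x, |f x| ≤ a) (h0 : expect p f = 0) (hb : a ^ 2 / 2 ≤ b) :
    lexpect p (fun x => ENNReal.ofReal (Real.exp (f x - b))) ≤ 1 := by
  rw [lexpect_ofReal _ _ fun x => (Real.exp_pos _).le, ← ENNReal.ofReal_one]
  refine ENNReal.ofReal_le_ofReal ?_
  have : (fun x => Real.exp (f x - b)) = fun x => Real.exp (-b) * Real.exp (f x) := by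
    funext x; rw [← Real.exp_add]; congr 1; ring
  rw [this, expect_const_mul]
  calc Real.exp (-b) * expect p (fun x => Real.exp (f x))
      ≤ Real.exp (-b) * Real.exp (a ^ 2 / 2) :=
        mul_le_mul_of_nonneg_left (expect_exp_le p f a ha hf h0) (Real.exp_pos _).le
    _ = Real.exp (a ^ 2 / 2 - b) := by rw [← Real.exp_add]; congr 1; ring
    _ ≤ 1 := by rw [Real.exp_le_one_iff]; linarith

end Finite

theorem expect_pure {X : Type*} (a : X) (f : X → ℝ) : expect (PMF.pure a) f = f a := by
  classical
  unfold expect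
  rw [tsum_eq_single a]
  · simp
  · intro b hb; simp [PMF.pure_apply, hb]

theorem summable_expect {X : Type*} (p : PMF X) (f : X → ℝ) (hp : p.support.Finite) :
    Summable fun x => (p x).toReal * f x := by
  refine summable_of_hasFiniteSupport (hp.subset fun x hx => ?_)
  rw [PMF.mem_support_iff]
  intro h0
  simp [h0] at hx

theorem expect_bind {X Y : Type*} [Fintype X] (p : PMF X) (q : X → PMF Y) (f : Y → ℝ)
    (hq : ∀ x, (q x).support.Finite) :
    expect (p.bind q) f = expect p fun x => expect (q x) f := by
  rw [expect_eq_sum p]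
  unfold expect
  simp only [← tsum_mul_left]
  rw [← Summable.tsum_finsetSum fun x _ => (summable_expect (q x) f (hq x)).mul_left _]
  refine tsum_congr fun y => ?_
  rw [PMF.bind_apply, tsum_fintype, ENNReal.toReal_sum fun x _ =>
    ENNReal.mul_ne_top (p.apply_ne_top x) ((q x).apply_ne_top y), Finset.sum_mul]
  exact Finset.sum_congr rfl fun x _ => by rw [ENNReal.toReal_mul, mul_assoc]

theorem expect_map {X Y : Type*} (p : PMF X) (g : X → Y) (f : Y → ℝ) (hp : p.support.Finite) :
    expect (p.map g) f = expect p fun x => f (g x) := by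
  classical
  have hs : (Function.support fun x => (p x).toReal * f (g x)).Finite := by
    refine hp.subset fun x hx => ?_
    rw [PMF.mem_support_iff]; intro h0; simp [h0] at hx
  unfold expect
  have h2 : ∀ y, ((p.map g) y).toReal * f y =
      ∑ x ∈ hp.toFinset, if y = g x then (p x).toReal * f (g x) else 0 := by
    intro y
    have h3 : (p.map g) y = ∑ x ∈ hp.toFinset, if y = g x then p x else 0 := by
      rw [PMF.map_apply, tsum_eq_sum]
      · intro x hx
        have : p x = 0 := by simpa [PMF.mem_support_iff] using hx
        simp [this]
    rw [h3, ENNReal.toReal_sum, Finset.sum_mul]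
    · refine Finset.sum_congr rfl fun x _ => ?_
      split_ifs with h
      · rw [h]
      · simp
    · intro x _; split_ifs
      · exact p.apply_ne_top x
      · simp
  simp only [h2]
  rw [Summable.tsum_finsetSum]
  · rw [tsum_eq_sum (s := hp.toFinset)]
    · refine Finset.sum_congr rfl fun x _ => ?_
      rw [tsum_ite_eq]
    · intro x hx
      have : p x = 0 := by simpa [PMF.mem_support_iff] using hx
      simp [this]
  · intro x _
    exact summable_of_hasFiniteSupport ((Set.finite_singleton (g x)).subset fun y hy => by
      simp only [Function.mem_support, ne_eq, ite_eq_right_iff, Classical.not_imp] at hy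
      exact hy.1)

/-! ### Completeness and finite covers force a finite state-action space -/

/-- The second moment condition of completeness for the constant continuation value `1`. -/
theorem sq_mem_of_complete {S : Type u} {A : Type v} {H : ℕ} {F : ℕ → Set (S × A → ℝ)}
    {P : ℕ → S × A → PMF S} (hc : Complete H F P) {h : ℕ} (hh : h < H) (r : S × A → ℝ)
    (hr : ∀ z, 0 ≤ r z ∧ r z ≤ 1) : (fun z => (r z + 1) ^ 2) ∈ F h := by
  have := (hc h hh (fun _ => 1) r (fun _ => ⟨zero_le_one, le_rfl⟩) hr).2
  simpa only [expect_const] using this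

open Classical in
/-- The function with value `4` on `B` and `1` off `B`; all of these belong to a complete class. -/
def corner {X : Type*} (B : Set X) (z : X) : ℝ := ((if z ∈ B then 1 else 0) + 1) ^ 2

theorem corner_mem {S : Type u} {A : Type v} {H : ℕ} {F : ℕ → Set (S × A → ℝ)}
    {P : ℕ → S × A → PMF S} (hc : Complete H F P) {h : ℕ} (hh : h < H) (B : Set (S × A)) :
    corner B ∈ F h := by
  classical
  exact sq_mem_of_complete hc hh (fun z => if z ∈ B then 1 else 0)
    fun z => by split_ifs <;> norm_num

/-- Distinct corners are at distance `3`, hence a cover of radius less than `3 / 2` has a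
different member near each of them. -/
theorem exists_injective_of_isCover {X : Type*} {G : Set (X → ℝ)} {η : ℝ} {N : Finset (X → ℝ)}
    (hN : IsCover G η N) (hG : ∀ B, corner B ∈ G) (hη : η < 3 / 2) :
    ∃ g : Set X → N, Function.Injective g := by
  classical
  choose g hg hd using fun B => hN.2 _ (hG B)
  refine ⟨fun B => ⟨g B, hg B⟩, fun B B' hBB => ?_⟩
  have e : g B = g B' := congrArg Subtype.val hBB
  ext z
  have h1 := abs_le.1 (hd B z)
  have h2 := abs_le.1 (hd B' z)
  rw [← e] at h2
  unfold corner at h1 h2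
  by_cases ha : z ∈ B <;> by_cases hb : z ∈ B' <;> simp only [ha, hb, if_true, if_false] at h1 h2 ⊢
  · linarith
  · linarith

theorem finite_of_corner_mem {X : Type*} {G : Set (X → ℝ)} (hF : HasFiniteCovers G)
    (hG : ∀ B, corner B ∈ G) : Finite X := by
  obtain ⟨N, hN⟩ := hF 1 one_pos
  obtain ⟨g, hg⟩ := exists_injective_of_isCover hN hG (by norm_num)
  have : Finite (Set X) := Finite.of_injective g hg
  exact Finite.of_injective (fun x : X => ({x} : Set X)) Set.singleton_injective

theorem exists_isCover_card {X : Type*} {G : Set (X → ℝ)} (hF : HasFiniteCovers G) {η : ℝ}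
    (hη : 0 < η) : ∃ N, IsCover G η N ∧ N.card = coveringNumber G η := by
  obtain ⟨N, hN⟩ := hF η hη
  exact Nat.sInf_mem (s := {n | ∃ N, IsCover G η N ∧ N.card = n}) ⟨_, N, hN, rfl⟩

theorem two_pow_le_coveringNumber {X : Type*} [Fintype X] {G : Set (X → ℝ)}
    (hF : HasFiniteCovers G) (hG : ∀ B, corner B ∈ G) {η : ℝ} (h0 : 0 < η) (hη : η < 3 / 2) :
    2 ^ Fintype.card X ≤ coveringNumber G η := by
  classical
  obtain ⟨N, hN, hc⟩ := exists_isCover_card hF h0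
  obtain ⟨g, hg⟩ := exists_injective_of_isCover hN hG hη
  rw [← hc, ← Fintype.card_set, ← Fintype.card_coe N]
  exact Fintype.card_le_of_injective g hg

theorem one_le_coveringNumber {X : Type*} {G : Set (X → ℝ)}
    (hF : HasFiniteCovers G) (hG : G.Nonempty) {η : ℝ} (h0 : 0 < η) :
    1 ≤ coveringNumber G η := by
  obtain ⟨N, hN, hc⟩ := exists_isCover_card hF h0
  obtain ⟨f, hf⟩ := hG
  obtain ⟨g, hg, -⟩ := hN.2 f hf
  rw [← hc]
  exact Finset.card_pos.2 ⟨g, hg⟩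

/-- Rounding the values down to multiples of `η` splits the class into few cells. -/
theorem coveringNumber_le {X : Type*} [Fintype X] {G : Set (X → ℝ)} {M η : ℝ} (hη : 0 < η)
    (hG : ∀ f ∈ G, ∀ z, 0 ≤ f z ∧ f z ≤ M) :
    coveringNumber G η ≤ (⌊M / η⌋₊ + 1) ^ Fintype.card X := by
  classical
  let c : G → X → Fin (⌊M / η⌋₊ + 1) := fun f z => ⟨⌊f.1 z / η⌋₊, Nat.lt_succ_of_le
    (Nat.floor_le_floor (div_le_div_of_nonneg_right (hG f.1 f.2 z).2 hη.le))⟩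
  let T : Finset (X → Fin (⌊M / η⌋₊ + 1)) := Finset.univ.filter fun t => ∃ f, c f = t
  let N : Finset (X → ℝ) := T.attach.image fun t => (Classical.choose (Finset.mem_filter.1 t.2).2).1
  have hN : IsCover G η N := by
    refine ⟨fun g hg => ?_, fun f hf => ?_⟩
    · obtain ⟨t, -, rfl⟩ := Finset.mem_image.1 (Finset.mem_coe.1 hg)
      exact Subtype.property _
    · have ht : c ⟨f, hf⟩ ∈ T := Finset.mem_filter.2 ⟨Finset.mem_univ _, _, rfl⟩
      refine ⟨_, Finset.mem_image.2 ⟨⟨_, ht⟩, Finset.mem_attach _ _, rfl⟩, fun x => ?_⟩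
      have hs := Classical.choose_spec (Finset.mem_filter.1 ht).2
      set g := Classical.choose (Finset.mem_filter.1 ht).2
      have e : ⌊g.1 x / η⌋₊ = ⌊f x / η⌋₊ := congrArg Fin.val (congrFun hs x)
      have hg0 : 0 ≤ g.1 x / η := div_nonneg (hG _ g.2 x).1 hη.le
      have hf0 : 0 ≤ f x / η := div_nonneg (hG f hf x).1 hη.le
      have a1 := Nat.floor_le hg0
      have a2 := Nat.lt_floor_add_one (g.1 x / η)
      have b1 := Nat.floor_le hf0
      have b2 := Nat.lt_floor_add_one (f x / η)
      rw [e] at a1 a2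
      have h1 : f x / η - g.1 x / η ≤ 1 := by linarith
      have h2 : g.1 x / η - f x / η ≤ 1 := by linarith
      rw [← sub_div, div_le_one hη] at h1 h2
      exact abs_le.2 ⟨by linarith, h1⟩
  have h1 : coveringNumber G η ≤ N.card := Nat.sInf_le ⟨N, hN, rfl⟩
  refine h1.trans (Finset.card_image_le.trans ?_)
  rw [Finset.card_attach]
  refine (Finset.card_le_univ T).trans (le_of_eq ?_)
  simp

/-! ### The uncertainty of a class on a finite domain -/

section Uncertainty

variable {X : Type*} {G : Set (X → ℝ)} {L lam : ℝ}

/-- The weighted square sum of `g` over the data. -/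
def sqSum (D : List (X × ℝ)) (g : X → ℝ) : ℝ := (D.map fun x => g x.1 ^ 2 / x.2 ^ 2).sum

theorem sqSum_nonneg (D : List (X × ℝ)) (g : X → ℝ) : 0 ≤ sqSum D g :=
  List.sum_nonneg fun a ha => by
    obtain ⟨x, -, rfl⟩ := List.mem_map.1 ha
    positivity

theorem sqSum_append (D D' : List (X × ℝ)) (g : X → ℝ) :
    sqSum (D ++ D') g = sqSum D g + sqSum D' g := by
  simp [sqSum]

theorem uncertaintySq_nonneg (hl : 0 < lam) (D : List (X × ℝ)) (z : X) :
    0 ≤ uncertaintySq G lam D z :=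
  Real.iSup_nonneg fun f => div_nonneg (sq_nonneg _)
    (add_nonneg (sqSum_nonneg D fun z => f.1.1 z - f.2.1 z) hl.le)

theorem sq_sub_le_sq (hG : ∀ f ∈ G, ∀ z, 0 ≤ f z ∧ f z ≤ L) (f g : G) (z : X) :
    (f.1 z - g.1 z) ^ 2 ≤ L ^ 2 := by
  have h1 := hG f.1 f.2 z
  have h2 := hG g.1 g.2 z
  exact sq_le_sq' (by linarith) (by linarith)

theorem bddAbove_uncertaintySq (hG : ∀ f ∈ G, ∀ z, 0 ≤ f z ∧ f z ≤ L) (hl : 0 < lam)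
    (D : List (X × ℝ)) (z : X) : BddAbove (Set.range fun f : G × G => (f.1.1 z - f.2.1 z) ^ 2 /
      ((D.map fun x => (f.1.1 x.1 - f.2.1 x.1) ^ 2 / x.2 ^ 2).sum + lam)) := by
  refine ⟨L ^ 2 / lam, ?_⟩
  rintro _ ⟨f, rfl⟩
  have := sqSum_nonneg D fun z => f.1.1 z - f.2.1 z
  exact div_le_div₀ (sq_nonneg _) (sq_sub_le_sq hG _ _ z) hl (by unfold sqSum at this; linarith)

theorem sq_sub_le_uncertaintySq_mul (hG : ∀ f ∈ G, ∀ z, 0 ≤ f z ∧ f z ≤ L) (hl : 0 < lam)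
    (D : List (X × ℝ)) {f g : X → ℝ} (hf : f ∈ G) (hg : g ∈ G) (z : X) :
    (f z - g z) ^ 2 ≤ uncertaintySq G lam D z * (sqSum D (fun z => f z - g z) + lam) := by
  have h0 := sqSum_nonneg D fun z => f z - g z
  rw [← div_le_iff₀ (by linarith)]
  exact le_ciSup (bddAbove_uncertaintySq hG hl D z) (⟨f, hf⟩, ⟨g, hg⟩)

theorem uncertaintySq_append_le (hG : ∀ f ∈ G, ∀ z, 0 ≤ f z ∧ f z ≤ L) (hl : 0 < lam)
    (D D' : List (X × ℝ)) (z : X) :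
    uncertaintySq G lam (D ++ D') z ≤ uncertaintySq G lam D z := by
  refine ciSup_mono (bddAbove_uncertaintySq hG hl D z) fun f => ?_
  have h0 := sqSum_nonneg D fun z => f.1.1 z - f.2.1 z
  have h1 := sqSum_nonneg D' fun z => f.1.1 z - f.2.1 z
  have h2 := sqSum_append D D' fun z => f.1.1 z - f.2.1 z
  unfold sqSum at h0 h1 h2
  exact div_le_div_of_nonneg_left (sq_nonneg _) (by linarith) (by linarith)

open Classical in
/-- The total weight `1 / σ²` of the visits to `z` recorded in the data. -/
def cumWeight (D : List (X × ℝ)) (z : X) : ℝ :=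
  (D.map fun x => if x.1 = z then 1 / x.2 ^ 2 else 0).sum

theorem cumWeight_nonneg (D : List (X × ℝ)) (z : X) : 0 ≤ cumWeight D z :=
  List.sum_nonneg fun a ha => by
    obtain ⟨x, -, rfl⟩ := List.mem_map.1 ha
    split_ifs <;> positivity

theorem cumWeight_mul_sq_le (D : List (X × ℝ)) (z : X) (g : X → ℝ) :
    cumWeight D z * g z ^ 2 ≤ sqSum D g := by
  induction D with
  | nil => simp [cumWeight, sqSum]
  | cons x D ih =>
    simp only [cumWeight, sqSum, List.map_cons, List.sum_cons] at ih ⊢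
    rw [add_mul]
    refine add_le_add ?_ ih
    split_ifs with h
    · rw [h]; exact le_of_eq (by ring)
    · rw [zero_mul]; positivity

/-- The only property of the class that enters here is its bound: the uncertainty is at most that
of the tabular class. -/
theorem uncertaintySq_le (hG : ∀ f ∈ G, ∀ z, 0 ≤ f z ∧ f z ≤ L) (hl : 0 < lam) (hL : 1 ≤ L)
    (D : List (X × ℝ)) (z : X) :
    uncertaintySq G lam D z ≤ L ^ 2 / (cumWeight D z + lam) := by
  have hW := cumWeight_nonneg D z
  refine Real.iSup_le (fun f => ?_) (by positivity)
  have h0 := sqSum_nonneg D fun z => f.1.1 z - f.2.1 z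
  have h1 := cumWeight_mul_sq_le D z fun z => f.1.1 z - f.2.1 z
  have h2 := sq_sub_le_sq hG f.1 f.2 z
  change _ / (sqSum D (fun z => f.1.1 z - f.2.1 z) + lam) ≤ _
  rw [div_le_div_iff₀ (by linarith) (by linarith)]
  have hL2 : 1 ≤ L ^ 2 := one_le_pow₀ hL
  nlinarith [mul_nonneg (sub_nonneg.2 hL2) h0, mul_nonneg (sub_nonneg.2 h2) hl.le]

theorem uncertaintySq_le_div (hG : ∀ f ∈ G, ∀ z, 0 ≤ f z ∧ f z ≤ L) (hl : 0 < lam) (hL : 1 ≤ L)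
    (D : List (X × ℝ)) (z : X) : uncertaintySq G lam D z ≤ L ^ 2 / lam :=
  (uncertaintySq_le hG hl hL D z).trans
    (div_le_div_of_nonneg_left (sq_nonneg _) hl (by linarith [cumWeight_nonneg D z]))

/-! ### The elliptical potential -/

/-- The logarithmic potential of the data. -/
def potential [Fintype X] (lam : ℝ) (D : List (X × ℝ)) : ℝ :=
  ∑ z, Real.log ((cumWeight D z + lam) / lam)

theorem potential_nil [Fintype X] (hl : 0 < lam) : potential lam ([] : List (X × ℝ)) = 0 := by
  simp [potential, cumWeight, hl.ne']

theorem cumWeight_concat_self (D : List (X × ℝ)) (x : X × ℝ) :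
    cumWeight (D ++ [x]) x.1 = cumWeight D x.1 + 1 / x.2 ^ 2 := by
  simp [cumWeight]

theorem cumWeight_concat_of_ne (D : List (X × ℝ)) (x : X × ℝ) {z : X} (h : z ≠ x.1) :
    cumWeight (D ++ [x]) z = cumWeight D z := by
  simp [cumWeight, h.symm]

theorem min_one_div_two_le_log {x : ℝ} (hx : 0 ≤ x) : min 1 x / 2 ≤ Real.log (1 + x) := by
  have h1 := Real.one_sub_inv_le_log_of_pos (show 0 < 1 + x by linarith)
  refine le_trans ?_ h1
  have : 1 - (1 + x)⁻¹ = x / (1 + x) := by field_simp; ring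
  rw [this, div_le_div_iff₀ two_pos (by linarith)]
  rcases le_total x 1 with h | h
  · rw [min_eq_right h]; nlinarith
  · rw [min_eq_left h]; nlinarith

theorem min_one_le_potential_sub [Fintype X] (hl : 0 < lam) (D : List (X × ℝ)) (x : X × ℝ) :
    min 1 (1 / x.2 ^ 2 / (cumWeight D x.1 + lam)) / 2 ≤
      potential lam (D ++ [x]) - potential lam D := by
  classical
  have hW := cumWeight_nonneg D x.1
  refine (min_one_div_two_le_log (by positivity)).trans (le_of_eq ?_)
  unfold potential
  rw [← Finset.sum_sub_distrib, Finset.sum_eq_single x.1]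
  · rw [cumWeight_concat_self, ← Real.log_div (by positivity) (by positivity)]
    congr 1
    field_simp
    ring
  · intro z _ hz
    rw [cumWeight_concat_of_ne D x hz, sub_self]
  · simp

theorem min_one_le_mul_potential_sub [Fintype X] (hG : ∀ f ∈ G, ∀ z, 0 ≤ f z ∧ f z ≤ L)
    (hl : 0 < lam) (hL : 1 ≤ L) {C : ℝ} (hC : 1 ≤ C) (D : List (X × ℝ)) (x : X × ℝ) :
    min 1 (C * uncertaintySq G lam D x.1 / x.2 ^ 2) ≤
      2 * C * L ^ 2 * (potential lam (D ++ [x]) - potential lam D) := by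
  have hL2 : 1 ≤ L ^ 2 := one_le_pow₀ hL
  have hCL : 1 ≤ C * L ^ 2 := one_le_mul_of_one_le_of_one_le hC hL2
  have hW := cumWeight_nonneg D x.1
  have h1 := min_one_le_potential_sub hl D x
  have h2 : C * uncertaintySq G lam D x.1 / x.2 ^ 2 ≤
      C * L ^ 2 * (1 / x.2 ^ 2 / (cumWeight D x.1 + lam)) := by
    calc _ ≤ C * (L ^ 2 / (cumWeight D x.1 + lam)) / x.2 ^ 2 := by
          gcongr; exact uncertaintySq_le hG hl hL D x.1
      _ = _ := by ring
  calc _ ≤ min (C * L ^ 2 * 1) (C * L ^ 2 * (1 / x.2 ^ 2 / (cumWeight D x.1 + lam))) :=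
        min_le_min (by linarith) h2
    _ = C * L ^ 2 * min 1 (1 / x.2 ^ 2 / (cumWeight D x.1 + lam)) :=
        (mul_min_of_nonneg _ _ (by linarith)).symm
    _ ≤ C * L ^ 2 * (2 * (potential lam (D ++ [x]) - potential lam D)) := by
        gcongr; linarith
    _ = _ := by ring

theorem cumWeight_le {α : ℝ} (hα : 0 < α) (D : List (X × ℝ)) (hD : ∀ x ∈ D, α ≤ x.2) (z : X) :
    cumWeight D z ≤ D.length / α ^ 2 := by
  induction D with
  | nil => simp [cumWeight]
  | cons x D ih =>
    have h1 := ih fun y hy => hD y (List.mem_cons_of_mem _ hy)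
    have h2 := hD x List.mem_cons_self
    simp only [cumWeight, List.map_cons, List.sum_cons, List.length_cons, Nat.cast_add,
      Nat.cast_one] at h1 ⊢
    rw [add_div, add_comm]
    refine add_le_add h1 ?_
    split_ifs
    · gcongr
    · positivity

theorem potential_le [Fintype X] {α : ℝ} (hl : 0 < lam) (hα : 0 < α) (D : List (X × ℝ))
    (hD : ∀ x ∈ D, α ≤ x.2) :
    potential lam D ≤ Fintype.card X * Real.log (1 + D.length / α ^ 2 / lam) := by
  unfold potential
  rw [← nsmul_eq_mul]
  refine Finset.sum_le_card_nsmul _ _ _ fun z _ => ?_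
  have hW := cumWeight_nonneg D z
  refine Real.log_le_log (by positivity) ?_
  rw [add_div, div_self hl.ne', add_comm]
  gcongr
  exact cumWeight_le hα D hD z

end Uncertainty

/-! ### The generalized eluder dimension on a finite domain -/

section Eluder

variable {X : Type u} {G : Set (X → ℝ)} {L lam : ℝ}

theorem bddAbove_eluderDim (α : ℝ) (K : ℕ) :
    BddAbove (Set.range fun w : {w : Fin K → X × ℝ // ∀ i, α ≤ (w i).2} =>
      ∑ i : Fin K, min 1
        (uncertaintySq G lam ((List.ofFn w.1).take i) (w.1 i).1 / (w.1 i).2 ^ 2)) := by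
  refine ⟨K, ?_⟩
  rintro _ ⟨w, rfl⟩
  refine (Finset.sum_le_sum fun i _ => min_le_left _ _).trans ?_
  simp

theorem eluderDim_mono (hl : 0 < lam) {α : ℝ} [Nonempty X] {K K' : ℕ} (hK : K ≤ K') :
    eluderDim G lam α K ≤ eluderDim G lam α K' := by
  induction hK with
  | refl => exact le_rfl
  | @step K' _ ih =>
    refine ih.trans ?_
    have : Nonempty {w : Fin K' → X × ℝ // ∀ i, α ≤ (w i).2} :=
      ⟨⟨fun _ => (Classical.arbitrary X, α), fun _ => le_rfl⟩⟩
    refine ciSup_le fun w => ?_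
    refine le_trans ?_ (le_ciSup (bddAbove_eluderDim α (K' + 1))
      ⟨Fin.snoc w.1 (Classical.arbitrary X, α), fun i => ?_⟩)
    · rw [Fin.sum_univ_castSucc]
      refine le_add_of_le_of_nonneg (le_of_eq (Finset.sum_congr rfl fun i _ => ?_)) ?_
      · rw [List.ofFn_succ_last]
        simp only [Fin.snoc_castSucc, Fin.val_castSucc]
        rw [List.take_append_of_le_length (by simp [i.2.le])]
      · exact le_min zero_le_one (div_nonneg (uncertaintySq_nonneg hl _ _) (sq_nonneg _))
    · refine Fin.lastCases ?_ (fun j => ?_) i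
      · simp
      · simpa using w.2 j

theorem sum_ofFn_take_le {Y : Type*} (g : List Y → Y → ℝ) (Φ : List Y → ℝ)
    (hg : ∀ l x, g l x ≤ Φ (l ++ [x]) - Φ l) :
    ∀ (K : ℕ) (w : Fin K → Y),
      ∑ i : Fin K, g ((List.ofFn w).take i) (w i) ≤ Φ (List.ofFn w) - Φ [] := by
  intro K
  induction K with
  | zero => intro w; simp
  | succ K ih =>
    intro w
    rw [Fin.sum_univ_castSucc, List.ofFn_succ_last]
    have h1 := ih fun i => w i.castSucc
    have h2 := hg (List.ofFn fun i => w i.castSucc) (w (Fin.last K))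
    have h3 : ∀ i : Fin K, (List.ofFn (fun i => w i.castSucc) ++ [w (Fin.last K)]).take
        (i.castSucc : Fin (K + 1)) = (List.ofFn fun i => w i.castSucc).take i := fun i => by
      rw [Fin.val_castSucc, List.take_append_of_le_length (by simp [i.2.le])]
    have h4 : (List.ofFn (fun i => w i.castSucc) ++ [w (Fin.last K)]).take
        (Fin.last K : Fin (K + 1)) = List.ofFn fun i => w i.castSucc := by
      rw [List.take_append_of_le_length (by simp), List.take_of_length_le (by simp)]
    simp only [h3, h4]
    linarith

theorem eluderDim_le [Fintype X] (hG : ∀ f ∈ G, ∀ z, 0 ≤ f z ∧ f z ≤ L) (hl : 0 < lam)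
    (hL : 1 ≤ L) {α : ℝ} (hα : 0 < α) (K : ℕ) :
    eluderDim G lam α K ≤
      2 * L ^ 2 * (Fintype.card X * Real.log (1 + K / α ^ 2 / lam)) := by
  have hlog : 0 ≤ Real.log (1 + K / α ^ 2 / lam) :=
    Real.log_nonneg (le_add_of_nonneg_right (by positivity))
  refine Real.iSup_le (fun w => ?_) (by positivity)
  have h1 := sum_ofFn_take_le (fun l x => min 1 (uncertaintySq G lam l x.1 / x.2 ^ 2))
    (fun l => 2 * L ^ 2 * potential lam l) (fun l x => by
      have := min_one_le_mul_potential_sub hG hl hL le_rfl l x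
      simp only [one_mul, mul_one] at this
      linarith) K w.1
  refine h1.trans ?_
  rw [potential_nil hl, mul_zero, sub_zero]
  gcongr
  have h2 := potential_le hl hα (List.ofFn w.1) (fun x hx => by
    obtain ⟨i, rfl⟩ := (List.mem_ofFn' _ _).1 hx
    exact w.2 i)
  rwa [List.length_ofFn] at h2

end Eluder

section

variable {S : Type u} {A : Type v}

/-! ### The exploration phase as a random list of episodes -/

/-- Law of the samples collected during `n` stages from stage `h` and state `s`. -/
def episodeLaw (P : ℕ → S × A → PMF S) (π : ℕ → S → A) (sd : ℕ → S × A → ℝ) :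
    ℕ → ℕ → S → PMF (List (Sample S A))
  | 0, _, _ => PMF.pure []
  | n + 1, h, s => (P h (s, π h s)).bind fun s' =>
      (episodeLaw P π sd n (h + 1) s').map fun e => ⟨(s, π h s), s', sd h (s, π h s)⟩ :: e

/-- Append the samples of an episode, which starts at stage `h`, to the data. -/
def appendEpisode : History S A → ℕ → List (Sample S A) → History S A
  | D, _, [] => D
  | D, h, x :: e => appendEpisode (Function.update D h (D h ++ [x])) (h + 1) e

/-- The data recorded by a list of episodes, newest first; an episode is given by its initial
state and its samples. -/
def historyOf : List (S × List (Sample S A)) → History S A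
  | [] => fun _ => []
  | e :: l => appendEpisode (historyOf l) 0 e.2

/-- Law of the list of the first `K` episodes of the exploration phase, newest first. The list
determines the data at all earlier times, which the final data set alone shows only implicitly. -/
def episodesLaw (I : Input S A) (P : ℕ → S × A → PMF S) (μ : PMF S) :
    ℕ → PMF (List (S × List (Sample S A)))
  | 0 => PMF.pure []
  | K + 1 => (episodesLaw I P μ K).bind fun l => μ.bind fun s =>
      (episodeLaw P (explorePolicy I (historyOf l)) (exploreSd I (historyOf l)) I.H 0 s).map
        fun e => (s, e) :: l

theorem runStages_eq_map (P : ℕ → S × A → PMF S) (π : ℕ → S → A) (sd : ℕ → S × A → ℝ) (n : ℕ) :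
    ∀ (h : ℕ) (s : S) (D : History S A),
      runStages P π sd n h s D = (episodeLaw P π sd n h s).map (appendEpisode D h) := by
  induction n with
  | zero => intro h s D; simp [runStages, episodeLaw, PMF.pure_map, appendEpisode]
  | succ n ih =>
    intro h s D
    simp only [runStages, episodeLaw, PMF.map_bind, PMF.map_comp, ih]
    rfl

theorem exploration_eq_map (I : Input S A) (P : ℕ → S × A → PMF S) (μ : PMF S) (K : ℕ) :
    exploration I P μ K = (episodesLaw I P μ K).map historyOf := by
  induction K with
  | zero => simp [exploration, episodesLaw, PMF.pure_map, historyOf]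
  | succ K ih =>
    simp only [exploration, episodesLaw, ih, PMF.map_bind, PMF.bind_map, PMF.map_comp,
      runStages_eq_map]
    rfl

theorem mem_support_episodeLaw_succ {P : ℕ → S × A → PMF S} {π : ℕ → S → A}
    {sd : ℕ → S × A → ℝ} {n h : ℕ} {s : S} {e : List (Sample S A)}
    (he : e ∈ (episodeLaw P π sd (n + 1) h s).support) :
    ∃ s' ∈ (P h (s, π h s)).support, ∃ e' ∈ (episodeLaw P π sd n (h + 1) s').support,
      e = ⟨(s, π h s), s', sd h (s, π h s)⟩ :: e' := by
  simp only [episodeLaw, PMF.mem_support_bind_iff, PMF.mem_support_map_iff] at he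
  obtain ⟨s', hs', e', he', rfl⟩ := he
  exact ⟨s', hs', e', he', rfl⟩

theorem mem_support_episodeLaw_zero {P : ℕ → S × A → PMF S} {π : ℕ → S → A}
    {sd : ℕ → S × A → ℝ} {h : ℕ} {s : S} {e : List (Sample S A)}
    (he : e ∈ (episodeLaw P π sd 0 h s).support) : e = [] := by
  simpa [episodeLaw] using he

theorem mem_support_episodesLaw_succ {I : Input S A} {P : ℕ → S × A → PMF S} {μ : PMF S} {K : ℕ}
    {l : List (S × List (Sample S A))} (hl : l ∈ (episodesLaw I P μ (K + 1)).support) :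
    ∃ l' ∈ (episodesLaw I P μ K).support, ∃ s ∈ μ.support,
      ∃ e ∈ (episodeLaw P (explorePolicy I (historyOf l')) (exploreSd I (historyOf l'))
        I.H 0 s).support, l = (s, e) :: l' := by
  simp only [episodesLaw, PMF.mem_support_bind_iff, PMF.mem_support_map_iff] at hl
  obtain ⟨l', hl', s, hs, e, he, rfl⟩ := hl
  exact ⟨l', hl', s, hs, e, he, rfl⟩

theorem mem_support_episodesLaw_of_suffix {I : Input S A} {P : ℕ → S × A → PMF S} {μ : PMF S}
    {l' : List (S × List (Sample S A))} : ∀ {K : ℕ} {l : List (S × List (Sample S A))},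
    l ∈ (episodesLaw I P μ K).support → l' <:+ l →
      ∃ k ≤ K, l' ∈ (episodesLaw I P μ k).support := by
  intro K
  induction K with
  | zero =>
    intro l hl h
    have e : l = [] := by simpa [episodesLaw] using hl
    subst e
    rw [List.suffix_nil] at h
    exact ⟨0, le_rfl, h ▸ hl⟩
  | succ K ih =>
    intro l hl h
    obtain ⟨l₁, hl₁, s, -, e, -, rfl⟩ := mem_support_episodesLaw_succ hl
    rcases List.suffix_cons_iff.1 h with rfl | h
    · exact ⟨K + 1, le_rfl, hl⟩
    · obtain ⟨k, hk, hk'⟩ := ih hl₁ h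
      exact ⟨k, by omega, hk'⟩

theorem length_of_mem_support_episodesLaw {I : Input S A} {P : ℕ → S × A → PMF S} {μ : PMF S} :
    ∀ {K : ℕ} {l : List (S × List (Sample S A))},
      l ∈ (episodesLaw I P μ K).support → l.length = K := by
  intro K
  induction K with
  | zero => intro l hl; simpa [episodesLaw] using hl
  | succ K ih =>
    intro l hl
    obtain ⟨l₁, hl₁, s, -, e, -, rfl⟩ := mem_support_episodesLaw_succ hl
    simp [ih hl₁]

theorem appendEpisode_of_lt (e : List (Sample S A)) : ∀ (D : History S A) (h h' : ℕ), h' < h →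
    appendEpisode D h e h' = D h' := by
  induction e with
  | nil => intro D h h' _; rfl
  | cons x e ih =>
    intro D h h' hh
    rw [appendEpisode, ih _ _ _ (by omega), Function.update_of_ne (by omega)]

theorem exists_appendEpisode_eq (e : List (Sample S A)) : ∀ (D : History S A) (h h' : ℕ),
    ∃ t, appendEpisode D h e h' = D h' ++ t ∧ t.length ≤ 1 := by
  induction e with
  | nil => intro D h h'; exact ⟨[], by simp [appendEpisode], by simp⟩
  | cons x e ih =>
    intro D h h'
    rw [appendEpisode]
    rcases eq_or_ne h' h with rfl | hne
    · exact ⟨[x], by rw [appendEpisode_of_lt _ _ _ _ (by omega), Function.update_self], by simp⟩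
    · obtain ⟨t, ht, hl⟩ := ih (Function.update D h (D h ++ [x])) (h + 1) h'
      exact ⟨t, by rw [ht, Function.update_of_ne hne], hl⟩

theorem exists_historyOf_eq_append {l l' : List (S × List (Sample S A))} (hl : l' <:+ l) (h : ℕ) :
    ∃ t, historyOf l h = historyOf l' h ++ t := by
  induction l with
  | nil => rw [List.suffix_nil] at hl; exact ⟨[], by simp [hl]⟩
  | cons e l ih =>
    rcases List.suffix_cons_iff.1 hl with rfl | hl
    · exact ⟨[], by simp⟩
    · obtain ⟨t, ht⟩ := ih hl
      obtain ⟨t', ht', -⟩ := exists_appendEpisode_eq e.2 (historyOf l) 0 h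
      exact ⟨t ++ t', by rw [historyOf, ht', ht, List.append_assoc]⟩

theorem length_historyOf_le (l : List (S × List (Sample S A))) (h : ℕ) :
    (historyOf l h).length ≤ l.length := by
  induction l with
  | nil => simp [historyOf]
  | cons e l ih =>
    obtain ⟨t, ht, hl⟩ := exists_appendEpisode_eq e.2 (historyOf l) 0 h
    rw [historyOf, ht]
    simp only [List.length_append, List.length_cons]
    omega

/-- The states that some behaviour visits at stage `h` with positive probability. -/
def Reachable (P : ℕ → S × A → PMF S) (μ : PMF S) : ℕ → S → Prop
  | 0, s => s ∈ μ.support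
  | h + 1, s' => ∃ s a, Reachable P μ h s ∧ s' ∈ (P h (s, a)).support

theorem forall_mem_appendEpisode {P : ℕ → S × A → PMF S} {μ : PMF S} {π : ℕ → S → A}
    {sd : ℕ → S × A → ℝ} {α : ℝ} (hsd : ∀ h z, α ≤ sd h z) (n : ℕ) :
    ∀ (h : ℕ) (s : S) (D : History S A), Reachable P μ h s →
      (∀ h', ∀ x ∈ D h', Reachable P μ h' x.pair.1 ∧ α ≤ x.sd) →
      ∀ e ∈ (episodeLaw P π sd n h s).support,
        ∀ h', ∀ x ∈ appendEpisode D h e h', Reachable P μ h' x.pair.1 ∧ α ≤ x.sd := by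
  induction n with
  | zero =>
    intro h s D _ hD e he
    rw [mem_support_episodeLaw_zero he]
    exact hD
  | succ n ih =>
    intro h s D hs hD e he
    obtain ⟨s', hs', e', he', rfl⟩ := mem_support_episodeLaw_succ he
    refine ih (h + 1) s' _ ⟨s, π h s, hs, hs'⟩ (fun h' x hx => ?_) e' he'
    rcases eq_or_ne h' h with rfl | hne
    · rw [Function.update_self, List.mem_append, List.mem_singleton] at hx
      rcases hx with hx | rfl
      · exact hD _ x hx
      · exact ⟨hs, hsd _ _⟩
    · rw [Function.update_of_ne hne] at hx
      exact hD _ x hx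

theorem forall_mem_historyOf {I : Input S A} {P : ℕ → S × A → PMF S} {μ : PMF S} :
    ∀ {K : ℕ} {l : List (S × List (Sample S A))}, l ∈ (episodesLaw I P μ K).support →
      ∀ h, ∀ x ∈ historyOf l h, Reachable P μ h x.pair.1 ∧ I.α ≤ x.sd := by
  intro K
  induction K with
  | zero =>
    intro l hl h x hx
    have e : l = [] := by simpa [episodesLaw] using hl
    simp [e, historyOf] at hx
  | succ K ih =>
    intro l hl
    obtain ⟨l₁, hl₁, s, hs, e, he, rfl⟩ := mem_support_episodesLaw_succ hl
    exact forall_mem_appendEpisode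
      (fun h z => (le_max_right _ _).trans (le_max_right _ _)) _ 0 s _ hs (ih hl₁) e he

/-! ### Exponential supermartingales -/

/-- An episode adds at most one sample to the data of stage `h₀`, and the exponential of its term
has mean at most one. -/
theorem lexpect_episodeLaw_exp_le (P : ℕ → S × A → PMF S) (π : ℕ → S → A) (sd : ℕ → S × A → ℝ)
    (h₀ : ℕ) (φ : Sample S A → ℝ)
    (hφ : ∀ z, lexpect (P h₀ z) (fun s' => ENNReal.ofReal (Real.exp (φ ⟨z, s', sd h₀ z⟩))) ≤ 1)
    (n : ℕ) : ∀ (h : ℕ) (s : S) (D : History S A),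
      lexpect (episodeLaw P π sd n h s)
        (fun e => ENNReal.ofReal (Real.exp ((appendEpisode D h e h₀).map φ).sum)) ≤
      ENNReal.ofReal (Real.exp ((D h₀).map φ).sum) := by
  induction n with
  | zero => intro h s D; simp [episodeLaw, lexpect_pure, appendEpisode]
  | succ n ih =>
    intro h s D
    simp only [episodeLaw, lexpect_bind, lexpect_map, appendEpisode]
    refine (lexpect_mono _ fun s' _ => ih (h + 1) s' _).trans ?_
    rcases eq_or_ne h₀ h with rfl | hne
    · simp only [Function.update_self, List.map_append, List.sum_append, List.map_cons,
        List.map_nil, List.sum_cons, List.sum_nil, add_zero, Real.exp_add,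
        ENNReal.ofReal_mul (Real.exp_pos _).le]
      rw [lexpect_const_mul]
      exact mul_le_of_le_one_right (zero_le) (hφ _)
    · simp only [Function.update_of_ne hne, lexpect_const, le_refl]

theorem lexpect_episodesLaw_exp_le (I : Input S A) (P : ℕ → S × A → PMF S) (μ : PMF S)
    (h₀ : ℕ) (φ : Sample S A → ℝ)
    (hφ : ∀ z σ, I.α ≤ σ →
      lexpect (P h₀ z) (fun s' => ENNReal.ofReal (Real.exp (φ ⟨z, s', σ⟩))) ≤ 1) (K : ℕ) :
    lexpect (episodesLaw I P μ K)
      (fun l => ENNReal.ofReal (Real.exp ((historyOf l h₀).map φ).sum)) ≤ 1 := by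
  induction K with
  | zero => simp [episodesLaw, lexpect_pure, historyOf]
  | succ K ih =>
    refine le_trans ?_ ih
    simp only [episodesLaw, lexpect_bind, lexpect_map, historyOf]
    refine lexpect_mono _ fun l _ => ?_
    refine (lexpect_mono _ fun s _ => lexpect_episodeLaw_exp_le P _ _ h₀ φ
      (fun z => hφ z _ ((le_max_right _ _).trans (le_max_right _ _))) _ 0 s _).trans ?_
    rw [lexpect_const]

/-- Sum over the samples of an episode that starts at stage `h`. -/
def sumFrom (f : ℕ → Sample S A → ℝ) : ℕ → List (Sample S A) → ℝ
  | _, [] => 0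
  | h, x :: e => f h x + sumFrom f (h + 1) e

/-- Sum over all episodes of a function `f₀` of the initial state and a function `f` of the
samples, both of which may depend on the data before the episode. -/
def total (f₀ : History S A → S → ℝ) (f : History S A → ℕ → Sample S A → ℝ) :
    List (S × List (Sample S A)) → ℝ
  | [] => 0
  | e :: l => total f₀ f l + (f₀ (historyOf l) e.1 + sumFrom (f (historyOf l)) 0 e.2)

theorem lexpect_exp_sumFrom_le (P : ℕ → S × A → PMF S) (π : ℕ → S → A) (sd : ℕ → S × A → ℝ)
    (f : ℕ → Sample S A → ℝ) {H : ℕ} (hf : ∀ h < H, ∀ z σ,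
      lexpect (P h z) (fun s' => ENNReal.ofReal (Real.exp (f h ⟨z, s', σ⟩))) ≤ 1)
    (n : ℕ) : ∀ (h : ℕ) (s : S), h + n ≤ H → lexpect (episodeLaw P π sd n h s)
      (fun e => ENNReal.ofReal (Real.exp (sumFrom f h e))) ≤ 1 := by
  induction n with
  | zero => intro h s _; simp [episodeLaw, lexpect_pure, sumFrom]
  | succ n ih =>
    intro h s hn
    simp only [episodeLaw, lexpect_bind, lexpect_map, sumFrom, Real.exp_add,
      ENNReal.ofReal_mul (Real.exp_pos _).le, lexpect_const_mul]
    refine le_trans (lexpect_mono _ fun s' _ => ?_) (hf h (by omega) (s, π h s) (sd h (s, π h s)))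
    exact mul_le_of_le_one_right (zero_le) (ih (h + 1) s' (by omega))

/-- Version of `lexpect_episodesLaw_exp_le` for a process that receives a term from every stage of
every episode and from the initial states, where the terms may depend on the earlier episodes. -/
theorem lexpect_exp_total_le (I : Input S A) (P : ℕ → S × A → PMF S) (μ : PMF S)
    (f₀ : History S A → S → ℝ) (f : History S A → ℕ → Sample S A → ℝ)
    (h₀ : ∀ D : History S A, (∀ h, ∀ x ∈ D h, I.α ≤ x.sd) →
      lexpect μ (fun s => ENNReal.ofReal (Real.exp (f₀ D s))) ≤ 1)
    (hf : ∀ D : History S A, (∀ h, ∀ x ∈ D h, I.α ≤ x.sd) → ∀ h < I.H, ∀ z σ,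
      lexpect (P h z) (fun s' => ENNReal.ofReal (Real.exp (f D h ⟨z, s', σ⟩))) ≤ 1) (K : ℕ) :
    lexpect (episodesLaw I P μ K) (fun l => ENNReal.ofReal (Real.exp (total f₀ f l))) ≤ 1 := by
  induction K with
  | zero => simp [episodesLaw, lexpect_pure, total]
  | succ K ih =>
    refine le_trans ?_ ih
    simp only [episodesLaw, lexpect_bind, lexpect_map, total, Real.exp_add,
      ENNReal.ofReal_mul (Real.exp_pos _).le, lexpect_const_mul]
    refine lexpect_mono _ fun l hl => mul_le_of_le_one_right (zero_le) ?_
    have hsd := fun h x hx => (forall_mem_historyOf hl h x hx).2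
    refine le_trans (lexpect_mono _ fun s _ => ?_) (h₀ (historyOf l) hsd)
    exact mul_le_of_le_one_right (zero_le)
      (lexpect_exp_sumFrom_le P _ _ _ (hf (historyOf l) hsd) _ 0 s (by omega))

/-- Union bound over the times `0, …, K`: the suffixes of the list of episodes are the lists of
episodes at the earlier times. -/
theorem lexpect_sum_tails_le (I : Input S A) (P : ℕ → S × A → PMF S) (μ : PMF S)
    (g : List (S × List (Sample S A)) → ENNReal) (b : ENNReal)
    (hg : ∀ k, lexpect (episodesLaw I P μ k) g ≤ b) (K : ℕ) :
    lexpect (episodesLaw I P μ K) (fun l => (l.tails.map g).sum) ≤ (K + 1) * b := by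
  induction K with
  | zero => simpa [episodesLaw, lexpect_pure] using hg 0
  | succ K ih =>
    have h1 := hg (K + 1)
    simp only [episodesLaw, lexpect_bind, lexpect_map] at h1
    simp only [episodesLaw, lexpect_bind, lexpect_map, List.tails_cons, List.map_cons,
      List.sum_cons, lexpect_add, lexpect_const]
    refine (add_le_add h1 ih).trans (le_of_eq ?_)
    push_cast
    ring

/-! ### Sums over episodes -/

theorem sumFrom_add (f g : ℕ → Sample S A → ℝ) (e : List (Sample S A)) : ∀ h,
    sumFrom (fun h x => f h x + g h x) h e = sumFrom f h e + sumFrom g h e := by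
  induction e with
  | nil => intro h; simp [sumFrom]
  | cons x e ih => intro h; simp only [sumFrom, ih]; ring

theorem sumFrom_const_mul (c : ℝ) (f : ℕ → Sample S A → ℝ) (e : List (Sample S A)) : ∀ h,
    sumFrom (fun h x => c * f h x) h e = c * sumFrom f h e := by
  induction e with
  | nil => intro h; simp [sumFrom]
  | cons x e ih => intro h; simp only [sumFrom, ih]; ring

theorem total_add (f₀ g₀ : History S A → S → ℝ) (f g : History S A → ℕ → Sample S A → ℝ)
    (l : List (S × List (Sample S A))) :
    total (fun D s => f₀ D s + g₀ D s) (fun D h x => f D h x + g D h x) l =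
      total f₀ f l + total g₀ g l := by
  induction l with
  | nil => simp [total]
  | cons e l ih => simp only [total, ih, sumFrom_add]; ring

theorem total_const_mul (c : ℝ) (f₀ : History S A → S → ℝ) (f : History S A → ℕ → Sample S A → ℝ)
    (l : List (S × List (Sample S A))) :
    total (fun D s => c * f₀ D s) (fun D h x => c * f D h x) l = c * total f₀ f l := by
  induction l with
  | nil => simp [total]
  | cons e l ih => simp only [total, ih, sumFrom_const_mul]; ring

end

section

variable {S : Type u} {A : Type v}

/-! ### Confidence sets of the weighted regression -/

/-- The assumptions of the theorem on the input of the algorithm, with the consequences `1 ≤ L`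
and `1 ≤ C`; both phases use the same confidence radius, and `Λ` is the logarithm of the number of
test functions divided by the probability of failure. -/
structure Setting (I : Input S A) (F : ℕ → Set (S × A → ℝ)) (P : ℕ → S × A → PMF S)
    (C L lam Λ : ℝ) : Prop where
  H_pos : 0 < I.H
  lam_pos : 0 < lam
  one_le_L : 1 ≤ L
  one_le_C : 1 ≤ C
  bounded : BoundedClass I.H F L
  oracle : IsBonusOracle I.H F lam C I.Dbar
  regression : IsRegression I.H F I.erm
  argmax : IsArgmax I.greedy
  complete : Complete I.H F P
  α_eq : I.α = 1 / √(I.H : ℝ)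
  betaP_eq : I.betaP = I.betaE
  γ_eq : I.γ = √I.logNV
  logNV_nonneg : 0 ≤ I.logNV
  one_le_betaE : 1 ≤ I.betaE
  radius : 16 * I.H * Λ + 5 + lam ≤ I.betaE ^ 2

theorem Setting.betaE_nonneg {I : Input S A} {F : ℕ → Set (S × A → ℝ)} {P : ℕ → S × A → PMF S}
    {C L lam Λ : ℝ} (M : Setting I F P C L lam Λ) : 0 ≤ I.betaE :=
  zero_le_one.trans M.one_le_betaE

/-- The weighted correlation of `g` with the noise `V(s') - P V` in the samples of one stage. -/
def crossSum (P : ℕ → S × A → PMF S) (h : ℕ) (l : List (Sample S A)) (g : S × A → ℝ)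
    (V : S → ℝ) : ℝ :=
  (l.map fun x => g x.pair / x.sd ^ 2 * (V x.next - expect (P h x.pair) V)).sum

open Classical in
/-- The indicator function of a finite set of states. -/
def indic (B : Finset S) (s : S) : ℝ := if s ∈ B then 1 else 0

/-- A function with values in the grid of mesh `1 / m` that starts at `-L`. -/
def gridFun (L : ℝ) (m : ℕ) {n : ℕ} (j : S × A → Fin n) (z : S × A) : ℝ := -L + (j z : ℕ) / m

/-- The samples of stage `h` are not atypical: the noise correlates weakly with every function on
the grid. Indicator functions suffice as test functions, because the correlation is linear in the
value function. -/
def Confident (P : ℕ → S × A → PMF S) (H K : ℕ) (L Λ : ℝ) (h : ℕ) (l : List (Sample S A)) :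
    Prop :=
  ∀ (B : Finset S) (j : S × A → Fin (⌊2 * L * (H * K : ℕ)⌋₊ + 1)),
    crossSum P h l (gridFun L (H * K) j) (indic B) ≤
      4 * H * Λ + sqSum (weights l) (gridFun L (H * K) j) / 8

theorem one_div_sq_le {H : ℕ} (hH : 0 < H) {σ : ℝ} (hσ : 1 / √(H : ℝ) ≤ σ) :
    0 < σ ∧ 1 / σ ^ 2 ≤ H := by
  have hH' : (0 : ℝ) < H := Nat.cast_pos.2 hH
  have h0 : 0 < 1 / √(H : ℝ) := by positivity
  refine ⟨h0.trans_le hσ, ?_⟩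
  have h1 : (1 / √(H : ℝ)) ^ 2 ≤ σ ^ 2 := pow_le_pow_left₀ h0.le hσ 2
  rw [div_pow, one_pow, Real.sq_sqrt hH'.le] at h1
  rw [one_div_le (pow_pos (h0.trans_le hσ) 2) hH']
  exact h1

theorem abs_sub_expect_le [Fintype S] (p : PMF S) {V : S → ℝ} (hV : ∀ s, 0 ≤ V s ∧ V s ≤ 1)
    (s : S) : |V s - expect p V| ≤ 1 := by
  have h1 := expect_nonneg p fun s => (hV s).1
  have h2 := expect_le_one p fun s => (hV s).2
  have h3 := hV s
  exact abs_le.2 ⟨by linarith, by linarith⟩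

theorem expect_sub_expect [Fintype S] (p : PMF S) (V : S → ℝ) (c : ℝ) :
    expect p (fun s => c * (V s - expect p V)) = 0 := by
  rw [expect_const_mul]
  have : (fun s => V s - expect p V) = fun s => V s + -expect p V := by funext s; ring
  rw [this, expect_add, expect_const]
  ring

/-- The correlation is linear in the value function, hence maximal over the cube at a vertex. -/
theorem crossSum_le_indic [Fintype S] (P : ℕ → S × A → PMF S) (h : ℕ) (l : List (Sample S A))
    (g : S × A → ℝ) {V : S → ℝ} (hV : ∀ s, 0 ≤ V s ∧ V s ≤ 1) :
    ∃ B : Finset S, crossSum P h l g V ≤ crossSum P h l g (indic B) := by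
  classical
  have lin : ∀ V : S → ℝ, crossSum P h l g V = ∑ s, V s * crossSum P h l g (indic {s}) := by
    intro V
    induction l with
    | nil => simp [crossSum]
    | cons x l ih =>
      simp only [crossSum, List.map_cons, List.sum_cons, mul_add, Finset.sum_add_distrib] at ih ⊢
      rw [ih]
      congr 1
      have e1 : V x.next = ∑ s, V s * indic {s} x.next := by
        simp [indic]
      have e2 : expect (P h x.pair) V = ∑ s, V s * expect (P h x.pair) (indic {s}) := by
        simp only [expect_eq_sum, Finset.mul_sum]
        rw [Finset.sum_comm]
        refine Finset.sum_congr rfl fun y _ => ?_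
        simp [indic, mul_comm]
      rw [e1, e2, ← Finset.sum_sub_distrib, Finset.mul_sum]
      exact Finset.sum_congr rfl fun s _ => by ring
  refine ⟨Finset.univ.filter fun s => 0 < crossSum P h l g (indic {s}), ?_⟩
  rw [lin V, lin (indic _)]
  refine Finset.sum_le_sum fun s _ => ?_
  by_cases hs : 0 < crossSum P h l g (indic {s})
  · simp only [indic, Finset.mem_filter, Finset.mem_univ, true_and, hs, if_true, one_mul]
    exact mul_le_of_le_one_left hs.le (hV s).2
  · have : indic (Finset.univ.filter fun s => 0 < crossSum P h l g (indic {s})) s = 0 := by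
      simp [indic, not_lt.1 hs]
    rw [this, zero_mul]
    exact mul_nonpos_of_nonneg_of_nonpos (hV s).1 (not_lt.1 hs)

theorem crossSum_le_of_abs_sub_le [Fintype S] (P : ℕ → S × A → PMF S) {H : ℕ} (hH : 0 < H) (h : ℕ)
    (l : List (Sample S A)) (hl : ∀ x ∈ l, 1 / √(H : ℝ) ≤ x.sd) {g g' : S × A → ℝ} {ρ : ℝ}
    (hg : ∀ z, |g z - g' z| ≤ ρ) {V : S → ℝ} (hV : ∀ s, 0 ≤ V s ∧ V s ≤ 1) :
    crossSum P h l g V ≤ crossSum P h l g' V + ρ * H * l.length := by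
  induction l with
  | nil => simp [crossSum]
  | cons x l ih =>
    have ih := ih fun y hy => hl y (List.mem_cons_of_mem _ hy)
    obtain ⟨hσ, hw⟩ := one_div_sq_le hH (hl x List.mem_cons_self)
    simp only [crossSum, List.map_cons, List.sum_cons, List.length_cons] at ih ⊢
    have h1 := abs_sub_expect_le (P h x.pair) hV x.next
    set ξ := V x.next - expect (P h x.pair) V
    have h2 : (g x.pair - g' x.pair) * (1 / x.sd ^ 2) * ξ ≤ ρ * H := by
      refine (le_abs_self _).trans ?_
      rw [abs_mul, abs_mul, abs_of_nonneg (show 0 ≤ 1 / x.sd ^ 2 by positivity)]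
      have hρ := (abs_nonneg _).trans (hg x.pair)
      calc _ ≤ ρ * H * 1 := by gcongr; exact hg _
        _ = _ := mul_one _
    push_cast
    have h3 : g x.pair / x.sd ^ 2 * ξ = g' x.pair / x.sd ^ 2 * ξ +
      (g x.pair - g' x.pair) * (1 / x.sd ^ 2) * ξ := by ring
    linarith

theorem sqSum_le_of_abs_sub_le {H : ℕ} (hH : 0 < H)
    (l : List (Sample S A)) (hl : ∀ x ∈ l, 1 / √(H : ℝ) ≤ x.sd) {g g' : S × A → ℝ} {ρ : ℝ}
    (hg : ∀ z, |g z - g' z| ≤ ρ) :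
    sqSum (weights l) g' ≤ 2 * sqSum (weights l) g + 2 * ρ ^ 2 * H * l.length := by
  induction l with
  | nil => simp [sqSum, weights]
  | cons x l ih =>
    have ih := ih fun y hy => hl y (List.mem_cons_of_mem _ hy)
    obtain ⟨hσ, hw⟩ := one_div_sq_le hH (hl x List.mem_cons_self)
    simp only [sqSum, weights, List.map_cons, List.sum_cons, List.length_cons] at ih ⊢
    have h1 : (g x.pair - g' x.pair) ^ 2 ≤ ρ ^ 2 :=
      sq_le_sq' (abs_le.1 (hg _)).1 (abs_le.1 (hg _)).2
    have h2 : g' x.pair ^ 2 ≤ 2 * g x.pair ^ 2 + 2 * ρ ^ 2 := by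
      nlinarith [sq_nonneg (2 * g x.pair - g' x.pair)]
    have h3 : g' x.pair ^ 2 / x.sd ^ 2 ≤ 2 * (g x.pair ^ 2 / x.sd ^ 2) + 2 * ρ ^ 2 * H := by
      calc _ ≤ (2 * g x.pair ^ 2 + 2 * ρ ^ 2) / x.sd ^ 2 := by gcongr
        _ = 2 * (g x.pair ^ 2 / x.sd ^ 2) + 2 * ρ ^ 2 * (1 / x.sd ^ 2) := by ring
        _ ≤ _ := by gcongr
    push_cast
    linarith

theorem weightedLoss_sub (P : ℕ → S × A → PMF S) (h : ℕ) (l : List (Sample S A))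
    (f f' r : S × A → ℝ) (V : S → ℝ)
    (hf : ∀ x ∈ l, f' x.pair = r x.pair + expect (P h x.pair) V) :
    weightedLoss f (regressionData l r V) - weightedLoss f' (regressionData l r V) =
      sqSum (weights l) (fun z => f z - f' z) - 2 * crossSum P h l (fun z => f z - f' z) V := by
  induction l with
  | nil => simp [weightedLoss, regressionData, sqSum, weights, crossSum]
  | cons x l ih =>
    have ih := ih fun y hy => hf y (List.mem_cons_of_mem _ hy)
    have e := hf x List.mem_cons_self
    simp only [weightedLoss, regressionData, sqSum, weights, crossSum, List.map_cons,
      List.sum_cons] at ih ⊢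
    have : (f x.pair - (r x.pair + V x.next)) ^ 2 / x.sd ^ 2 -
        (f' x.pair - (r x.pair + V x.next)) ^ 2 / x.sd ^ 2 =
        (f x.pair - f' x.pair) ^ 2 / x.sd ^ 2 - 2 * ((f x.pair - f' x.pair) / x.sd ^ 2 *
          (V x.next - expect (P h x.pair) V)) := by
      rw [e]; ring
    linarith

theorem exists_gridFun_near {L : ℝ} {m : ℕ} (hm : 0 < m) (g : S × A → ℝ)
    (hg : ∀ z, -L ≤ g z ∧ g z ≤ L) :
    ∃ j : S × A → Fin (⌊2 * L * m⌋₊ + 1), ∀ z, |g z - gridFun L m j z| ≤ 1 / m := by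
  have hm' : (0 : ℝ) < m := Nat.cast_pos.2 hm
  refine ⟨fun z => ⟨⌊(g z + L) * m⌋₊, Nat.lt_succ_of_le (Nat.floor_le_floor ?_)⟩, fun z => ?_⟩
  · have := (hg z).2
    gcongr
    linarith
  · have h0 : 0 ≤ (g z + L) * m := mul_nonneg (by linarith [(hg z).1]) hm'.le
    have h1 := Nat.floor_le h0
    have h2 := Nat.lt_floor_add_one ((g z + L) * m)
    unfold gridFun
    dsimp only
    have e : g z - (-L + (⌊(g z + L) * m⌋₊ : ℝ) / m) =
        ((g z + L) * m - ⌊(g z + L) * m⌋₊) / m := by field_simp; ring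
    rw [e, abs_of_nonneg (div_nonneg (by linarith) hm'.le)]
    exact div_le_div_of_nonneg_right (by linarith) hm'.le

/-- Least squares: the minimizer `f` beats `f'`, so that the square sum of `f - f'` is at most its
correlation with the noise, which is small for confident data. -/
theorem sqSum_sub_le [Fintype S] {P : ℕ → S × A → PMF S} {H K : ℕ} (hH : 0 < H)
    (hK : 0 < K) {L Λ : ℝ} {h : ℕ}
    {l : List (Sample S A)} (hl : ∀ x ∈ l, 1 / √(H : ℝ) ≤ x.sd) (hlen : l.length ≤ K)
    (hc : Confident P H K L Λ h l) {f f' r : S × A → ℝ} {V : S → ℝ}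
    (hV : ∀ s, 0 ≤ V s ∧ V s ≤ 1) (hf : ∀ z, 0 ≤ f z ∧ f z ≤ L) (hf' : ∀ z, 0 ≤ f' z ∧ f' z ≤ L)
    (hfr : ∀ x ∈ l, f' x.pair = r x.pair + expect (P h x.pair) V)
    (hle : weightedLoss f (regressionData l r V) ≤ weightedLoss f' (regressionData l r V)) :
    sqSum (weights l) (fun z => f z - f' z) ≤ 16 * H * Λ + 5 := by
  have h1 := weightedLoss_sub P h l f f' r V hfr
  have hm : 0 < H * K := Nat.mul_pos hH hK
  obtain ⟨j, hj⟩ := exists_gridFun_near (L := L) hm (fun z => f z - f' z) fun z =>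
    ⟨by linarith [(hf z).1, (hf' z).2], by linarith [(hf z).2, (hf' z).1]⟩
  have h2 := crossSum_le_of_abs_sub_le P hH h l hl hj hV
  have h3 := sqSum_le_of_abs_sub_le hH l hl hj
  obtain ⟨B, hB⟩ := crossSum_le_indic P h l (gridFun L (H * K) j) hV
  have h4 := hc B j
  have hH' : (0 : ℝ) < H := Nat.cast_pos.2 hH
  have hK' : (0 : ℝ) < K := Nat.cast_pos.2 hK
  have hlen' : (l.length : ℝ) ≤ K := Nat.cast_le.2 hlen
  have h5 : 1 / ((H * K : ℕ) : ℝ) * H * l.length ≤ 1 := by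
    push_cast
    calc _ ≤ 1 / ((H : ℝ) * K) * H * K := by gcongr
      _ = 1 := by field_simp
  have h6 : 2 * (1 / ((H * K : ℕ) : ℝ)) ^ 2 * H * l.length ≤ 2 := by
    have hm1 : 1 / ((H * K : ℕ) : ℝ) ≤ 1 := by
      rw [div_le_one (by exact_mod_cast hm)]; exact_mod_cast hm
    have hm0 : 0 ≤ 1 / ((H * K : ℕ) : ℝ) := by positivity
    nlinarith [mul_nonneg hm0 (sub_nonneg.2 h5),
      mul_nonneg hH'.le (Nat.cast_nonneg (α := ℝ) l.length)]
  linarith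

/-- The regression estimates `r + P V` up to a multiple of the bonus. Rewards are cut off to
`[0, 1]` at pairs that do not occur in the data, where they may be arbitrary. -/
theorem abs_regression_sub_le [Fintype S] {I : Input S A} {F : ℕ → Set (S × A → ℝ)}
    {P : ℕ → S × A → PMF S} {C L lam Λ : ℝ} (M : Setting I F P C L lam Λ) {K : ℕ} (hK : 0 < K)
    {h : ℕ} (hh : h < I.H) {l : List (Sample S A)} (hl : ∀ x ∈ l, 1 / √(I.H : ℝ) ≤ x.sd)
    (hlen : l.length ≤ K) (hc : Confident P I.H K L Λ h l) {r : S × A → ℝ} {V : S → ℝ}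
    (hV : ∀ s, 0 ≤ V s ∧ V s ≤ 1) (hr : ∀ x ∈ l, 0 ≤ r x.pair ∧ r x.pair ≤ 1) (z : S × A) :
    |I.erm h (regressionData l r V) z - (max 0 (min (r z) 1) + expect (P h z) V)| ≤
      I.betaE * I.Dbar h (weights l) z := by
  have hβ := M.radius
  have hpos : ∀ x ∈ regressionData l r V, 0 < x.2.1 := by
    intro x hx
    obtain ⟨y, hy, rfl⟩ := List.mem_map.1 hx
    exact (one_div_sq_le M.H_pos (hl y hy)).1
  have hpos' : ∀ x ∈ weights l, 0 < x.2 := by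
    intro x hx
    obtain ⟨y, hy, rfl⟩ := List.mem_map.1 hx
    exact (one_div_sq_le M.H_pos (hl y hy)).1
  obtain ⟨hfF, hmin⟩ := M.regression h hh _ hpos
  set f := I.erm h (regressionData l r V)
  let f' : S × A → ℝ := fun z => max 0 (min (r z) 1) + expect (P h z) V
  have hf'F : f' ∈ F h := by
    have := (M.complete h hh V (fun z => max 0 (min (r z) 1)) hV fun z =>
      ⟨le_max_left _ _, max_le zero_le_one (min_le_right _ _)⟩).1
    simpa only [expect_add, expect_const] using this
  have hfr : ∀ x ∈ l, f' x.pair = r x.pair + expect (P h x.pair) V := by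
    intro x hx
    have := hr x hx
    simp only [f', min_eq_left this.2, max_eq_right this.1]
  have hs := sqSum_sub_le M.H_pos hK hl hlen hc hV (M.bounded h hh f hfF)
    (M.bounded h hh f' hf'F) hfr (hmin f' hf'F)
  have hD := sq_sub_le_uncertaintySq_mul (M.bounded h hh) M.lam_pos (weights l) hfF hf'F z
  have hO := (M.oracle h hh _ hpos' z).1
  have hu := uncertaintySq_nonneg (G := F h) M.lam_pos (weights l) z
  have hO0 := (Real.sqrt_nonneg _).trans hO
  have hO2 : uncertaintySq (F h) lam (weights l) z ≤ I.Dbar h (weights l) z ^ 2 := by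
    rw [← Real.sq_sqrt hu]; exact pow_le_pow_left₀ (Real.sqrt_nonneg _) hO 2
  have hs0 := sqSum_nonneg (weights l) fun z => f z - f' z
  refine abs_le_of_sq_le_sq ?_ (mul_nonneg M.betaE_nonneg hO0)
  calc (f z - f' z) ^ 2 ≤ _ := hD
    _ ≤ I.Dbar h (weights l) z ^ 2 * I.betaE ^ 2 :=
        mul_le_mul hO2 (by linarith) (by linarith [M.lam_pos]) (sq_nonneg _)
    _ = _ := by ring

/-! ### Typical data are confident -/

/-- The exponent of the supermartingale that controls the correlation of `g` with the noise. -/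
def confTerm (P : ℕ → S × A → PMF S) (H h : ℕ) (V : S → ℝ) (g : S × A → ℝ) (x : Sample S A) : ℝ :=
  g x.pair / x.sd ^ 2 / (4 * H) * (V x.next - expect (P h x.pair) V) -
    g x.pair ^ 2 / x.sd ^ 2 / (32 * H)

theorem sum_confTerm (P : ℕ → S × A → PMF S) (H h : ℕ) (V : S → ℝ) (g : S × A → ℝ)
    (l : List (Sample S A)) : (l.map (confTerm P H h V g)).sum =
      crossSum P h l g V / (4 * H) - sqSum (weights l) g / (32 * H) := by
  induction l with
  | nil => simp [crossSum, sqSum, weights]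
  | cons x l ih =>
    simp only [confTerm, crossSum, sqSum, weights, List.map_cons, List.sum_cons] at ih ⊢
    rw [ih]; ring

theorem lexpect_exp_confTerm_le [Fintype S] (P : ℕ → S × A → PMF S) {H : ℕ} (hH : 0 < H) (h : ℕ)
    {V : S → ℝ} (hV : ∀ s, 0 ≤ V s ∧ V s ≤ 1) (g : S × A → ℝ) (z : S × A) {σ : ℝ} (hσ : 1 / √(H : ℝ) ≤ σ) :
    lexpect (P h z) (fun s' => ENNReal.ofReal (Real.exp (confTerm P H h V g ⟨z, s', σ⟩))) ≤ 1 := by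
  obtain ⟨hσ0, hw⟩ := one_div_sq_le hH hσ
  have hH' : (0 : ℝ) < H := Nat.cast_pos.2 hH
  change lexpect (P h z) (fun s' => ENNReal.ofReal (Real.exp (g z / σ ^ 2 / (4 * H) *
    (V s' - expect (P h z) V) - g z ^ 2 / σ ^ 2 / (32 * H)))) ≤ 1
  refine lexpect_exp_sub_le_one (P h z) _ (|g z| / σ ^ 2 / (4 * H)) _ (by positivity)
    (fun s => ?_) (expect_sub_expect _ _ _) ?_
  · rw [abs_mul, abs_div, abs_div, abs_of_pos (pow_pos hσ0 2),
      abs_of_pos (show (0 : ℝ) < 4 * H by positivity)]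
    exact mul_le_of_le_one_right (by positivity) (abs_sub_expect_le _ hV s)
  · have e1 : (|g z| / σ ^ 2 / (4 * H)) ^ 2 / 2 =
        g z ^ 2 / σ ^ 2 / (32 * H ^ 2) * (1 / σ ^ 2) := by
      rw [div_pow, div_pow, sq_abs]; field_simp; ring
    have e2 : g z ^ 2 / σ ^ 2 / (32 * H) = g z ^ 2 / σ ^ 2 / (32 * H ^ 2) * H := by
      field_simp
    rw [e1, e2]
    gcongr

/-- Number of the test functions in `Confident`, over all stages, times the number of times. -/
def confCount (S : Type u) (A : Type v) [Fintype S] [Fintype A] (H K : ℕ) (L : ℝ) : ℝ :=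
  (K + 1) * (H * (2 ^ Fintype.card S * (⌊2 * L * (H * K : ℕ)⌋₊ + 1 : ℕ) ^ Fintype.card (S × A)))

/-- The certificate `g` is the sum of the exponential supermartingales of all test functions and
all times; it is at least one where some data are not confident. -/
theorem exists_confident_certificate [Fintype S] [Fintype A] (I : Input S A)
    (hα : I.α = 1 / √(I.H : ℝ)) (hH : 0 < I.H)
    (P : ℕ → S × A → PMF S) (μ : PMF S) (K : ℕ) (L Λ : ℝ) :
    ∃ g : List (S × List (Sample S A)) → ENNReal,
      lexpect (episodesLaw I P μ K) g ≤ ENNReal.ofReal (confCount S A I.H K L * Real.exp (-Λ)) ∧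
      ∀ l, 1 ≤ g l ∨
        ∀ l', l' <:+ l → ∀ h < I.H, Confident P I.H K L Λ h (historyOf l' h) := by
  classical
  have hH' : (0 : ℝ) < I.H := Nat.cast_pos.2 hH
  let T := S × A → Fin (⌊2 * L * (I.H * K : ℕ)⌋₊ + 1)
  let ψ : ℕ → Finset S → T → List (S × List (Sample S A)) → ENNReal := fun h B j l =>
    ENNReal.ofReal (Real.exp (-Λ)) * ENNReal.ofReal (Real.exp
      ((historyOf l h).map (confTerm P I.H h (indic B) (gridFun L (I.H * K) j))).sum)
  let G : List (S × List (Sample S A)) → ENNReal := fun l =>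
    ∑ h ∈ Finset.range I.H, ∑ B : Finset S, ∑ j : T, ψ h B j l
  have hindic : ∀ B : Finset S, ∀ s, 0 ≤ indic B s ∧ indic B s ≤ 1 := fun B s => by
    unfold indic; split_ifs <;> norm_num
  have hψ : ∀ h B j k, lexpect (episodesLaw I P μ k) (ψ h B j) ≤
      ENNReal.ofReal (Real.exp (-Λ)) := by
    intro h B j k
    rw [lexpect_const_mul]
    refine mul_le_of_le_one_right (zero_le) (lexpect_episodesLaw_exp_le I P μ h _ ?_ k)
    intro z σ hσ
    exact lexpect_exp_confTerm_le P hH h (hindic B) _ z (hα ▸ hσ)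
  have hG : ∀ k, lexpect (episodesLaw I P μ k) G ≤
      I.H * (2 ^ Fintype.card S * ((⌊2 * L * (I.H * K : ℕ)⌋₊ + 1 : ℕ) ^ Fintype.card (S × A) *
        ENNReal.ofReal (Real.exp (-Λ)))) := by
    intro k
    simp only [G, lexpect_finset_sum]
    calc _ ≤ ∑ h ∈ Finset.range I.H, ∑ B : Finset S, ∑ j : T, ENNReal.ofReal (Real.exp (-Λ)) :=
          Finset.sum_le_sum fun h _ => Finset.sum_le_sum fun B _ => Finset.sum_le_sum fun j _ =>
            hψ h B j k
      _ = _ := by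
          simp only [Finset.sum_const, Finset.card_univ, Finset.card_range, Fintype.card_finset,
            T, Fintype.card_fun, Fintype.card_fin, nsmul_eq_mul]
          push_cast
          ring
  refine ⟨_, (lexpect_sum_tails_le I P μ G _ hG K).trans (le_of_eq ?_), fun l => ?_⟩
  · unfold confCount
    rw [ENNReal.ofReal_mul (by positivity), ENNReal.ofReal_mul (by positivity),
      ENNReal.ofReal_mul (by positivity), ENNReal.ofReal_mul (by positivity),
      ENNReal.ofReal_pow (by positivity), ENNReal.ofReal_pow (by positivity),
      ENNReal.ofReal_natCast, ENNReal.ofReal_natCast,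
      ENNReal.ofReal_add (by positivity) (by positivity)]
    simp only [ENNReal.ofReal_natCast, ENNReal.ofReal_one, ENNReal.ofReal_ofNat]
    ring
  · by_contra! hcon
    obtain ⟨hlt, l', hl', h, hh, hnc⟩ := hcon
    unfold Confident at hnc
    push Not at hnc
    obtain ⟨B, j, hBj⟩ := hnc
    refine absurd hlt (not_lt.2 ?_)
    have h1 : (1 : ENNReal) ≤ ψ h B j l' := by
      simp only [ψ]
      rw [← ENNReal.ofReal_mul (Real.exp_pos _).le, ← Real.exp_add, sum_confTerm]
      refine ENNReal.one_le_ofReal.2 (Real.one_le_exp ?_)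
      have : Λ ≤ (crossSum P h (historyOf l' h) (gridFun L (I.H * K) j) (indic B) -
          sqSum (weights (historyOf l' h)) (gridFun L (I.H * K) j) / 8) / (4 * I.H) := by
        rw [le_div_iff₀ (by positivity)]; linarith
      calc (0 : ℝ) ≤ -Λ + (crossSum P h (historyOf l' h) (gridFun L (I.H * K) j) (indic B) -
          sqSum (weights (historyOf l' h)) (gridFun L (I.H * K) j) / 8) / (4 * I.H) := by linarith
        _ = _ := by field_simp; ring
    have h2 : ψ h B j l' ≤ G l' :=
      (Finset.single_le_sum (f := fun j => ψ h B j l') (fun _ _ => zero_le)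
        (Finset.mem_univ j)).trans
        ((Finset.single_le_sum (f := fun B => ∑ j, ψ h B j l') (fun _ _ => zero_le)
          (Finset.mem_univ B)).trans
        (Finset.single_le_sum (f := fun h => ∑ B, ∑ j, ψ h B j l') (fun _ _ => zero_le)
          (Finset.mem_range.2 hh)))
    refine h1.trans (h2.trans ?_)
    exact List.single_le_sum (fun _ _ => zero_le) _
      (List.mem_map.2 ⟨l', (List.mem_tails _ _).2 hl', rfl⟩)

end

section

variable {S : Type u} {A : Type v}

/-! ### Value functions -/

theorem finite_support_trajectory [Fintype S] (P : ℕ → S × A → PMF S) (π : ℕ → S → A) (n : ℕ) :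
    ∀ h s, (trajectory P π n h s).support.Finite := by
  induction n with
  | zero => intro h s; simp [trajectory, PMF.support_pure]
  | succ n ih =>
    intro h s
    rw [trajectory, PMF.support_bind]
    refine Set.Finite.biUnion (Set.toFinite _) fun s' _ => ?_
    rw [PMF.support_map]
    exact (ih _ _).image _

theorem expect_const_add {X : Type*} (p : PMF X) (hp : p.support.Finite) (c : ℝ) (f : X → ℝ) :
    expect p (fun x => c + f x) = c + expect p f := by
  have h1 := expect_const p c
  unfold expect at h1 ⊢
  simp only [mul_add]
  rw [Summable.tsum_add (summable_expect p (fun _ => c) hp) (summable_expect p f hp), h1]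

theorem value_of_lt [Fintype S] {H : ℕ} (P : ℕ → S × A → PMF S) (r : ℕ → S × A → ℝ)
    (π : ℕ → S → A) {h : ℕ} (hh : h < H) (s : S) :
    value H P r π h s =
      r h (s, π h s) + expect (P h (s, π h s)) (value H P r π (h + 1)) := by
  unfold value
  obtain ⟨n, hn⟩ : ∃ n, H - h = n + 1 := ⟨H - h - 1, by omega⟩
  have hn' : H - (h + 1) = n := by omega
  have hfin := fun s' => finite_support_trajectory P π n (h + 1) s'
  rw [hn, hn', trajectory, expect_bind _ _ _ fun s' => ?_]
  · simp only [expect_map _ _ _ (hfin _), rewardSum, expect_const_add _ (hfin _)]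
    rw [expect_add, expect_const]
  · rw [PMF.support_map]
    exact (hfin s').image _

theorem value_of_le {H : ℕ} (P : ℕ → S × A → PMF S) (r : ℕ → S × A → ℝ)
    (π : ℕ → S → A) {h : ℕ} (hh : H ≤ h) (s : S) : value H P r π h s = 0 := by
  unfold value
  rw [Nat.sub_eq_zero_of_le hh, trajectory, expect_pure, rewardSum]

theorem rewardSum_div (r : ℕ → S × A → ℝ) (c : ℝ) (l : List (S × A)) : ∀ h,
    rewardSum (fun h z => r h z / c) h l = rewardSum r h l / c := by
  induction l with
  | nil => intro h; simp [rewardSum]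
  | cons z l ih => intro h; simp only [rewardSum, ih]; ring

theorem value_div (H : ℕ) (P : ℕ → S × A → PMF S) (r : ℕ → S × A → ℝ) (c : ℝ)
    (π : ℕ → S → A) (h : ℕ) (s : S) :
    value H P (fun h z => r h z / c) π h s = value H P r π h s / c := by
  unfold value expect
  rw [← tsum_div_const]
  exact tsum_congr fun l => by rw [rewardSum_div]; ring

theorem backward_induction {H : ℕ} {motive : ℕ → Prop} (top : ∀ h, H ≤ h → motive h)
    (step : ∀ h, h < H → motive (h + 1) → motive h) (h : ℕ) : motive h := by
  obtain ⟨n, hn⟩ : ∃ n, H - h = n := ⟨_, rfl⟩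
  induction n generalizing h with
  | zero => exact top h (by omega)
  | succ n ih => exact step h (by omega) (ih (h + 1) (by omega))

theorem value_nonneg [Fintype S] {H : ℕ} (P : ℕ → S × A → PMF S) (r : ℕ → S × A → ℝ)
    (π : ℕ → S → A) (hr : ∀ h < H, ∀ z, 0 ≤ r h z) (h : ℕ) : ∀ s, 0 ≤ value H P r π h s := by
  induction h using backward_induction (H := H) with
  | top h hh => exact fun s => (value_of_le P r π hh s).ge
  | step h hh ih =>
    intro s
    rw [value_of_lt P r π hh]
    exact add_nonneg (hr h hh _) (expect_nonneg _ ih)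

theorem exists_path_of_reachable {P : ℕ → S × A → PMF S} {μ : PMF S} [Nonempty A] (h : ℕ) :
    ∀ s, Reachable P μ h s → ∃ (sq : ℕ → S) (aq : ℕ → A), sq 0 ∈ μ.support ∧
      (∀ i < h, sq (i + 1) ∈ (P i (sq i, aq i)).support) ∧ sq h = s := by
  induction h with
  | zero =>
    intro s hs
    exact ⟨fun _ => s, fun _ => Classical.arbitrary A, hs, by simp, rfl⟩
  | succ h ih =>
    rintro s' ⟨s, a, hs, hs'⟩
    obtain ⟨sq, aq, h0, hi, hsq⟩ := ih s hs
    refine ⟨Function.update sq (h + 1) s', Function.update aq h a, ?_, fun i hi' => ?_, by simp⟩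
    · rwa [Function.update_of_ne (by omega)]
    · rcases (Nat.lt_succ_iff.1 hi').eq_or_lt with rfl | hlt
      · simpa [hsq] using hs'
      · rw [Function.update_of_ne (by omega), Function.update_of_ne (by omega),
          Function.update_of_ne (by omega)]
        exact hi i hlt

/-- The rewards collected on the way to stage `h` and the value of any policy from there on add
up to at most the bound on the total reward of the possible trajectories. -/
theorem sum_add_value_le [Fintype S] {H : ℕ} (P : ℕ → S × A → PMF S) (μ : PMF S)
    (r : ℕ → S × A → ℝ) (π : ℕ → S → A) {b : ℝ}
    (hr : ∀ s a, IsPossible H P μ s a → ∑ h ∈ Finset.range H, r h (s h, a h) ≤ b) (h : ℕ) :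
    h ≤ H → ∀ (sq : ℕ → S) (aq : ℕ → A), sq 0 ∈ μ.support →
      (∀ i < h, sq (i + 1) ∈ (P i (sq i, aq i)).support) →
      ∑ i ∈ Finset.range h, r i (sq i, aq i) + value H P r π h (sq h) ≤ b := by
  induction h using backward_induction (H := H) with
  | top h hh =>
    intro hh' sq aq h0 hi
    obtain rfl := le_antisymm hh' hh
    rw [value_of_le P r π le_rfl, add_zero]
    exact hr sq aq ⟨h0, fun i hi' => hi i (by omega)⟩
  | step h hh ih =>
    intro _ sq aq h0 hi
    rw [value_of_lt P r π hh]
    have key : ∀ s' ∈ (P h (sq h, π h (sq h))).support, value H P r π (h + 1) s' ≤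
        b - ∑ i ∈ Finset.range h, r i (sq i, aq i) - r h (sq h, π h (sq h)) := by
      intro s' hs'
      have := ih (by omega) (Function.update sq (h + 1) s') (Function.update aq h (π h (sq h)))
        (by rwa [Function.update_of_ne (by omega)]) (fun i hi' => by
          rcases (Nat.lt_succ_iff.1 hi').eq_or_lt with rfl | hlt
          · simpa using hs'
          · rw [Function.update_of_ne (by omega), Function.update_of_ne (by omega),
              Function.update_of_ne (by omega)]
            exact hi i hlt)
      rw [Finset.sum_range_succ, Function.update_self, Function.update_self,
        Function.update_of_ne (by omega), Finset.sum_congr rfl fun i hi' => by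
          rw [Function.update_of_ne (by have := Finset.mem_range.1 hi'; omega),
            Function.update_of_ne (by have := Finset.mem_range.1 hi'; omega)]] at this
      linarith
    have := expect_mono _ key
    rw [expect_const] at this
    linarith

theorem value_le_of_reachable [Fintype S] [Nonempty A] {H : ℕ} {P : ℕ → S × A → PMF S} {μ : PMF S}
    {r : ℕ → S × A → ℝ} {b : ℝ} (hr0 : ∀ h < H, ∀ z, 0 ≤ r h z)
    (hr : ∀ s a, IsPossible H P μ s a → ∑ h ∈ Finset.range H, r h (s h, a h) ≤ b)
    (π : ℕ → S → A) {h : ℕ} (hh : h ≤ H) {s : S} (hs : Reachable P μ h s) :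
    value H P r π h s ≤ b := by
  obtain ⟨sq, aq, h0, hi, rfl⟩ := exists_path_of_reachable h s hs
  have h1 := sum_add_value_le P μ r π hr h hh sq aq h0 hi
  have h2 : 0 ≤ ∑ i ∈ Finset.range h, r i (sq i, aq i) := Finset.sum_nonneg fun i hi' =>
    hr0 i (by have := Finset.mem_range.1 hi'; omega) _
  linarith

theorem reward_le_of_reachable [Fintype S] [Nonempty A] {H : ℕ} {P : ℕ → S × A → PMF S} {μ : PMF S}
    {r : ℕ → S × A → ℝ} {b : ℝ} (hr0 : ∀ h < H, ∀ z, 0 ≤ r h z)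
    (hr : ∀ s a, IsPossible H P μ s a → ∑ h ∈ Finset.range H, r h (s h, a h) ≤ b)
    {h : ℕ} (hh : h < H) {z : S × A} (hs : Reachable P μ h z.1) : r h z ≤ b := by
  have h1 := value_le_of_reachable hr0 hr (fun _ _ => z.2) hh.le hs
  rw [value_of_lt P r _ hh] at h1
  have h2 := expect_nonneg (P h (z.1, z.2)) (value_nonneg P r (fun _ _ => z.2) hr0 (h + 1))
  linarith

/-- Rewards in `[0, 1]` have total at most `H`, so that the first kind of admissible rewards is a
special case of the second. -/
theorem AdmissibleReward.nonneg_and_sum_le {H : ℕ} {P : ℕ → S × A → PMF S} {μ : PMF S}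
    {r : ℕ → S × A → ℝ} (hr : AdmissibleReward H P μ r) : (∀ h < H, ∀ z, 0 ≤ r h z) ∧
      ∀ s a, IsPossible H P μ s a → ∑ h ∈ Finset.range H, r h (s h, a h) ≤ H := by
  rcases hr with hr | hr
  · refine ⟨fun h hh z => (hr h hh z).1, fun s a _ => ?_⟩
    refine (Finset.sum_le_card_nsmul _ _ 1 fun h hh => (hr h (Finset.mem_range.1 hh) _).2).trans ?_
    simp
  · exact hr

/-! ### Optimism -/

/-- All weight parameters in the data respect the floor `α`. -/
structure FloorData (I : Input S A) (D : History S A) : Prop where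
  sd_le : ∀ h, ∀ x ∈ D h, I.α ≤ x.sd

/-- Data of the exploration phase for which all regressions are accurate. -/
structure GoodData (I : Input S A) (P : ℕ → S × A → PMF S) (μ : PMF S) (K : ℕ) (L Λ : ℝ)
    (D : History S A) : Prop extends FloorData I D where
  reach : ∀ h, ∀ x ∈ D h, Reachable P μ h x.pair.1
  length : ∀ h, (D h).length ≤ K
  confident : ∀ h < I.H, Confident P I.H K L Λ h (D h)

variable {I : Input S A} {F : ℕ → Set (S × A → ℝ)} {P : ℕ → S × A → PMF S} {μ : PMF S}
  {C L lam Λ : ℝ} {K : ℕ} {D : History S A}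

theorem FloorData.sd_pos (M : Setting I F P C L lam Λ) (hD : FloorData I D) {h : ℕ} :
    ∀ x ∈ weights (D h), 0 < x.2 := by
  intro x hx
  obtain ⟨y, hy, rfl⟩ := List.mem_map.1 hx
  exact (one_div_sq_le M.H_pos (M.α_eq ▸ hD.sd_le h y hy)).1

theorem FloorData.Dbar_nonneg (M : Setting I F P C L lam Λ) (hD : FloorData I D) {h : ℕ}
    (hh : h < I.H) (z : S × A) : 0 ≤ I.Dbar h (weights (D h)) z :=
  (Real.sqrt_nonneg _).trans (M.oracle h hh _ (hD.sd_pos M) z).1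

theorem FloorData.backF_bounds (M : Setting I F P C L lam Λ) (hD : FloorData I D)
    (r b : ℕ → S × A → ℝ) {h : ℕ} (hh : h < I.H) (z : S × A) :
    0 ≤ backF I D r b h z ∧ backF I D r b h z ≤ L := by
  refine M.bounded h hh _ (M.regression h hh _ fun x hx => ?_).1 z
  obtain ⟨y, hy, rfl⟩ := List.mem_map.1 hx
  exact (one_div_sq_le M.H_pos (M.α_eq ▸ hD.sd_le h y hy)).1

theorem backV_of_le (r b : ℕ → S × A → ℝ) {h : ℕ} (hh : I.H ≤ h) (s : S) :
    backV I D r b h s = 0 := by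
  rw [backV, if_neg (by omega)]; rfl

theorem backV_of_lt (r b : ℕ → S × A → ℝ) {h : ℕ} (hh : h < I.H) (s : S) :
    backV I D r b h s = ⨆ a, backQ I D r b h (s, a) := by
  rw [backV, if_pos hh]; rfl

theorem backQ_le_backV [Finite A] (r b : ℕ → S × A → ℝ) {h : ℕ} (hh : h < I.H) (s : S) (a : A) :
    backQ I D r b h (s, a) ≤ backV I D r b h s := by
  rw [backV_of_lt r b hh]
  exact le_ciSup (f := fun a => backQ I D r b h (s, a)) (Set.finite_range _).bddAbove a

theorem backV_eq_backQ [Finite A] [Nonempty A] (hg : IsArgmax I.greedy) (r b : ℕ → S × A → ℝ)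
    {h : ℕ} (hh : h < I.H) (s : S) :
    backV I D r b h s = backQ I D r b h (s, backPolicy I D r b h s) := by
  refine le_antisymm ?_ (backQ_le_backV r b hh s _)
  rw [backV_of_lt r b hh]
  exact ciSup_le (hg _ (Finite.exists_max fun a => backQ I D r b h (s, a)))

theorem FloorData.backV_bounds [Finite A] [Nonempty A] (M : Setting I F P C L lam Λ)
    (hD : FloorData I D) (r : ℕ → S × A → ℝ) {b : ℕ → S × A → ℝ}
    (hb : ∀ h < I.H, ∀ z, 0 ≤ b h z) (h : ℕ) (s : S) :
    0 ≤ backV I D r b h s ∧ backV I D r b h s ≤ 1 := by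
  rcases lt_or_ge h I.H with hh | hh
  · rw [backV_eq_backQ M.argmax r b hh]
    exact ⟨le_min (add_nonneg (hD.backF_bounds M r b hh _).1 (hb h hh _)) zero_le_one,
      min_le_right _ _⟩
  · rw [backV_of_le r b hh]
    exact ⟨le_rfl, zero_le_one⟩

theorem GoodData.abs_backF_sub_le [Fintype S] [Finite A] [Nonempty A] (hK : 0 < K)
    (M : Setting I F P C L lam Λ) (hD : GoodData I P μ K L Λ D) {r b : ℕ → S × A → ℝ}
    (hb : ∀ h < I.H, ∀ z, 0 ≤ b h z) {h : ℕ} (hh : h < I.H)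
    (hr : ∀ z, Reachable P μ h z.1 → 0 ≤ r h z ∧ r h z ≤ 1) (z : S × A) :
    |backF I D r b h z - (max 0 (min (r h z) 1) + expect (P h z) (backV I D r b (h + 1)))| ≤
      I.betaE * I.Dbar h (weights (D h)) z :=
  abs_regression_sub_le M hK hh (fun x hx => M.α_eq ▸ hD.sd_le h x hx) (hD.length h)
    (hD.confident h hh) (fun s => hD.backV_bounds M r hb (h + 1) s)
    (fun x hx => hr _ (hD.reach h x hx)) z

/-! ### The exploration phase -/

/-- The optimistic value function of the exploration phase. -/
def exploreV (I : Input S A) (D : History S A) : ℕ → S → ℝ :=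
  backV I D (exploreReward I D) (exploreBonus I D)

theorem FloorData.exploreBonus_nonneg (M : Setting I F P C L lam Λ) (hD : FloorData I D)
    (h : ℕ) (hh : h < I.H) (z : S × A) : 0 ≤ exploreBonus I D h z :=
  mul_nonneg (mul_nonneg two_pos.le M.betaE_nonneg) (hD.Dbar_nonneg M hh z)

theorem exploreReward_eq (I : Input S A) (D : History S A) (h : ℕ) (z : S × A) :
    exploreReward I D h z = min (I.betaE * I.Dbar h (weights (D h)) z) 1 := by
  rw [exploreReward, exploreBonus]; congr 1; ring

theorem FloorData.exploreReward_bounds (M : Setting I F P C L lam Λ)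
    (hD : FloorData I D) {h : ℕ} (hh : h < I.H) (z : S × A) :
    0 ≤ exploreReward I D h z ∧ exploreReward I D h z ≤ 1 :=
  ⟨le_min (div_nonneg (hD.exploreBonus_nonneg M h hh z) two_pos.le) zero_le_one, min_le_right _ _⟩

theorem FloorData.exploreV_bounds [Finite A] [Nonempty A] (M : Setting I F P C L lam Λ)
    (hD : FloorData I D) (h : ℕ) (s : S) : 0 ≤ exploreV I D h s ∧ exploreV I D h s ≤ 1 :=
  hD.backV_bounds M _ (hD.exploreBonus_nonneg M) h s

theorem GoodData.abs_explore_backF_sub_le [Fintype S] [Finite A] [Nonempty A] (hK : 0 < K)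
    (M : Setting I F P C L lam Λ) (hD : GoodData I P μ K L Λ D) {h : ℕ} (hh : h < I.H)
    (z : S × A) :
    |backF I D (exploreReward I D) (exploreBonus I D) h z -
      (exploreReward I D h z + expect (P h z) (exploreV I D (h + 1)))| ≤
      I.betaE * I.Dbar h (weights (D h)) z := by
  have h1 := hD.abs_backF_sub_le hK M (hD.exploreBonus_nonneg M) hh
    (fun z _ => hD.exploreReward_bounds M hh z) z
  have h2 := hD.exploreReward_bounds M hh z
  rwa [min_eq_left h2.2, max_eq_right h2.1] at h1

/-- Optimism of the exploration phase: the bonus exceeds the estimation error by `β D`, so its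
value function dominates the accumulated uncertainty along every policy. -/
theorem GoodData.le_exploreV [Fintype S] [Finite A] [Nonempty A] (hK : 0 < K)
    (M : Setting I F P C L lam Λ) (hD : GoodData I P μ K L Λ D) {h : ℕ} (hh : h < I.H)
    (z : S × A) : min (I.betaE * I.Dbar h (weights (D h)) z +
      expect (P h z) (exploreV I D (h + 1))) 1 ≤ exploreV I D h z.1 := by
  refine le_trans ?_ (backQ_le_backV _ _ hh z.1 z.2)
  have h1 := abs_le.1 (hD.abs_explore_backF_sub_le hK M hh z)
  have h2 := hD.exploreReward_bounds M hh z
  refine min_le_min ?_ le_rfl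
  have e : exploreBonus I D h z = 2 * (I.betaE * I.Dbar h (weights (D h)) z) := by
    rw [exploreBonus]; ring
  rw [Prod.mk.eta, e]
  linarith

/-- Along the exploration policy, the optimistic value exceeds the expected optimistic value of the
next state by at most four rewards: the reward, the bonus (twice the reward) and the error. -/
theorem GoodData.exploreV_le [Fintype S] [Finite A] [Nonempty A] (hK : 0 < K)
    (M : Setting I F P C L lam Λ) (hD : GoodData I P μ K L Λ D) {h : ℕ} (hh : h < I.H)
    {s : S} {z : S × A} (hz : z = (s, explorePolicy I D h s)) :
    exploreV I D h s ≤ expect (P h z) (exploreV I D (h + 1)) + 4 * exploreReward I D h z := by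
  have h0 : exploreV I D h s = backQ I D (exploreReward I D) (exploreBonus I D) h z := by
    rw [hz]; exact backV_eq_backQ M.argmax _ _ hh s
  rw [h0, backQ]
  have h1 := abs_le.1 (hD.abs_explore_backF_sub_le hK M hh z)
  have h3 := expect_nonneg (P h z) fun s => (hD.exploreV_bounds M (h + 1) s).1
  have e : exploreBonus I D h z = 2 * (I.betaE * I.Dbar h (weights (D h)) z) := by
    rw [exploreBonus]; ring
  rw [exploreReward_eq] at h1 ⊢
  rw [e]
  rcases le_total (I.betaE * I.Dbar h (weights (D h)) z) 1 with h4 | h4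
  · rw [min_eq_left h4] at h1 ⊢
    exact (min_le_left _ _).trans (by linarith)
  · rw [min_eq_right h4]
    exact (min_le_right _ _).trans (by linarith)

/-- The regression estimate enters the weight parameter; this replaces it by optimistic values. -/
theorem GoodData.min_explore_backF_le [Fintype S] [Finite A] [Nonempty A] (hK : 0 < K)
    (M : Setting I F P C L lam Λ) (hD : GoodData I P μ K L Λ D) {h : ℕ} (hh : h < I.H)
    (z : S × A) :
    min (backF I D (exploreReward I D) (exploreBonus I D) h z) 1 ≤
      expect (P h z) (exploreV I D (h + 1)) + 2 * exploreReward I D h z := by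
  have h1 := abs_le.1 (hD.abs_explore_backF_sub_le hK M hh z)
  have h3 := expect_nonneg (P h z) fun s => (hD.exploreV_bounds M (h + 1) s).1
  rw [exploreReward_eq] at h1 ⊢
  rcases le_total (I.betaE * I.Dbar h (weights (D h)) z) 1 with h4 | h4
  · rw [min_eq_left h4] at h1 ⊢
    exact (min_le_left _ _).trans (by linarith)
  · rw [min_eq_right h4]
    exact (min_le_right _ _).trans (by linarith)

/-! ### The planning phase -/

/-- The optimistic value function of the planning phase. -/
def planV (I : Input S A) (D : History S A) (r : ℕ → S × A → ℝ) : ℕ → S → ℝ :=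
  backV I D r (planBonus I D)

theorem FloorData.planBonus_nonneg (M : Setting I F P C L lam Λ) (hD : FloorData I D)
    (h : ℕ) (hh : h < I.H) (z : S × A) : 0 ≤ planBonus I D h z :=
  le_min (mul_nonneg (M.betaP_eq ▸ M.betaE_nonneg) (hD.Dbar_nonneg M hh z)) zero_le_one

theorem GoodData.abs_plan_backF_sub_le [Fintype S] [Finite A] [Nonempty A] (hK : 0 < K)
    (M : Setting I F P C L lam Λ) (hD : GoodData I P μ K L Λ D) {r : ℕ → S × A → ℝ} {h : ℕ}
    (hh : h < I.H) (hr : ∀ z, Reachable P μ h z.1 → 0 ≤ r h z ∧ r h z ≤ 1) {z : S × A}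
    (hz : Reachable P μ h z.1) :
    |backF I D r (planBonus I D) h z - (r h z + expect (P h z) (planV I D r (h + 1)))| ≤
      I.betaE * I.Dbar h (weights (D h)) z := by
  have h1 := hD.abs_backF_sub_le hK M (hD.planBonus_nonneg M) hh hr z
  have h2 := hr z hz
  rwa [min_eq_left h2.2, max_eq_right h2.1] at h1

/-- Optimism of the planning phase: at reachable states its value function dominates the value of
every policy. -/
theorem GoodData.value_le_planV [Fintype S] [Finite A] [Nonempty A] (hK : 0 < K)
    (M : Setting I F P C L lam Λ) (hD : GoodData I P μ K L Λ D) {r : ℕ → S × A → ℝ}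
    (hr0 : ∀ h < I.H, ∀ z, 0 ≤ r h z)
    (hr : ∀ s a, IsPossible I.H P μ s a → ∑ h ∈ Finset.range I.H, r h (s h, a h) ≤ 1)
    (π : ℕ → S → A) (h : ℕ) :
    ∀ s, Reachable P μ h s → value I.H P r π h s ≤ planV I D r h s := by
  induction h using backward_induction (H := I.H) with
  | top h hh =>
    intro s _
    rw [value_of_le P r π hh, planV, backV_of_le _ _ hh]
  | step h hh ih =>
    intro s hs
    have hle1 := value_le_of_reachable hr0 hr π hh.le hs
    refine le_trans ?_ (backQ_le_backV _ _ hh s (π h s))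
    rw [backQ]
    refine le_min ?_ hle1
    have hf := (hD.backF_bounds M r (planBonus I D) hh (s, π h s)).1
    have h1 := abs_le.1 (hD.abs_plan_backF_sub_le hK M (r := r) hh
      (fun z hz => ⟨hr0 h hh z, reward_le_of_reachable hr0 hr hh hz⟩) (z := (s, π h s)) hs)
    rw [planBonus, M.betaP_eq]
    rcases le_total (I.betaE * I.Dbar h (weights (D h)) (s, π h s)) 1 with h4 | h4
    · rw [min_eq_left h4]
      have h5 : expect (P h (s, π h s)) (value I.H P r π (h + 1)) ≤
          expect (P h (s, π h s)) (planV I D r (h + 1)) :=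
        expect_mono _ fun s' hs' => ih s' ⟨s, _, hs, hs'⟩
      rw [value_of_lt P r π hh]
      linarith
    -- a truncated bonus equals `1` and dominates the value by itself
    · rw [min_eq_right h4]
      linarith

/-- The loss of the planned policy is controlled by the optimistic value function of every earlier
exploration episode, because the uncertainty decreases with the data. -/
theorem GoodData.planV_sub_value_le [Fintype S] [Finite A] [Nonempty A] (hK : 0 < K)
    (M : Setting I F P C L lam Λ) (hD : GoodData I P μ K L Λ D) {D' : History S A}
    (hD' : GoodData I P μ K L Λ D') (hDD' : ∀ h, ∃ t, D h = D' h ++ t) {r : ℕ → S × A → ℝ}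
    (hr0 : ∀ h < I.H, ∀ z, 0 ≤ r h z)
    (hr : ∀ s a, IsPossible I.H P μ s a → ∑ h ∈ Finset.range I.H, r h (s h, a h) ≤ 1) (h : ℕ) :
    ∀ s, Reachable P μ h s → planV I D r h s - value I.H P r (planPolicy I D r) h s ≤
      2 * C * exploreV I D' h s := by
  induction h using backward_induction (H := I.H) with
  | top h hh =>
    intro s _
    rw [value_of_le P r _ hh, planV, backV_of_le _ _ hh, exploreV, backV_of_le _ _ hh]
    simp
  | step h hh ih =>
    intro s hs
    have hC := M.one_le_C
    have hv := value_nonneg P r (planPolicy I D r) hr0 h s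
    set z : S × A := (s, planPolicy I D r h s) with hz
    have hV : planV I D r h s = backQ I D r (planBonus I D) h z := backV_eq_backQ M.argmax _ _ hh s
    have h1 := abs_le.1 (hD.abs_plan_backF_sub_le hK M (r := r) hh
      (fun z hz => ⟨hr0 h hh z, reward_le_of_reachable hr0 hr hh hz⟩) (z := z) hs)
    have hb : planBonus I D h z ≤ I.betaE * I.Dbar h (weights (D h)) z := by
      rw [planBonus, M.betaP_eq]; exact min_le_left _ _
    have hle1 : planV I D r h s ≤ 1 := by rw [hV]; exact min_le_right _ _
    have hle2 : planV I D r h s ≤ backF I D r (planBonus I D) h z + planBonus I D h z := by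
      rw [hV]; exact min_le_left _ _
    have hmono : I.Dbar h (weights (D h)) z ≤ C * I.Dbar h (weights (D' h)) z := by
      obtain ⟨t, ht⟩ := hDD' h
      have e : weights (D h) = weights (D' h) ++ weights t := by
        rw [ht, weights, List.map_append]; rfl
      calc _ ≤ C * √(uncertaintySq (F h) lam (weights (D h)) z) :=
            (M.oracle h hh _ (hD.sd_pos M) z).2
        _ ≤ C * √(uncertaintySq (F h) lam (weights (D' h)) z) := by
            gcongr
            rw [e]
            exact uncertaintySq_append_le (M.bounded h hh) M.lam_pos _ _ _
        _ ≤ _ := by gcongr; exact (M.oracle h hh _ (hD'.sd_pos M) z).1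
    have hval : value I.H P r (planPolicy I D r) h s =
        r h z + expect (P h z) (value I.H P r (planPolicy I D r) (h + 1)) := value_of_lt P r _ hh s
    have hnext : expect (P h z) (planV I D r (h + 1)) ≤
        expect (P h z) (value I.H P r (planPolicy I D r) (h + 1)) +
          2 * C * expect (P h z) (exploreV I D' (h + 1)) := by
      rw [← expect_const_mul, ← expect_add]
      refine expect_mono _ fun s' hs' => ?_
      linarith [ih s' ⟨s, _, hs, hs'⟩]
    have hexp := hD'.le_exploreV hK M hh z
    have hmul := mul_le_mul_of_nonneg_left hmono M.betaE_nonneg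
    refine le_trans ?_ (mul_le_mul_of_nonneg_left hexp (by linarith : 0 ≤ 2 * C))
    rw [mul_min_of_nonneg _ _ (by linarith : 0 ≤ 2 * C)]
    refine le_min ?_ (by linarith)
    linarith

end

section

variable {S : Type u} {A : Type v} {I : Input S A} {F : ℕ → Set (S × A → ℝ)}
  {P : ℕ → S × A → PMF S} {μ : PMF S} {C L lam Λ : ℝ} {K : ℕ}

/-! ### Regret of the exploration phase -/

theorem length_of_mem_support_episodeLaw {π : ℕ → S → A} {sd : ℕ → S × A → ℝ} {n : ℕ} :
    ∀ {h : ℕ} {s : S} {e : List (Sample S A)}, e ∈ (episodeLaw P π sd n h s).support →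
      e.length = n := by
  induction n with
  | zero => intro h s e he; rw [mem_support_episodeLaw_zero he]; rfl
  | succ n ih =>
    intro h s e he
    obtain ⟨s', -, e', he', rfl⟩ := mem_support_episodeLaw_succ he
    rw [List.length_cons, ih he']

theorem sumFrom_le_sumFrom {π : ℕ → S → A} {sd : ℕ → S × A → ℝ} {f g : ℕ → Sample S A → ℝ} {H : ℕ}
    (hfg : ∀ h < H, ∀ z s', f h ⟨z, s', sd h z⟩ ≤ g h ⟨z, s', sd h z⟩) {n : ℕ} :
    ∀ {h : ℕ} {s : S} {e : List (Sample S A)}, h + n ≤ H →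
      e ∈ (episodeLaw P π sd n h s).support → sumFrom f h e ≤ sumFrom g h e := by
  induction n with
  | zero => intro h s e _ he; rw [mem_support_episodeLaw_zero he]; exact le_rfl
  | succ n ih =>
    intro h s e hn he
    obtain ⟨s', -, e', he', rfl⟩ := mem_support_episodeLaw_succ he
    exact add_le_add (hfg h (by omega) _ _) (ih (by omega) he')

theorem sumFrom_const (c : ℝ) (e : List (Sample S A)) : ∀ h,
    sumFrom (fun _ _ => c) h e = c * e.length := by
  induction e with
  | nil => intro h; simp [sumFrom]
  | cons x e ih => intro h; simp only [sumFrom, ih, List.length_cons]; push_cast; ring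

/-- Comparison of sums over the exploration phase, episode by episode. -/
theorem total_le_total {f₀ g₀ : History S A → S → ℝ} {f g : History S A → ℕ → Sample S A → ℝ} :
    ∀ {K : ℕ} {l : List (S × List (Sample S A))}, l ∈ (episodesLaw I P μ K).support →
      (∀ l', l' <:+ l → l'.length < K → ∀ s, ∀ e ∈ (episodeLaw P (explorePolicy I (historyOf l'))
        (exploreSd I (historyOf l')) I.H 0 s).support,
        f₀ (historyOf l') s + sumFrom (f (historyOf l')) 0 e ≤
          g₀ (historyOf l') s + sumFrom (g (historyOf l')) 0 e) →
      total f₀ f l ≤ total g₀ g l := by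
  intro K
  induction K with
  | zero =>
    intro l hl _
    have e : l = [] := by simpa [episodesLaw] using hl
    rw [e, total, total]
  | succ K ih =>
    intro l hl hfg
    obtain ⟨l', hl', s, hs, e, he, rfl⟩ := mem_support_episodesLaw_succ hl
    have hlen := length_of_mem_support_episodesLaw hl'
    exact add_le_add (ih hl' fun l'' h1 h2 => hfg l'' (h1.trans (List.suffix_cons _ _)) (by omega))
      (hfg l' (List.suffix_cons _ _) (by omega) s e he)

/-- The expected optimistic value of the next state, `P_h V_{h+1}` at the pair of the sample. -/
def nextValue (I : Input S A) (P : ℕ → S × A → PMF S) (D : History S A) (h : ℕ)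
    (x : Sample S A) : ℝ := expect (P h x.pair) (exploreV I D (h + 1))

/-- The noise in the transition of a sample, weighted as in `weighted_value_add_sumFrom_le`. -/
def stepNoise (I : Input S A) (P : ℕ → S × A → PMF S) (D : History S A) (h : ℕ)
    (x : Sample S A) : ℝ := (I.H + h + 1) * (nextValue I P D h x - exploreV I D (h + 1) x.next)

/-- The noise in the choice of the initial state. -/
def startNoise (I : Input S A) (μ : PMF S) (D : History S A) (s : S) : ℝ :=
  I.H * (expect μ (exploreV I D 0) - exploreV I D 0 s)

/-- Unrolling the optimistic values along an episode. The weight of the value grows by one with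
every stage, which leaves one copy of every `P_h V_{h+1}` on the left-hand side. -/
theorem GoodData.weighted_value_add_sumFrom_le [Fintype S] [Finite A] [Nonempty A]
    (M : Setting I F P C L lam Λ) {D : History S A} (hK : 0 < K) (hD : GoodData I P μ K L Λ D)
    {sd : ℕ → S × A → ℝ} (n : ℕ) :
    ∀ (h : ℕ) (s : S) (e : List (Sample S A)), h + n = I.H →
      e ∈ (episodeLaw P (explorePolicy I D) sd n h s).support →
      (I.H + h) * exploreV I D h s + sumFrom (nextValue I P D) h e ≤
        8 * I.H * sumFrom (fun h x => exploreReward I D h x.pair) h e +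
          sumFrom (stepNoise I P D) h e := by
  induction n with
  | zero =>
    intro h s e hn he
    rw [mem_support_episodeLaw_zero he, exploreV, backV_of_le _ _ (by omega)]
    simp [sumFrom]
  | succ n ih =>
    intro h s e hn he
    obtain ⟨s', -, e', he', rfl⟩ := mem_support_episodeLaw_succ he
    have hh : h < I.H := by omega
    have h1 := ih (h + 1) s' e' (by omega) he'
    have h2 := hD.exploreV_le hK M hh (s := s) rfl
    have h3 := (hD.exploreReward_bounds M hh (s, explorePolicy I D h s)).1
    simp only [sumFrom, stepNoise, nextValue] at h1 ⊢
    set v := exploreV I D (h + 1) s'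
    set p := expect (P h (s, explorePolicy I D h s)) (exploreV I D (h + 1))
    set ρ := exploreReward I D h (s, explorePolicy I D h s)
    have hHh : (h : ℝ) ≤ I.H := Nat.cast_le.2 hh.le
    have h4 : ((I.H : ℝ) + h) * exploreV I D h s ≤ (I.H + h) * (p + 4 * ρ) := by gcongr
    have h5 : ((I.H : ℝ) + h) * ρ ≤ 2 * I.H * ρ := by gcongr; linarith
    push_cast at h1
    linarith

theorem total_value_le [Fintype S] [Finite A] [Nonempty A] (M : Setting I F P C L lam Λ)
    (hK : 0 < K) {l : List (S × List (Sample S A))} (hl : l ∈ (episodesLaw I P μ K).support)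
    (hg : ∀ l', l' <:+ l → GoodData I P μ K L Λ (historyOf l')) :
    total (fun D _ => I.H * expect μ (exploreV I D 0)) (nextValue I P) l ≤
      8 * I.H * total (fun _ _ => 0) (fun D h x => exploreReward I D h x.pair) l +
        total (startNoise I μ) (stepNoise I P) l := by
  rw [← total_const_mul, ← total_add]
  refine total_le_total hl fun l' hl' _ s e he => ?_
  have h1 := (hg l' hl').weighted_value_add_sumFrom_le M hK I.H 0 s e (by omega) he
  rw [sumFrom_add, sumFrom_const_mul, startNoise]
  push_cast at h1
  linarith

/-! ### The sum of the bonuses -/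

theorem GoodData.Dbar_le [Nonempty S] [Nonempty A] (M : Setting I F P C L lam Λ)
    {D : History S A} (hD : GoodData I P μ K L Λ D) {h : ℕ} (hh : h < I.H) (z : S × A) :
    I.Dbar h (weights (D h)) z ≤ C * (L / √lam) := by
  have hC := M.one_le_C
  have hL := M.one_le_L
  refine (M.oracle h hh _ (hD.sd_pos M) z).2.trans ?_
  gcongr
  refine (Real.sqrt_le_sqrt
    (uncertaintySq_le_div (M.bounded h hh) M.lam_pos M.one_le_L _ z)).trans (le_of_eq ?_)
  rw [Real.sqrt_div (sq_nonneg L), Real.sqrt_sq (by linarith)]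

/-- The weight parameter exceeds its floor `1 / √H` only by terms that the optimistic values
control. -/
theorem GoodData.exploreSd_sq_le [Fintype S] [Finite A] [Nonempty S] [Nonempty A]
    (M : Setting I F P C L lam Λ) (hK : 0 < K) {D : History S A} (hD : GoodData I P μ K L Λ D)
    {h : ℕ} (hh : h < I.H) (z : S × A) :
    exploreSd I D h z ^ 2 ≤ 1 / I.H +
      I.logNV * ((1 + C * (L / √lam) + 8) * exploreReward I D h z +
        4 * expect (P h z) (exploreV I D (h + 1))) := by
  have hN := M.logNV_nonneg
  have hL := M.one_le_L
  have hC := M.one_le_C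
  have hH : (0 : ℝ) < I.H := Nat.cast_pos.2 M.H_pos
  have hb0 : 0 ≤ C * (L / √lam) := by positivity
  have hD0 := hD.Dbar_nonneg M hh z
  have hρ := hD.exploreReward_bounds M hh z
  have hp := expect_nonneg (P h z) fun s => (hD.exploreV_bounds M (h + 1) s).1
  have hf0 := (hD.backF_bounds M (exploreReward I D) (exploreBonus I D) hh z).1
  have hf := hD.min_explore_backF_le hK M hh z
  have hDρ : I.Dbar h (weights (D h)) z ≤ (1 + C * (L / √lam)) * exploreReward I D h z := by
    rw [exploreReward_eq]
    have h1 := hD.Dbar_le M hh z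
    have h2 := mul_le_mul_of_nonneg_right M.one_le_betaE hD0
    rcases le_total (I.betaE * I.Dbar h (weights (D h)) z) 1 with h4 | h4
    · rw [min_eq_left h4]
      nlinarith [mul_nonneg hb0 (mul_nonneg M.betaE_nonneg hD0)]
    · rw [min_eq_right h4]; linarith
  set q := expect (P h z) (exploreV I D (h + 1))
  set ρ := exploreReward I D h z
  set d := I.Dbar h (weights (D h)) z
  set m := min (backF I D (exploreReward I D) (exploreBonus I D) h z) 1 with hm
  have hm0 : 0 ≤ m := le_min hf0 zero_le_one
  have e1 : (I.γ * √d) ^ 2 = I.logNV * d := by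
    rw [M.γ_eq, mul_pow, Real.sq_sqrt hN, Real.sq_sqrt hD0]
  have e2 : (2 * √(I.logNV * m)) ^ 2 = I.logNV * (4 * m) := by
    rw [mul_pow, Real.sq_sqrt (mul_nonneg hN hm0)]; ring
  have e3 : I.α ^ 2 = 1 / I.H := by
    rw [M.α_eq, div_pow, one_pow, Real.sq_sqrt hH.le]
  have hρ' : 0 ≤ (1 + C * (L / √lam) + 8) * ρ := mul_nonneg (by linarith) hρ.1
  have hα : 0 ≤ 1 / (I.H : ℝ) := by positivity
  have key : ∀ y : ℝ, y ≤ (1 + C * (L / √lam) + 8) * ρ + 4 * q →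
      I.logNV * y ≤ 1 / I.H + I.logNV * ((1 + C * (L / √lam) + 8) * ρ + 4 * q) := fun y hy => by
    have := mul_le_mul_of_nonneg_left hy hN
    linarith
  have hsd : exploreSd I D h z = max (I.γ * √d) (max (2 * √(I.logNV * m)) I.α) := rfl
  rw [hsd]
  rcases max_choice (I.γ * √d) (max (2 * √(I.logNV * m)) I.α) with h1 | h1 <;> rw [h1]
  · rw [e1]; exact key _ (by linarith)
  · rcases max_choice (2 * √(I.logNV * m)) I.α with h2 | h2 <;> rw [h2]
    · rw [e2]
      refine key _ ?_
      nlinarith [mul_nonneg hb0 hρ.1]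
    · rw [e3]
      have := mul_nonneg hN (add_nonneg hρ' (by linarith : 0 ≤ 4 * q))
      linarith

/-- The truncated relative uncertainty of a sample with respect to the earlier data. -/
def relUncertainty (I : Input S A) (D : History S A) (h : ℕ) (x : Sample S A) : ℝ :=
  min 1 (I.Dbar h (weights (D h)) x.pair ^ 2 / x.sd ^ 2)

/-- The inequality of arithmetic and geometric means, with `β d = 2 (√t σ) (β d / (2 √t σ))`; the
summand `1` covers the truncated case. -/
theorem min_mul_le {β d σ t : ℝ} (hσ : 0 < σ) (ht : 0 < t) :
    min (β * d) 1 ≤ t * σ ^ 2 + (β ^ 2 / (4 * t) + 1) * min 1 (d ^ 2 / σ ^ 2) := by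
  have h0 : 0 ≤ t * σ ^ 2 := by positivity
  have h1 : 0 ≤ β ^ 2 / (4 * t) := by positivity
  rcases le_total 1 (d ^ 2 / σ ^ 2) with h | h
  · rw [min_eq_left h]
    exact (min_le_right _ _).trans (by linarith)
  · rw [min_eq_right h]
    refine (min_le_left _ _).trans ?_
    have h2 : 0 ≤ d ^ 2 / σ ^ 2 := by positivity
    have h3 : t * σ ^ 2 + β ^ 2 / (4 * t) * (d ^ 2 / σ ^ 2) - β * d =
        t * (σ - β / (2 * t) * (d / σ)) ^ 2 := by field_simp; ring
    have h4 : 0 ≤ t * (σ - β / (2 * t) * (d / σ)) ^ 2 := by positivity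
    linarith

theorem total_const (c : ℝ) : ∀ {K : ℕ} {l : List (S × List (Sample S A))},
    l ∈ (episodesLaw I P μ K).support →
      total (fun _ _ => 0) (fun _ _ _ => c) l = c * I.H * K := by
  intro K
  induction K with
  | zero =>
    intro l hl
    have e : l = [] := by simpa [episodesLaw] using hl
    simp [e, total]
  | succ K ih =>
    intro l hl
    obtain ⟨l', hl', s, hs, e, he, rfl⟩ := mem_support_episodesLaw_succ hl
    rw [total, ih hl', sumFrom_const, length_of_mem_support_episodeLaw he]
    push_cast
    ring

/-- A bound of the sum of the bonuses that still contains this sum, and the sum of the optimistic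
values, on the right-hand side; the parameter `t` is the price of the weights. -/
theorem total_exploreReward_le [Fintype S] [Finite A] [Nonempty S] [Nonempty A]
    (M : Setting I F P C L lam Λ) (hK : 0 < K) {l : List (S × List (Sample S A))}
    (hl : l ∈ (episodesLaw I P μ K).support)
    (hg : ∀ l', l' <:+ l → GoodData I P μ K L Λ (historyOf l')) {t : ℝ} (ht : 0 < t) :
    total (fun _ _ => 0) (fun D h x => exploreReward I D h x.pair) l ≤
      t * K + t * I.logNV * ((1 + C * (L / √lam) + 8) *
        total (fun _ _ => 0) (fun D h x => exploreReward I D h x.pair) l +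
        4 * total (fun _ _ => 0) (nextValue I P) l) +
      (I.betaE ^ 2 / (4 * t) + 1) * total (fun _ _ => 0) (relUncertainty I) l := by
  have hH : (0 : ℝ) < I.H := Nat.cast_pos.2 M.H_pos
  have e1 : t * K = total (fun _ _ => 0) (fun _ _ _ => t * (1 / I.H)) l := by
    rw [total_const _ hl]; field_simp
  have key : total (fun _ _ => 0) (fun D h x => exploreReward I D h x.pair) l ≤
      total (fun _ _ => 0 + (t * I.logNV * ((1 + C * (L / √lam) + 8) * 0 + 4 * 0) +
        (I.betaE ^ 2 / (4 * t) + 1) * 0))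
      (fun D h x => t * (1 / I.H) + (t * I.logNV * ((1 + C * (L / √lam) + 8) *
        exploreReward I D h x.pair + 4 * nextValue I P D h x) +
        (I.betaE ^ 2 / (4 * t) + 1) * relUncertainty I D h x)) l := by
    refine total_le_total hl fun l' hl' _ s e he => ?_
    simp only [mul_zero, add_zero, zero_add]
    refine sumFrom_le_sumFrom (H := I.H) (fun h hh z s' => ?_) (by omega) he
    have hD := hg l' hl'
    have h1 := hD.exploreSd_sq_le M hK hh z
    have hsd : 0 < exploreSd I (historyOf l') h z :=
      (one_div_sq_le M.H_pos (M.α_eq ▸ (le_max_right _ _).trans (le_max_right _ _))).1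
    have h2 := min_mul_le (β := I.betaE) (d := I.Dbar h (weights (historyOf l' h)) z) hsd ht
    have h3 := mul_le_mul_of_nonneg_left h1 ht.le
    rw [← exploreReward_eq] at h2
    simp only [relUncertainty, nextValue]
    linarith
  refine key.trans (le_of_eq ?_)
  rw [total_add, total_add, total_const_mul, total_add, total_const_mul, total_const_mul,
    total_const_mul, ← e1]
  ring

theorem sumFrom_sub_eq (Φ : List (Sample S A) → ℝ) (D : History S A) {H : ℕ}
    (e : List (Sample S A)) : ∀ (h : ℕ) (D' : History S A), (∀ h', h ≤ h' → D' h' = D h') →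
      h + e.length ≤ H →
      sumFrom (fun h x => Φ (D h ++ [x]) - Φ (D h)) h e =
        ∑ i ∈ Finset.range H, Φ (appendEpisode D' h e i) - ∑ i ∈ Finset.range H, Φ (D' i) := by
  induction e with
  | nil => intro h D' _ _; simp [sumFrom, appendEpisode]
  | cons x e ih =>
    intro h D' hD hle
    rw [List.length_cons] at hle
    rw [sumFrom, appendEpisode, ih (h + 1) (Function.update D' h (D' h ++ [x]))
      (fun h' hh => by rw [Function.update_of_ne (by omega), hD h' (by omega)]) (by omega)]
    have e1 : ∑ i ∈ Finset.range H, Φ (Function.update D' h (D' h ++ [x]) i) -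
        ∑ i ∈ Finset.range H, Φ (D' i) = Φ (D h ++ [x]) - Φ (D h) := by
      rw [← Finset.sum_sub_distrib, Finset.sum_eq_single h]
      · rw [Function.update_self, hD h le_rfl]
      · intro i _ hi; rw [Function.update_of_ne hi, sub_self]
      · intro hh; exact absurd (Finset.mem_range.2 (by omega)) hh
    linarith

/-- Telescoping: each episode appends one sample to the data of every stage. -/
theorem total_sub_eq (Φ : List (Sample S A) → ℝ) :
    ∀ {K : ℕ} {l : List (S × List (Sample S A))}, l ∈ (episodesLaw I P μ K).support →
      total (fun _ _ => 0) (fun D h x => Φ (D h ++ [x]) - Φ (D h)) l =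
        ∑ i ∈ Finset.range I.H, Φ (historyOf l i) - I.H * Φ [] := by
  intro K
  induction K with
  | zero =>
    intro l hl
    have e : l = [] := by simpa [episodesLaw] using hl
    simp [e, total, historyOf]
  | succ K ih =>
    intro l hl
    obtain ⟨l', hl', s, hs, e, he, rfl⟩ := mem_support_episodesLaw_succ hl
    rw [total, ih hl', sumFrom_sub_eq (H := I.H) Φ _ e 0 (historyOf l') (fun _ _ => rfl)
      (by rw [length_of_mem_support_episodeLaw he]; omega), historyOf]
    ring

/-- The sum of the truncated relative uncertainties grows only logarithmically. -/
theorem total_relUncertainty_le [Fintype S] [Fintype A] (M : Setting I F P C L lam Λ)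
    {l : List (S × List (Sample S A))} (hl : l ∈ (episodesLaw I P μ K).support)
    (hg : ∀ l', l' <:+ l → GoodData I P μ K L Λ (historyOf l')) :
    total (fun _ _ => 0) (relUncertainty I) l ≤ 2 * C ^ 2 * L ^ 2 *
      (I.H * (Fintype.card (S × A) * Real.log (1 + K * I.H / lam))) := by
  have hC := M.one_le_C
  have hH : (0 : ℝ) < I.H := Nat.cast_pos.2 M.H_pos
  have hl0 := M.lam_pos
  let Φ : List (Sample S A) → ℝ := fun l => potential lam (weights l)
  -- each summand is at most the increase of the potential of its stage
  have h1 : total (fun _ _ => 0) (relUncertainty I) l ≤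
      total (fun _ _ => 2 * C ^ 2 * L ^ 2 * 0)
        (fun D h x => 2 * C ^ 2 * L ^ 2 * (Φ (D h ++ [x]) - Φ (D h))) l := by
    refine total_le_total hl fun l' hl' _ s e he => ?_
    rw [mul_zero, zero_add, zero_add]
    refine sumFrom_le_sumFrom (H := I.H) (fun h hh z s' => ?_) (by omega) he
    have hD := hg l' hl'
    have h2 := min_one_le_mul_potential_sub (M.bounded h hh) hl0 M.one_le_L
      (one_le_pow₀ hC : 1 ≤ C ^ 2) (weights (historyOf l' h)) (z, exploreSd I (historyOf l') h z)
    simp only [Φ, weights, List.map_append, List.map_cons, List.map_nil] at h2 ⊢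
    refine le_trans (min_le_min le_rfl ?_) h2
    gcongr
    have h3 := M.oracle h hh (weights (historyOf l' h)) (hD.sd_pos M) z
    calc _ ≤ (C * √(uncertaintySq (F h) lam (weights (historyOf l' h)) z)) ^ 2 :=
          pow_le_pow_left₀ (hD.Dbar_nonneg M hh z) h3.2 2
      _ = _ := by rw [mul_pow, Real.sq_sqrt (uncertaintySq_nonneg hl0 _ _)]; rfl
  refine h1.trans ?_
  rw [total_const_mul, total_sub_eq Φ hl]
  gcongr
  have h0 : Φ [] = 0 := potential_nil hl0
  rw [h0, mul_zero, sub_zero]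
  refine (Finset.sum_le_card_nsmul _ _ (Fintype.card (S × A) * Real.log (1 + K * I.H / lam))
    fun h _ => ?_).trans (by rw [Finset.card_range, nsmul_eq_mul])
  have hD := hg l (List.suffix_refl l)
  have hα : 0 < 1 / √(I.H : ℝ) := by positivity
  refine (potential_le hl0 hα (weights (historyOf l h)) fun x hx => ?_).trans ?_
  · obtain ⟨y, hy, rfl⟩ := List.mem_map.1 hx
    exact M.α_eq ▸ hD.sd_le h y hy
  · have hlen : ((weights (historyOf l h)).length : ℝ) ≤ K := by
      rw [weights, List.length_map]; exact Nat.cast_le.2 (hD.length h)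
    have e : (1 / √(I.H : ℝ)) ^ 2 = 1 / I.H := by
      rw [div_pow, one_pow, Real.sq_sqrt hH.le]
    rw [e, div_div_eq_mul_div, div_one]
    gcongr

end

section

variable {S : Type u} {A : Type v} {I : Input S A} {F : ℕ → Set (S × A → ℝ)}
  {P : ℕ → S × A → PMF S} {μ : PMF S} {C L lam Λ : ℝ} {K : ℕ}

/-! ### From exploration to planning -/

/-- The loss of the planned policy, in the units of the original reward, is controlled by the
optimistic initial value of every earlier exploration episode. -/
theorem GoodData.regret_le [Fintype S] [Finite A] [Nonempty A]
    (M : Setting I F P C L lam Λ) (hK : 0 < K) {D D' : History S A}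
    (hD : GoodData I P μ K L Λ D) (hD' : GoodData I P μ K L Λ D')
    (hDD' : ∀ h, ∃ t, D h = D' h ++ t) {r : ℕ → S × A → ℝ} (hr : AdmissibleReward I.H P μ r) :
    expect μ (fun s => optValue I.H P r 0 s -
        value I.H P r (planPolicy I D fun h z => r h z / I.H) 0 s) ≤
      2 * C * (I.H * expect μ (exploreV I D' 0)) := by
  have hH : (0 : ℝ) < I.H := Nat.cast_pos.2 M.H_pos
  obtain ⟨hr0, hr1⟩ := hr.nonneg_and_sum_le
  set r' : ℕ → S × A → ℝ := fun h z => r h z / I.H with hr'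
  have hr0' : ∀ h < I.H, ∀ z, 0 ≤ r' h z := fun h hh z => div_nonneg (hr0 h hh z) hH.le
  have hr1' : ∀ s a, IsPossible I.H P μ s a →
      ∑ h ∈ Finset.range I.H, r' h (s h, a h) ≤ 1 := fun s a hsa => by
    rw [hr', ← Finset.sum_div, div_le_one hH]
    exact hr1 s a hsa
  have hval : ∀ π s, value I.H P r π 0 s = I.H * value I.H P r' π 0 s := fun π s => by
    rw [hr', value_div]; field_simp
  rw [← mul_assoc, ← expect_const_mul]
  refine expect_mono _ fun s hs => ?_
  have h1 := hD.planV_sub_value_le hK M hD' hDD' hr0' hr1' 0 s hs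
  have h2 : optValue I.H P r 0 s ≤ I.H * planV I D r' 0 s := by
    have : Nonempty (ℕ → S → A) := inferInstance
    refine ciSup_le fun π => ?_
    rw [hval]
    exact mul_le_mul_of_nonneg_left (hD.value_le_planV hK M hr0' hr1' π 0 s hs) hH.le
  have h3 := mul_le_mul_of_nonneg_left h1 hH.le
  rw [hval]
  linarith

/-- The loss for the final data is below a multiple of the optimistic value in each of the `K`
episodes, hence below their average. -/
theorem plansWell_of_total_le [Fintype S] [Finite A] [Nonempty A] (M : Setting I F P C L lam Λ)
    (hK : 0 < K) {l : List (S × List (Sample S A))} (hl : l ∈ (episodesLaw I P μ K).support)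
    (hg : ∀ l', l' <:+ l → GoodData I P μ K L Λ (historyOf l')) {ε : ℝ}
    (hΨ : total (fun D _ => I.H * expect μ (exploreV I D 0)) (nextValue I P) l ≤
      ε * K / (2 * C)) : PlansWell I P μ ε (historyOf l) := by
  intro r hr
  have hH : (0 : ℝ) < I.H := Nat.cast_pos.2 M.H_pos
  have hK' : (0 : ℝ) < K := Nat.cast_pos.2 hK
  have hC : 0 < C := zero_lt_one.trans_le M.one_le_C
  set R := expect μ (fun s => optValue I.H P r 0 s -
        value I.H P r (planPolicy I (historyOf l) fun h z => r h z / I.H) 0 s)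
  have h1 : total (fun _ _ => 0) (fun _ _ _ => R / (2 * C) / I.H) l ≤
      total (fun D _ => I.H * expect μ (exploreV I D 0)) (nextValue I P) l := by
    refine total_le_total hl fun l' hl' _ s e he => ?_
    rw [sumFrom_const, length_of_mem_support_episodeLaw he, zero_add, div_mul_cancel₀ _ hH.ne']
    have h2 := (hg l (List.suffix_refl l)).regret_le M hK (hg l' hl')
      (exists_historyOf_eq_append hl') hr
    have h3 : 0 ≤ sumFrom (nextValue I P (historyOf l')) 0 e := by
      have := sumFrom_le_sumFrom (f := fun _ _ => 0) (g := nextValue I P (historyOf l')) (H := I.H)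
        (fun h hh z s' => expect_nonneg _ fun s => ((hg l' hl').exploreV_bounds M (h + 1) s).1)
        (by omega) he
      rwa [sumFrom_const, zero_mul] at this
    have h4 : R / (2 * C) ≤ I.H * expect μ (exploreV I (historyOf l') 0) := by
      rw [div_le_iff₀ (by positivity)]; linarith
    linarith
  rw [total_const _ hl, div_mul_cancel₀ _ hH.ne'] at h1
  have h2 := h1.trans hΨ
  rw [div_mul_eq_mul_div, div_le_div_iff_of_pos_right (by positivity)] at h2
  exact le_of_mul_le_mul_right h2 hK'

/-! ### The noise -/

/-- Exponential moment of the total noise. Each of the at most `2 H` noise terms of an episode is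
bounded by `2 H`, hence the variance proxy `8 H³` per episode. -/
theorem lexpect_exp_noise_le [Fintype S] [Finite A] [Nonempty A] (M : Setting I F P C L lam Λ)
    (θ : ℝ) (hθ : 0 ≤ θ) (K : ℕ) :
    lexpect (episodesLaw I P μ K) (fun l => ENNReal.ofReal (Real.exp
      (θ * total (startNoise I μ) (stepNoise I P) l - 4 * θ ^ 2 * I.H ^ 3 * K))) ≤ 1 := by
  have hH : (1 : ℝ) ≤ I.H := Nat.one_le_cast.2 M.H_pos
  have hH0 : (0 : ℝ) < I.H := by linarith
  refine le_trans (lexpect_mono _ fun l hl => le_of_eq ?_)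
    (lexpect_exp_total_le I P μ (fun D s => θ * startNoise I μ D s - 2 * θ ^ 2 * I.H ^ 3)
      (fun D h x => θ * stepNoise I P D h x - 2 * θ ^ 2 * I.H ^ 2) ?_ ?_ K)
  · congr 2
    -- the exponents subtracted at the start and at the `H` transitions sum to `4 θ² H³`
    have h1 : total (fun _ _ => (2 * θ ^ 2 * I.H ^ 3 : ℝ)) (fun _ _ _ => 2 * θ ^ 2 * I.H ^ 2) l =
        4 * θ ^ 2 * I.H ^ 3 * K := by
      have h2 := total_const (4 * θ ^ 2 * I.H ^ 2) hl
      have h3 : total (fun _ _ => (2 * θ ^ 2 * I.H ^ 3 : ℝ)) (fun _ _ _ => 2 * θ ^ 2 * I.H ^ 2) l =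
          total (fun _ _ => 0) (fun _ _ _ => 4 * θ ^ 2 * I.H ^ 2) l := by
        refine le_antisymm (total_le_total hl fun l' _ _ s e he => ?_)
          (total_le_total hl fun l' _ _ s e he => ?_) <;>
        · rw [sumFrom_const, sumFrom_const, length_of_mem_support_episodeLaw he]
          exact le_of_eq (by ring)
      rw [h3, h2]; ring
    rw [← h1, ← total_const_mul, sub_eq_add_neg, ← neg_one_mul, ← total_const_mul, ← total_add]
    congr 1
    · funext D s; ring
    · funext D h x; ring
  · intro D hD
    have hV := (FloorData.mk hD).exploreV_bounds M 0
    have e : ∀ s, θ * startNoise I μ D s = (-(θ * I.H)) *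
        (exploreV I D 0 s - expect μ (exploreV I D 0)) := fun s => by rw [startNoise]; ring
    simp only [e]
    refine lexpect_exp_sub_le_one μ _ (θ * I.H) _ (by positivity) (fun s => ?_)
      (expect_sub_expect _ _ _) ?_
    · rw [abs_mul, abs_neg, abs_of_nonneg (by positivity : 0 ≤ θ * I.H)]
      exact mul_le_of_le_one_right (by positivity) (abs_sub_expect_le _ hV s)
    · have : (θ * I.H) ^ 2 ≤ θ ^ 2 * I.H ^ 3 := by
        rw [mul_pow]; gcongr; norm_num
      nlinarith [mul_nonneg (sq_nonneg θ) (pow_nonneg hH0.le 3)]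
  · intro D hD h hh z σ
    have hV := (FloorData.mk hD).exploreV_bounds M (h + 1)
    have hhH : (h : ℝ) + 1 ≤ I.H := by exact_mod_cast hh
    have e : ∀ s', θ * stepNoise I P D h ⟨z, s', σ⟩ = (-(θ * (I.H + h + 1))) *
        (exploreV I D (h + 1) s' - expect (P h z) (exploreV I D (h + 1))) := fun s' => by
      rw [stepNoise, nextValue]; ring
    simp only [e]
    refine lexpect_exp_sub_le_one (P h z) _ (θ * (2 * I.H)) _ (by positivity) (fun s => ?_)
      (expect_sub_expect _ _ _) (le_of_eq (by ring))
    rw [abs_mul, abs_neg, abs_of_nonneg (by positivity : 0 ≤ θ * ((I.H : ℝ) + h + 1))]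
    calc _ ≤ θ * (2 * I.H) * 1 := by
          gcongr
          · linarith
          · exact abs_sub_expect_le _ hV s
      _ = _ := mul_one _

/-! ### The success probability -/

/-- Outside two events of probability at most `δ / 2`, all data are good and the noise is small. -/
theorem ofReal_one_sub_le_exploration [Fintype S] [Fintype A] [Nonempty A]
    (M : Setting I F P C L lam Λ) (hK : 0 < K) {δ ε θ N : ℝ} (hδ : 0 < δ) (hθ : 0 < θ)
    (hΛ : confCount S A I.H K L * Real.exp (-Λ) ≤ δ / 2)
    (hN : Real.log (2 / δ) / θ + 4 * θ * I.H ^ 3 * K ≤ N)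
    (hΨ : ∀ l ∈ (episodesLaw I P μ K).support,
      (∀ l', l' <:+ l → GoodData I P μ K L Λ (historyOf l')) →
      total (startNoise I μ) (stepNoise I P) l ≤ N →
      total (fun D _ => I.H * expect μ (exploreV I D 0)) (nextValue I P) l ≤
        ε * K / (2 * C)) :
    ENNReal.ofReal (1 - δ) ≤
      (exploration I P μ K).toOuterMeasure {D | PlansWell I P μ ε D} := by
  obtain ⟨g, hg, hg'⟩ := exists_confident_certificate I M.α_eq M.H_pos P μ K L Λ
  rw [exploration_eq_map, PMF.toOuterMeasure_map_apply]
  refine ofReal_one_sub_le_toOuterMeasure _ _ (fun l => g l + ENNReal.ofReal (δ / 2) *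
    ENNReal.ofReal (Real.exp (θ * total (startNoise I μ) (stepNoise I P) l -
      4 * θ ^ 2 * I.H ^ 3 * K))) δ hδ.le (fun l hl hbad => ?_) ?_
  · rcases hg' l with h1 | h1
    · exact h1.trans le_self_add
    have hgood : ∀ l', l' <:+ l → GoodData I P μ K L Λ (historyOf l') := by
      intro l' hl'
      obtain ⟨k, hk, hk'⟩ := mem_support_episodesLaw_of_suffix hl hl'
      have h2 := length_historyOf_le l'
      rw [length_of_mem_support_episodesLaw hk'] at h2
      exact ⟨⟨fun h x hx => (forall_mem_historyOf hk' h x hx).2⟩,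
        fun h x hx => (forall_mem_historyOf hk' h x hx).1, fun h => (h2 h).trans hk, h1 l' hl'⟩
    have hlt : N < total (startNoise I μ) (stepNoise I P) l := by
      by_contra hle
      exact hbad (plansWell_of_total_le M hK hl hgood (hΨ l hl hgood (not_lt.1 hle)))
    refine le_trans ?_ le_add_self
    rw [← ENNReal.ofReal_mul (by positivity), ENNReal.one_le_ofReal]
    have h3 : Real.log (2 / δ) ≤ θ * total (startNoise I μ) (stepNoise I P) l -
        4 * θ ^ 2 * I.H ^ 3 * K := by
      have h4 := mul_le_mul_of_nonneg_left (hN.trans hlt.le) hθ.le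
      have h5 : θ * (Real.log (2 / δ) / θ + 4 * θ * I.H ^ 3 * K) =
          Real.log (2 / δ) + 4 * θ ^ 2 * I.H ^ 3 * K := by field_simp
      linarith
    have h4 := Real.exp_le_exp.2 h3
    rw [Real.exp_log (by positivity)] at h4
    calc (1 : ℝ) = δ / 2 * (2 / δ) := by field_simp
      _ ≤ _ := by gcongr
  · rw [lexpect_add, lexpect_const_mul]
    calc _ ≤ ENNReal.ofReal (δ / 2) + ENNReal.ofReal (δ / 2) * 1 := by
          gcongr
          · exact hg.trans (ENNReal.ofReal_le_ofReal hΛ)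
          · exact lexpect_exp_noise_le M θ hθ.le K
      _ = ENNReal.ofReal δ := by
          rw [mul_one, ← ENNReal.ofReal_add (by positivity) (by positivity), add_halves]

/-- The self-bounding step: the weights exceed their floor only by a multiple of the optimistic
values, which are in turn bounded by the sum of the bonuses. A small `t` makes this feedback a
contraction. -/
theorem total_value_le_of_small [Fintype S] [Fintype A] [Nonempty S] [Nonempty A]
    (M : Setting I F P C L lam Λ) (hK : 0 < K) {l : List (S × List (Sample S A))}
    (hl : l ∈ (episodesLaw I P μ K).support)
    (hg : ∀ l', l' <:+ l → GoodData I P μ K L Λ (historyOf l')) {t N : ℝ} (ht : 0 < t)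
    (htN : t * I.logNV * (I.H * (C * (L / √lam) + 41)) ≤ 1 / 2) (hN0 : 0 ≤ N)
    (hN : total (startNoise I μ) (stepNoise I P) l ≤ N) :
    total (fun D _ => I.H * expect μ (exploreV I D 0)) (nextValue I P) l ≤
      16 * I.H * t * K + 2 * N + 16 * I.H * (I.betaE ^ 2 / (4 * t) + 1) *
        (2 * C ^ 2 * L ^ 2 * (I.H * (Fintype.card (S × A) * Real.log (1 + K * I.H / lam)))) := by
  have hH : (1 : ℝ) ≤ I.H := Nat.one_le_cast.2 M.H_pos
  have hL := M.one_le_L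
  have hC := M.one_le_C
  have hNV := M.logNV_nonneg
  have hm : 0 ≤ C * (L / √lam) := by positivity
  have h1 := total_value_le M hK hl hg
  have h2 := total_exploreReward_le M hK hl hg ht
  have h3 := total_relUncertainty_le M hl hg
  have h4 : total (fun _ _ => 0) (nextValue I P) l ≤
      total (fun D _ => I.H * expect μ (exploreV I D 0)) (nextValue I P) l := by
    refine total_le_total hl fun l' hl' _ s e he => ?_
    have := expect_nonneg μ fun s => ((hg l' hl').exploreV_bounds M 0 s).1
    gcongr
    positivity
  have hB : 0 ≤ total (fun _ _ => 0) (fun D h x => exploreReward I D h x.pair) l := by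
    have h5 := total_const (P := P) (μ := μ) 0 hl
    rw [zero_mul, zero_mul] at h5
    refine h5.ge.trans (total_le_total hl fun l' hl' _ s e he => ?_)
    gcongr
    exact sumFrom_le_sumFrom (f := fun _ _ => 0)
      (g := fun h x => exploreReward I (historyOf l') h x.pair) (H := I.H) (fun h hh z s' =>
        ((hg l' hl').exploreReward_bounds M hh z).1) (by omega) he
  set B := total (fun _ _ => 0) (fun D h x => exploreReward I D h x.pair) l
  set Ψ := total (fun D _ => I.H * expect μ (exploreV I D 0)) (nextValue I P) l
  set p := total (fun _ _ => 0) (nextValue I P) l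
  set U := total (fun _ _ => 0) (relUncertainty I) l
  set U' := 2 * C ^ 2 * L ^ 2 * (I.H * (Fintype.card (S × A) * Real.log (1 + K * I.H / lam)))
  set m := C * (L / √lam)
  set q := I.betaE ^ 2 / (4 * t) + 1 with hq
  have hq0 : 0 ≤ q := by positivity
  have hp : p ≤ 8 * I.H * B + N := by linarith
  have htN0 : 0 ≤ t * I.logNV := by positivity
  have h6 : t * I.logNV * ((1 + m + 8) * B + 4 * p) ≤
      t * I.logNV * (I.H * (m + 41)) * B + 4 * (t * I.logNV) * N := by
    have e : (1 + m + 8) * B + 4 * p ≤ I.H * (m + 41) * B + 4 * N := by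
      have : (m + 9) * B ≤ I.H * (m + 9) * B := by
        gcongr
        exact le_mul_of_one_le_left (by positivity) hH
      linarith
    have := mul_le_mul_of_nonneg_left e htN0
    linarith
  have h7 : t * I.logNV * (I.H * (m + 41)) * B ≤ 1 / 2 * B := by gcongr
  have h8 : q * U ≤ q * U' := by gcongr
  have h9 : B ≤ 2 * t * K + 8 * (t * I.logNV) * N + 2 * (q * U') := by linarith
  have h10 : 64 * (t * I.logNV * I.H) ≤ 1 := by
    have : t * I.logNV * I.H * 41 ≤ t * I.logNV * (I.H * (m + 41)) := by
      rw [mul_assoc (t * I.logNV)]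
      gcongr
      linarith
    have h0 : 0 ≤ t * I.logNV * I.H := by positivity
    linarith
  have h11 := mul_le_mul_of_nonneg_left h9 (by positivity : 0 ≤ 8 * (I.H : ℝ))
  have h12 := mul_le_mul_of_nonneg_right h10 hN0
  linarith

end

/-! ### Logarithmic factors -/

section Log

variable {H K : ℕ} {ε δ : ℝ}

theorem log_le_logFactor {y : ℝ} (hy0 : 0 < y) (hy : y ≤ Real.exp 1 + K * H / (ε * δ)) :
    Real.log y ≤ logFactor H K ε δ := Real.log_le_log hy0 hy

theorem one_le_logFactor (hε : 0 < ε) (hδ : 0 < δ) : 1 ≤ logFactor H K ε δ := by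
  have h : Real.exp 1 ≤ Real.exp 1 + K * H / (ε * δ) := le_add_of_nonneg_right (by positivity)
  calc (1 : ℝ) = Real.log (Real.exp 1) := (Real.log_exp 1).symm
    _ ≤ _ := log_le_logFactor (Real.exp_pos _) h

theorem mul_le_div_mul (hε : 0 < ε) (hε1 : ε < 1) (hδ : 0 < δ) (hδ1 : δ < 1) :
    (K : ℝ) * H ≤ K * H / (ε * δ) :=
  le_div_self (by positivity) (by positivity) (mul_le_one₀ hε1.le hδ.le hδ1.le)

theorem log_natCast_le_left (hH : 0 < H) (hK : 0 < K) (hε : 0 < ε) (hε1 : ε < 1) (hδ : 0 < δ)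
    (hδ1 : δ < 1) : Real.log K ≤ logFactor H K ε δ := by
  have hH1 : (1 : ℝ) ≤ H := Nat.one_le_cast.2 hH
  have hK' : (0 : ℝ) < K := Nat.cast_pos.2 hK
  have h1 := mul_le_div_mul (H := H) (K := K) hε hε1 hδ hδ1
  have h2 : (K : ℝ) ≤ K * H := le_mul_of_one_le_right hK'.le hH1
  exact log_le_logFactor hK' (by linarith [Real.exp_pos 1])

theorem log_natCast_le_right (hH : 0 < H) (hK : 0 < K) (hε : 0 < ε) (hε1 : ε < 1) (hδ : 0 < δ)
    (hδ1 : δ < 1) : Real.log H ≤ logFactor H K ε δ := by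
  have hK1 : (1 : ℝ) ≤ K := Nat.one_le_cast.2 hK
  have hH' : (0 : ℝ) < H := Nat.cast_pos.2 hH
  have h1 := mul_le_div_mul (H := H) (K := K) hε hε1 hδ hδ1
  have h2 : (H : ℝ) ≤ K * H := le_mul_of_one_le_left hH'.le hK1
  exact log_le_logFactor hH' (by linarith [Real.exp_pos 1])

theorem one_le_cast_mul (hH : 0 < H) (hK : 0 < K) : (1 : ℝ) ≤ K * H := by
  exact_mod_cast Nat.mul_pos hK hH

theorem log_one_div_eps_le (hH : 0 < H) (hK : 0 < K) (hε : 0 < ε) (hδ : 0 < δ)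
    (hδ1 : δ < 1) : Real.log (1 / ε) ≤ logFactor H K ε δ := by
  refine log_le_logFactor (by positivity) ?_
  have : 1 / ε ≤ K * H / (ε * δ) := by
    rw [div_le_div_iff₀ hε (by positivity)]
    nlinarith [one_le_cast_mul hH hK, mul_le_mul_of_nonneg_left (one_le_cast_mul hH hK) hε.le]
  linarith [Real.exp_pos 1]

theorem log_one_div_delta_le (hH : 0 < H) (hK : 0 < K) (hε : 0 < ε) (hε1 : ε < 1) (hδ : 0 < δ) :
    Real.log (1 / δ) ≤ logFactor H K ε δ := by
  refine log_le_logFactor (by positivity) ?_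
  have : 1 / δ ≤ K * H / (ε * δ) := by
    rw [div_le_div_iff₀ hδ (by positivity)]
    nlinarith [one_le_cast_mul hH hK, mul_le_mul_of_nonneg_left (one_le_cast_mul hH hK) hδ.le]
  linarith [Real.exp_pos 1]

theorem log_one_add_div_le (hε : 0 < ε) (hε1 : ε < 1) (hδ : 0 < δ) (hδ1 : δ < 1) {lam : ℝ}
    (hl : 0 < lam) :
    Real.log (1 + K * H / lam) ≤ (1 + 1 / lam) * logFactor H K ε δ := by
  have hℓ := one_le_logFactor (H := H) (K := K) hε hδ
  have h0 : (0 : ℝ) ≤ K * H := by positivity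
  have h1 : (1 : ℝ) + K * H / lam ≤ (1 + 1 / lam) * (1 + K * H) := by
    have : (1 + 1 / lam) * (1 + K * H) = 1 + K * H / lam + (1 / lam + K * H) := by ring
    rw [this]
    exact le_add_of_nonneg_right (by positivity)
  have h2 : Real.log (1 + 1 / lam) ≤ 1 / lam := by
    have := Real.log_le_sub_one_of_pos (show 0 < 1 + 1 / lam by positivity)
    linarith
  have h3 : Real.log (1 + K * H) ≤ logFactor H K ε δ := by
    refine log_le_logFactor (by positivity) ?_
    have := mul_le_div_mul (H := H) (K := K) hε hε1 hδ hδ1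
    linarith [Real.add_one_le_exp 1]
  calc _ ≤ Real.log ((1 + 1 / lam) * (1 + K * H)) := Real.log_le_log (by positivity) h1
    _ = Real.log (1 + 1 / lam) + Real.log (1 + K * H) :=
        Real.log_mul (by positivity) (by positivity)
    _ ≤ 1 / lam * 1 + logFactor H K ε δ := by linarith
    _ ≤ 1 / lam * logFactor H K ε δ + logFactor H K ε δ := by gcongr
    _ = _ := by ring

end Log

/-! ### Covering numbers -/

section Cover

variable {S : Type u} {A : Type v} [Fintype S] [Fintype A] {H : ℕ} {F : ℕ → Set (S × A → ℝ)}
  {L : ℝ}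

theorem two_pow_le_coverF (hH : 0 < H) (hF : ∀ h < H, HasFiniteCovers (F h))
    (hc : ∀ h < H, ∀ B, corner B ∈ F h) {η : ℝ} (h0 : 0 < η) (hη : η < 3 / 2) :
    2 ^ Fintype.card (S × A) ≤ coverF H F η :=
  (two_pow_le_coveringNumber (hF 0 hH) (hc 0 hH) h0 hη).trans
    (Finset.le_sup (f := fun h => coveringNumber (F h) η) (Finset.mem_range.2 hH))

theorem card_mul_log_two_le (hH : 0 < H) (hF : ∀ h < H, HasFiniteCovers (F h))
    (hc : ∀ h < H, ∀ B, corner B ∈ F h) {η : ℝ} (h0 : 0 < η) (hη : η < 3 / 2) :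
    Fintype.card (S × A) * Real.log 2 ≤ Real.log (coverF H F η) := by
  rw [← Real.log_pow]
  exact Real.log_le_log (by positivity) (by exact_mod_cast two_pow_le_coverF hH hF hc h0 hη)

theorem log_natCast_le_of_le_floor {N X : ℕ} {M : ℝ} (hM : 0 ≤ M) (hN : N ≤ (⌊M⌋₊ + 1) ^ X) :
    Real.log N ≤ X * Real.log (M + 1) := by
  rcases Nat.eq_zero_or_pos N with rfl | h0
  · rw [Nat.cast_zero, Real.log_zero]
    exact mul_nonneg (Nat.cast_nonneg _) (Real.log_nonneg (by linarith))
  rw [← Real.log_pow]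
  refine Real.log_le_log (Nat.cast_pos.2 h0) ?_
  calc (N : ℝ) ≤ ((⌊M⌋₊ + 1) ^ X : ℕ) := Nat.cast_le.2 hN
    _ = ((⌊M⌋₊ : ℝ) + 1) ^ X := by push_cast; ring
    _ ≤ _ := by gcongr; exact Nat.floor_le hM

theorem log_coverF_le (hL : 0 ≤ L) (hb : BoundedClass H F L) {η : ℝ} (hη : 0 < η) :
    Real.log (coverF H F η) ≤ Fintype.card (S × A) * Real.log (L / η + 1) :=
  log_natCast_le_of_le_floor (by positivity) (Finset.sup_le fun h hh =>
    coveringNumber_le hη (hb h (Finset.mem_range.1 hh)))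

/-- `log (y / ε + 1)` is at most a multiple of the logarithmic factor. -/
theorem log_div_add_one_le {y ε ℓ : ℝ} (hy : 0 ≤ y) (hε : 0 < ε) (hε1 : ε < 1)
    (hℓ : Real.log (1 / ε) ≤ ℓ) : Real.log (y / ε + 1) ≤ y + ℓ := by
  have h1 : y / ε + 1 ≤ (y + 1) * (1 / ε) := by
    have : 1 ≤ 1 / ε := by rw [le_div_iff₀ hε]; linarith
    calc _ ≤ y / ε + 1 / ε := by linarith
      _ = _ := by ring
  have h2 := Real.log_le_sub_one_of_pos (show 0 < y + 1 by linarith)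
  calc _ ≤ Real.log ((y + 1) * (1 / ε)) := Real.log_le_log (by positivity) h1
    _ = Real.log (y + 1) + Real.log (1 / ε) := Real.log_mul (by positivity) (by positivity)
    _ ≤ _ := by linarith

theorem log_confCount_le [Nonempty S] [Nonempty A] {K : ℕ} {ε δ : ℝ} (hH : 0 < H) (hK : 0 < K)
    (hε : 0 < ε) (hε1 : ε < 1) (hδ : 0 < δ) (hδ1 : δ < 1) (hL : 1 ≤ L) :
    0 < confCount S A H K L ∧ Real.log (2 / δ * confCount S A H K L) ≤
      (2 * L + 8) * (Fintype.card (S × A) * logFactor H K ε δ) := by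
  have hH' : (1 : ℝ) ≤ H := Nat.one_le_cast.2 hH
  have hK' : (1 : ℝ) ≤ K := Nat.one_le_cast.2 hK
  have hℓ := one_le_logFactor (H := H) (K := K) hε hδ
  have hlK := log_natCast_le_left hH hK hε hε1 hδ hδ1
  have hlH := log_natCast_le_right hH hK hε hε1 hδ hδ1
  have hlδ := log_one_div_delta_le hH hK hε hε1 hδ
  have hX : (1 : ℝ) ≤ Fintype.card (S × A) := Nat.one_le_cast.2 Fintype.card_pos
  have hSX : (Fintype.card S : ℝ) ≤ Fintype.card (S × A) := by
    rw [Fintype.card_prod]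
    exact_mod_cast Nat.le_mul_of_pos_right _ Fintype.card_pos
  have hlog2 : Real.log 2 ≤ 1 := by linarith [Real.log_two_lt_d9]
  set X : ℝ := ((Fintype.card (S × A) : ℕ) : ℝ)
  set ℓ := logFactor H K ε δ
  have hM : Real.log ((⌊2 * L * (H * K : ℕ)⌋₊ + 1 : ℕ) : ℝ) ≤ 2 * L + 2 * ℓ := by
    have h1 : ((⌊2 * L * (H * K : ℕ)⌋₊ + 1 : ℕ) : ℝ) ≤ (2 * L + 1) * (H * K) := by
      have h2 := Nat.floor_le (show 0 ≤ 2 * L * (H * K : ℕ) by positivity)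
      have h3 : (1 : ℝ) ≤ H * K := one_le_mul_of_one_le_of_one_le hH' hK'
      push_cast at h2 ⊢
      linarith
    have h4 := Real.log_le_sub_one_of_pos (show 0 < 2 * L + 1 by linarith)
    calc _ ≤ Real.log ((2 * L + 1) * (H * K)) := Real.log_le_log (by positivity) h1
      _ = Real.log (2 * L + 1) + (Real.log H + Real.log K) := by
          rw [Real.log_mul (by positivity) (by positivity),
            Real.log_mul (by positivity) (by positivity)]
      _ ≤ _ := by linarith
  have hK1 : Real.log ((K : ℝ) + 1) ≤ 1 + ℓ := by
    calc _ ≤ Real.log (2 * K) := Real.log_le_log (by positivity) (by linarith)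
      _ = Real.log 2 + Real.log K := Real.log_mul (by positivity) (by positivity)
      _ ≤ _ := by linarith
  have hpos : (0 : ℝ) < (⌊2 * L * (H * K : ℕ)⌋₊ + 1 : ℕ) := by positivity
  refine ⟨by unfold confCount; positivity, ?_⟩
  have e : Real.log (2 / δ * confCount S A H K L) = Real.log 2 + Real.log (1 / δ) +
      (Real.log ((K : ℝ) + 1) + (Real.log H + (Fintype.card S * Real.log 2 +
        X * Real.log ((⌊2 * L * (H * K : ℕ)⌋₊ + 1 : ℕ) : ℝ)))) := by
    unfold confCount
    rw [show (2 / δ : ℝ) = 2 * (1 / δ) by ring, Real.log_mul (by positivity) (by positivity),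
      Real.log_mul (by positivity) (by positivity), Real.log_mul (by positivity) (by positivity),
      Real.log_mul (by positivity) (by positivity), Real.log_mul (by positivity) (by positivity),
      Real.log_pow, Real.log_pow]
  rw [e]
  have h1 : (Fintype.card S : ℝ) * Real.log 2 ≤ X * 1 := by
    gcongr
  have h2 : X * Real.log ((⌊2 * L * (H * K : ℕ)⌋₊ + 1 : ℕ) : ℝ) ≤ X * (2 * L + 2 * ℓ) := by
    gcongr
  have h3 : 1 ≤ X * ℓ := one_le_mul_of_one_le_of_one_le hX hℓ
  have h4 : ℓ ≤ X * ℓ := le_mul_of_one_le_left (by linarith) hX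
  have h5 : X ≤ X * ℓ := le_mul_of_one_le_right (by linarith) hℓ
  have h6 : X * L ≤ X * ℓ * L := by gcongr
  linarith

end Cover

/-! ### The constants -/

/-- The upper bound `C L / √λ` of the bonuses. -/
def bonusBound (C L lam : ℝ) : ℝ := C * (L / √lam)

/-- The confidence radius is this constant times `ℓ √(H |S × A|)`, `ℓ` the logarithmic factor. -/
def radiusConst (C L lam : ℝ) : ℝ :=
  1 + (16 * (2 * L + 8) + 5 + lam + (2 * L + 4 * bonusBound C L lam + 4))

/-- `log N_V(ε)` is at most this constant times `ℓ |S × A|`. -/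
def coverConst (C L lam : ℝ) : ℝ := 2 * L + 4 * bonusBound C L lam + 4 + radiusConst C L lam

/-- The sum of the truncated relative uncertainties is at most this constant times
`ℓ H |S × A|`. -/
def potentialConst (C L lam : ℝ) : ℝ := 2 * C ^ 2 * L ^ 2 * (1 + 1 / lam)

/-- The factor `τ` in the parameter `t = τ ε / (H max (1, ε ℓ |S × A|))` of
`total_value_le_of_small`. -/
def feedbackConst (C L lam : ℝ) : ℝ :=
  1 / (128 * C * coverConst C L lam * (bonusBound C L lam + 41))

/-- The number of episodes has to exceed this constant times
`ℓ⁴ H⁴ |S × A|² max (1, ε |S × A|) / ε²`. -/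
def episodeConst (C L lam : ℝ) : ℝ :=
  32 * C * radiusConst C L lam ^ 2 * potentialConst C L lam / feedbackConst C L lam +
    128 * C * potentialConst C L lam + 8192 * C ^ 2

/-- The constant `c` of the theorem. -/
def mainConst (C L lam : ℝ) : ℝ := 4 * episodeConst C L lam + 2 * radiusConst C L lam + 4

section Const

variable {C L lam : ℝ}

theorem bonusBound_nonneg (hC : 1 ≤ C) (hL : 1 ≤ L) : 0 ≤ bonusBound C L lam := by
  unfold bonusBound; positivity

theorem one_le_radiusConst (hC : 1 ≤ C) (hL : 1 ≤ L) (hl : 0 < lam) :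
    1 ≤ radiusConst C L lam := by
  have := bonusBound_nonneg (lam := lam) hC hL
  unfold radiusConst
  linarith

theorem le_radiusConst_sq (hC : 1 ≤ C) (hL : 1 ≤ L) (hl : 0 < lam) :
    16 * (2 * L + 8) + 5 + lam ≤ radiusConst C L lam ^ 2 ∧
      coverConst C L lam ≤ radiusConst C L lam ^ 2 := by
  have hm := bonusBound_nonneg (lam := lam) hC hL
  set q := 16 * (2 * L + 8) + 5 + lam + (2 * L + 4 * bonusBound C L lam + 4) with hq
  have e : radiusConst C L lam = 1 + q := rfl
  have hq0 : 0 ≤ q := by positivity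
  unfold coverConst
  rw [e]
  have : (1 + q) ^ 2 = 1 + 2 * q + q ^ 2 := by ring
  have := sq_nonneg q
  constructor <;> linarith

theorem one_le_coverConst (hC : 1 ≤ C) (hL : 1 ≤ L) (hl : 0 < lam) :
    1 ≤ coverConst C L lam := by
  have := bonusBound_nonneg (lam := lam) hC hL
  have := one_le_radiusConst hC hL hl
  unfold coverConst
  linarith

theorem potentialConst_pos (hC : 1 ≤ C) (hL : 1 ≤ L) (hl : 0 < lam) :
    0 < potentialConst C L lam := by
  unfold potentialConst; positivity

theorem feedbackConst_pos (hC : 1 ≤ C) (hL : 1 ≤ L) (hl : 0 < lam) :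
    0 < feedbackConst C L lam := by
  have := bonusBound_nonneg (lam := lam) hC hL
  have := one_le_coverConst hC hL hl
  unfold feedbackConst; positivity

theorem feedbackConst_le (hC : 1 ≤ C) (hL : 1 ≤ L) (hl : 0 < lam) :
    feedbackConst C L lam ≤ 1 / (128 * C) ∧
      feedbackConst C L lam * coverConst C L lam * (bonusBound C L lam + 41) ≤ 1 / 2 := by
  have hm := bonusBound_nonneg (lam := lam) hC hL
  have hN := one_le_coverConst hC hL hl
  unfold feedbackConst
  constructor
  · refine div_le_div_of_nonneg_left zero_le_one (by positivity) ?_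
    calc 128 * C = 128 * C * 1 * 1 := by ring
      _ ≤ _ := by gcongr; linarith
  · have e : 1 / (128 * C * coverConst C L lam * (bonusBound C L lam + 41)) *
        coverConst C L lam * (bonusBound C L lam + 41) = 1 / (128 * C) := by field_simp
    rw [e]
    gcongr
    linarith

/-- The choice of all parameters makes the bound of `total_value_le_of_small` small enough. -/
theorem parameter_choice (hC : 1 ≤ C) (hL : 1 ≤ L) (hl : 0 < lam) {H X ℓ ε K u n β t : ℝ}
    (hH : 1 ≤ H) (hX : 1 ≤ X) (hℓ : 1 ≤ ℓ) (hε : 0 < ε) (hε1 : ε < 1)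
    (hK : episodeConst C L lam * (ℓ ^ 4 * H ^ 4 * X ^ 2 * max 1 (ε * X) / ε ^ 2) ≤ K)
    (hβ : β ^ 2 = radiusConst C L lam ^ 2 * ℓ ^ 2 * (H * X))
    (hu0 : 0 ≤ u) (hu : u ≤ potentialConst C L lam * (H * X * ℓ)) (hn : n ≤ 2 * ℓ)
    (ht : t = feedbackConst C L lam * ε / (H * max 1 (ε * (X * ℓ)))) :
    16 * H * t * K + 2 * (128 * C * H ^ 3 / ε * n + ε * K / (32 * C)) +
      16 * H * (β ^ 2 / (4 * t) + 1) * u ≤ ε * K / (2 * C) := by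
  have hr := one_le_radiusConst hC hL hl
  have hp := potentialConst_pos hC hL hl
  have hτ := feedbackConst_pos hC hL hl
  obtain ⟨hτ1, -⟩ := feedbackConst_le hC hL hl
  have hc1 : episodeConst C L lam =
    32 * C * radiusConst C L lam ^ 2 * potentialConst C L lam / feedbackConst C L lam +
    128 * C * potentialConst C L lam + 8192 * C ^ 2 := rfl
  set b := radiusConst C L lam
  set a := potentialConst C L lam
  set τ := feedbackConst C L lam
  set g := max 1 (ε * X) with hg
  set w := max 1 (ε * (X * ℓ)) with hw
  have hg1 : 1 ≤ g := le_max_left _ _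
  have hw1 : 1 ≤ w := le_max_left _ _
  have hwg : w ≤ g * ℓ := by
    refine max_le (one_le_mul_of_one_le_of_one_le hg1 hℓ) ?_
    rw [← mul_assoc]
    exact mul_le_mul_of_nonneg_right (le_max_right _ _) (by linarith)
  set R := ℓ ^ 4 * H ^ 4 * X ^ 2 * g / ε ^ 2 with hR
  have hR0 : 0 < R := by positivity
  have hK0 : 0 ≤ K := le_trans (by rw [hc1]; positivity) hK
  -- the four contributions are at most one eighth of `ε K / C` each
  have hA : 16 * H * t * K ≤ ε * K / (8 * C) := by
    have e : 16 * H * t * K = 16 * τ * (ε * K) / w := by rw [ht]; field_simp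
    rw [e]
    calc _ ≤ 16 * τ * (ε * K) := div_le_self (by positivity) hw1
      _ ≤ 16 * (1 / (128 * C)) * (ε * K) := by gcongr
      _ = _ := by field_simp; ring
  have hB : 2 * (128 * C * H ^ 3 / ε * n) ≤ ε * K / (16 * C) := by
    have h1 : 8192 * C ^ 2 * R ≤ K := le_trans (by
      rw [hc1]; gcongr; exact le_add_of_nonneg_left (by positivity)) hK
    have h2 : H ^ 3 * ℓ / ε ^ 2 ≤ R := by
      refine div_le_div_of_nonneg_right ?_ (by positivity)
      calc H ^ 3 * ℓ = ℓ ^ 1 * H ^ 3 * 1 * 1 := by ring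
        _ ≤ ℓ ^ 4 * H ^ 4 * X ^ 2 * g := by
          gcongr
          · norm_num
          · norm_num
          · exact one_le_pow₀ hX
    calc _ ≤ 2 * (128 * C * H ^ 3 / ε * (2 * ℓ)) := by gcongr
      _ = ε / (16 * C) * (8192 * C ^ 2 * (H ^ 3 * ℓ / ε ^ 2)) := by field_simp; norm_num
      _ ≤ ε / (16 * C) * K := by
          gcongr
          exact le_trans (by gcongr) h1
      _ = _ := by ring
  have hCc : 16 * H * u ≤ ε * K / (8 * C) := by
    have h1 : 128 * C * a * R ≤ K := le_trans (by
      rw [hc1]; gcongr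
      have h3 : 0 ≤ 32 * C * b ^ 2 * a / τ := by positivity
      have h4 : 0 ≤ 8192 * C ^ 2 := by positivity
      linarith) hK
    have h2 : H ^ 2 * X * ℓ ≤ ε * R := by
      have e : ε * R = ℓ ^ 4 * H ^ 4 * X ^ 2 * g / ε := by rw [hR]; field_simp
      rw [e, le_div_iff₀ hε]
      calc H ^ 2 * X * ℓ * ε = ℓ ^ 1 * H ^ 2 * X ^ 1 * ε := by ring
        _ ≤ ℓ ^ 4 * H ^ 4 * X ^ 2 * g := by
          gcongr
          · norm_num
          · norm_num
          · norm_num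
          · linarith
    calc _ ≤ 16 * H * (a * (H * X * ℓ)) := by gcongr
      _ = 16 * a * (H ^ 2 * X * ℓ) := by ring
      _ ≤ 16 * a * (ε * R) := by gcongr
      _ = ε / (8 * C) * (128 * C * a * R) := by field_simp; norm_num
      _ ≤ ε / (8 * C) * K := by gcongr
      _ = _ := by ring
  have hD : 16 * H * (β ^ 2 / (4 * t)) * u ≤ ε * K / (8 * C) := by
    have h1 : 32 * C * b ^ 2 * a / τ * R ≤ K := le_trans (by
      rw [hc1, add_assoc]; gcongr; exact le_add_of_nonneg_right (by positivity)) hK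
    have e : 16 * H * (β ^ 2 / (4 * t)) = 4 * b ^ 2 * ℓ ^ 2 * H ^ 3 * X * w / (τ * ε) := by
      rw [hβ, ht]; field_simp; ring
    rw [e]
    calc _ ≤ 4 * b ^ 2 * ℓ ^ 2 * H ^ 3 * X * (g * ℓ) / (τ * ε) * (a * (H * X * ℓ)) := by gcongr
      _ = ε / (8 * C) * (32 * C * b ^ 2 * a / τ * R) := by rw [hR]; field_simp; ring
      _ ≤ ε / (8 * C) * K := by gcongr
      _ = _ := by ring
  have e1 : 2 * (ε * K / (32 * C)) = ε * K / (16 * C) := by field_simp; ring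
  have e2 : ε * K / (2 * C) = ε * K / (8 * C) + (ε * K / (16 * C) + ε * K / (16 * C)) +
    (ε * K / (8 * C) + ε * K / (8 * C)) := by field_simp; ring
  rw [e2]
  linarith

end Const

section

variable {S : Type u} {A : Type v} {H : ℕ} {F : ℕ → Set (S × A → ℝ)}
  {Dbar : ℕ → List ((S × A) × ℝ) → S × A → ℝ} {erm : ℕ → List ((S × A) × ℝ × ℝ) → S × A → ℝ}
  {greedy : (A → ℝ) → A} {C L lam ε δ : ℝ} {K : ℕ}

/-! ### The number of episodes -/

/-- Two corners that differ make the uncertainty positive, and an oracle overestimates it. -/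
theorem one_le_of_isBonusOracle [Nonempty S] [Nonempty A] (hH : 0 < H) (hb : BoundedClass H F L)
    (hl : 0 < lam) (hO : IsBonusOracle H F lam C Dbar) (hc : ∀ h < H, ∀ B, corner B ∈ F h) :
    1 ≤ C := by
  let z : S × A := Classical.arbitrary _
  have h1 := sq_sub_le_uncertaintySq_mul (hb 0 hH) hl [] (hc 0 hH Set.univ) (hc 0 hH ∅) z
  have h2 : (corner Set.univ z - corner ∅ z) ^ 2 = 9 := by simp [corner]; norm_num
  have h3 : sqSum ([] : List ((S × A) × ℝ)) (fun z => corner Set.univ z - corner ∅ z) = 0 := rfl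
  rw [h2, h3, zero_add] at h1
  have hu : 0 < uncertaintySq (F 0) lam [] z := pos_of_mul_pos_left (by linarith) hl.le
  obtain ⟨h4, h5⟩ := hO 0 hH [] (by simp) z
  have h6 : 0 < √(uncertaintySq (F 0) lam [] z) := Real.sqrt_pos.2 hu
  nlinarith

theorem four_le_of_boundedClass [Nonempty S] [Nonempty A] (hH : 0 < H) (hb : BoundedClass H F L)
    (hc : ∀ h < H, ∀ B, corner B ∈ F h) : 4 ≤ L := by
  have h1 := (hb 0 hH _ (hc 0 hH Set.univ) (Classical.arbitrary (S × A))).2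
  have h2 : corner Set.univ (Classical.arbitrary (S × A)) = 4 := by simp [corner]; norm_num
  linarith

theorem logFactor_mono (hε : 0 < ε) (hδ : 0 < δ) {K K' : ℕ} (h : K ≤ K') :
    logFactor H K ε δ ≤ logFactor H K' ε δ := by
  have := Real.exp_pos 1
  refine Real.log_le_log (by positivity) ?_
  gcongr

theorem eluderDimF_mono [Nonempty S] [Nonempty A] (hl : 0 < lam) (α : ℝ) {K K' : ℕ} (hKK : K ≤ K') :
    eluderDimF H F lam α K ≤ eluderDimF H F lam α K' := by
  unfold eluderDimF
  gcongr
  exact eluderDim_mono hl hKK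

section

variable [Fintype S] [Fintype A]

/-- The complexity is at least of the order of the number of state-action pairs. -/
theorem card_mul_log_two_le_complexity (hH : 0 < H) (hF : ∀ h < H, HasFiniteCovers (F h))
    (hc : ∀ h < H, ∀ B, corner B ∈ F h) (hε : 0 < ε) (hε1 : ε < 1) (K : ℕ) :
    Fintype.card (S × A) * Real.log 2 ≤ complexity H F lam ε K :=
  (card_mul_log_two_le hH hF hc hε (by linarith)).trans (le_max_left _ _)

/-- The complexity grows at most logarithmically with the number of episodes. -/
theorem complexity_le (hH : 0 < H) (hb : BoundedClass H F L) (hl : 0 < lam) (hL : 1 ≤ L)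
    (hε : 0 < ε) (hε1 : ε < 1) (hδ : 0 < δ) (hδ1 : δ < 1) (K : ℕ) :
    complexity H F lam ε K ≤
      (Real.log (coverF H F ε) + 2 * L ^ 2 * (Fintype.card (S × A) * (1 + 1 / lam))) *
        logFactor H K ε δ := by
  have hH' : (0 : ℝ) < H := Nat.cast_pos.2 hH
  have hℓ := one_le_logFactor (H := H) (K := K) hε hδ
  have h0 : 0 ≤ Real.log (coverF H F ε) := Real.log_natCast_nonneg _
  have h1 : 0 ≤ 2 * L ^ 2 * (Fintype.card (S × A) * (1 + 1 / lam)) := by positivity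
  rw [add_mul]
  refine max_le ?_ ?_
  · have := le_mul_of_one_le_right h0 hℓ
    have : 0 ≤ 2 * L ^ 2 * (Fintype.card (S × A) * (1 + 1 / lam)) * logFactor H K ε δ := by
      positivity
    linarith
  · refine le_add_of_nonneg_of_le (by positivity) ?_
    unfold eluderDimF
    rw [div_le_iff₀ hH']
    refine (Finset.sum_le_card_nsmul _ _ (2 * L ^ 2 * (Fintype.card (S × A) * (1 + 1 / lam)) *
      logFactor H K ε δ) fun h hh => ?_).trans (le_of_eq ?_)
    · refine (eluderDim_le (hb h (Finset.mem_range.1 hh)) hl hL (by positivity) K).trans ?_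
      have e : (1 / √(H : ℝ)) ^ 2 = 1 / H := by rw [div_pow, one_pow, Real.sq_sqrt hH'.le]
      rw [e, div_div_eq_mul_div, div_one]
      have h2 := log_one_add_div_le (H := H) (K := K) hε hε1 hδ hδ1 hl
      calc _ ≤ 2 * L ^ 2 * (Fintype.card (S × A) * ((1 + 1 / lam) * logFactor H K ε δ)) := by
            gcongr
        _ = _ := by ring
    · rw [Finset.card_range, nsmul_eq_mul, mul_comm]

/-- Powers of the logarithm are dominated by the identity. -/
theorem exists_mul_logFactor_pow_le (hε : 0 < ε) (hδ : 0 < δ) {κ : ℝ}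
    (hκ : 0 < κ) (n : ℕ) : ∃ K : ℕ, 1 ≤ K ∧ κ * logFactor H K ε δ ^ n ≤ K := by
  have he := Real.exp_pos 1
  have hm : 0 < Real.exp 1 + H / (ε * δ) := by positivity
  obtain ⟨x₀, hx₀⟩ := Filter.eventually_atTop.1 ((Real.isLittleO_pow_log_id_atTop (n := n)).def
    (show 0 < 1 / (κ * (Real.exp 1 + H / (ε * δ))) by positivity))
  rcases Nat.eq_zero_or_pos H with rfl | hH
  · obtain ⟨K, hK⟩ := exists_nat_ge (κ * logFactor 0 0 ε δ ^ n)
    refine ⟨K + 1, by omega, ?_⟩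
    have e : logFactor 0 (K + 1) ε δ = logFactor 0 0 ε δ := by simp [logFactor]
    rw [e]
    push_cast
    linarith
  have hH' : (0 : ℝ) < H := Nat.cast_pos.2 hH
  obtain ⟨K, hK⟩ := exists_nat_ge (max 1 (x₀ / (H / (ε * δ))))
  have hK1 : (1 : ℝ) ≤ K := (le_max_left _ _).trans hK
  refine ⟨K, by exact_mod_cast hK1, ?_⟩
  have hy : x₀ ≤ Real.exp 1 + K * H / (ε * δ) := by
    have h1 := (le_max_right _ _).trans hK
    rw [div_le_iff₀ (by positivity)] at h1
    rw [mul_div_assoc]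
    linarith
  have h2 := hx₀ _ hy
  have hy0 : 0 < Real.exp 1 + K * H / (ε * δ) := by positivity
  rw [Real.norm_eq_abs, id, Real.norm_eq_abs, abs_of_pos hy0] at h2
  have h3 : Real.exp 1 + K * H / (ε * δ) ≤ (Real.exp 1 + H / (ε * δ)) * K := by
    have : Real.exp 1 ≤ Real.exp 1 * K := le_mul_of_one_le_right he.le hK1
    calc _ ≤ Real.exp 1 * K + K * H / (ε * δ) := by linarith
      _ = _ := by ring
  calc κ * logFactor H K ε δ ^ n ≤ κ * (1 / (κ * (Real.exp 1 + H / (ε * δ))) *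
        ((Real.exp 1 + H / (ε * δ)) * K)) := by
        gcongr
        exact (le_abs_self _).trans (h2.trans (by gcongr))
    _ = K := by field_simp

variable [Nonempty S] [Nonempty A]

/-- The smallest number of episodes above the bound is less than one above it, since the bound
increases with the number of episodes. -/
theorem exists_episode_number (hH : 0 < H) (hF : ∀ h < H, HasFiniteCovers (F h))
    (hc : ∀ h < H, ∀ B, corner B ∈ F h) (hb : BoundedClass H F L) (hl : 0 < lam) (hL : 1 ≤ L)
    (hε : 0 < ε) (hε1 : ε < 1) (hδ : 0 < δ) (hδ1 : δ < 1) {c : ℝ} (hc4 : 4 ≤ c) (p : ℕ) :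
    ∃ K : ℕ, 1 ≤ K ∧ sampleBound c p H F lam ε δ K ≤ K ∧
      K ≤ 2 * sampleBound c p H F lam ε δ K := by
  have hH1 : (1 : ℝ) ≤ H := Nat.one_le_cast.2 hH
  have hX : (1 : ℝ) ≤ Fintype.card (S × A) := Nat.one_le_cast.2 Fintype.card_pos
  have hlog2 := Real.log_two_gt_d9
  have hd : ∀ K, Real.log 2 ≤ complexity H F lam ε K := fun K =>
    (le_mul_of_one_le_left (by linarith) hX).trans
      (card_mul_log_two_le_complexity hH hF hc hε hε1 K)
  have hℓ : ∀ K, 1 ≤ logFactor H K ε δ := fun K => one_le_logFactor hε hδ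
  have hT1 : ∀ K, 1 ≤ sampleBound c p H F lam ε δ K := by
    intro K
    have h1 : 1 / 4 ≤ complexity H F lam ε K ^ 2 := by nlinarith [hd K]
    have h2 : 1 / 4 ≤ H ^ 4 * complexity H F lam ε K ^ 2 / ε ^ 2 := by
      rw [le_div_iff₀ (by positivity)]
      calc 1 / 4 * ε ^ 2 ≤ 1 * (1 / 4) := by nlinarith
        _ ≤ _ := mul_le_mul (one_le_pow₀ hH1) h1 (by norm_num) (by positivity)
    have h3 : 4 ≤ c * logFactor H K ε δ ^ p :=
      hc4.trans (le_mul_of_one_le_right (by linarith) (one_le_pow₀ (hℓ K)))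
    have h4 : 1 ≤ max 1 (ε * Real.log (coverF H F ε)) := le_max_left _ _
    unfold sampleBound
    calc (1 : ℝ) = 4 * (1 / 4) * 1 := by norm_num
      _ ≤ _ := by gcongr
  have hmono : ∀ K K' : ℕ, K ≤ K' →
      sampleBound c p H F lam ε δ K ≤ sampleBound c p H F lam ε δ K' := by
    intro K K' hKK
    have h1 := logFactor_mono (H := H) hε hδ hKK
    have h2 : complexity H F lam ε K ≤ complexity H F lam ε K' :=
      max_le_max le_rfl (eluderDimF_mono hl _ hKK)
    have h3 := hℓ K
    have h4 := hd K
    have h5 := hℓ K'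
    have hc0 : 0 < c := by linarith
    have h6 : 0 ≤ complexity H F lam ε K := by linarith
    unfold sampleBound
    gcongr
  have hex : ∃ K : ℕ, 1 ≤ K ∧ sampleBound c p H F lam ε δ K ≤ K := by
    set q := Real.log (coverF H F ε) + 2 * L ^ 2 * (Fintype.card (S × A) * (1 + 1 / lam)) with hq
    have hq0 : 0 < q := by
      have : 0 ≤ Real.log (coverF H F ε) := Real.log_natCast_nonneg _
      positivity
    obtain ⟨K, hK1, hK⟩ := exists_mul_logFactor_pow_le (H := H) (ε := ε) (δ := δ)
      (κ := c * (H ^ 4 * q ^ 2 / ε ^ 2) * max 1 (ε * Real.log (coverF H F ε))) hε hδ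
      (by positivity) (p + 2)
    refine ⟨K, hK1, le_trans ?_ hK⟩
    have h1 := complexity_le (F := F) hH hb hl hL hε hε1 hδ hδ1 K
    have h2 := hℓ K
    have h3 := hd K
    rw [← hq] at h1
    unfold sampleBound
    calc _ ≤ c * logFactor H K ε δ ^ p * (H ^ 4 * (q * logFactor H K ε δ) ^ 2 / ε ^ 2) *
          max 1 (ε * Real.log (coverF H F ε)) := by gcongr; linarith
      _ = _ := by ring
  classical
  obtain ⟨h1, h2⟩ := Nat.find_spec hex
  refine ⟨Nat.find hex, h1, h2, ?_⟩
  rcases h1.eq_or_lt with h3 | h3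
  · rw [← h3]
    have := hT1 1
    push_cast
    linarith
  · have h4 := Nat.find_min hex (m := Nat.find hex - 1) (by omega)
    rw [not_and, not_le] at h4
    have h5 := h4 (by omega)
    have h6 := hmono _ _ (Nat.sub_le (Nat.find hex) 1)
    have h7 := hT1 (Nat.find hex)
    rw [Nat.cast_sub h1, Nat.cast_one] at h5
    linarith

/-! ### The confidence radius -/

/-- What a number of episodes above the bound gives, in terms of the number of state-action
pairs. -/
theorem episodeConst_mul_le (hH : 0 < H) (hF : ∀ h < H, HasFiniteCovers (F h))
    (hc : ∀ h < H, ∀ B, corner B ∈ F h) (hC : 1 ≤ C) (hL : 1 ≤ L) (hl : 0 < lam)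
    (hε : 0 < ε) (hε1 : ε < 1) (hδ : 0 < δ)
    (hK : sampleBound (mainConst C L lam) 4 H F lam ε δ K ≤ K) :
    episodeConst C L lam * (logFactor H K ε δ ^ 4 * H ^ 4 * Fintype.card (S × A) ^ 2 *
      max 1 (ε * Fintype.card (S × A)) / ε ^ 2) ≤ K := by
  have hℓ := one_le_logFactor (H := H) (K := K) hε hδ
  have hX : (1 : ℝ) ≤ Fintype.card (S × A) := Nat.one_le_cast.2 Fintype.card_pos
  have hlog2 := Real.log_two_gt_d9
  have hlog2' := Real.log_two_lt_d9
  have h1 := card_mul_log_two_le_complexity (lam := lam) hH hF hc hε hε1 K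
  have h2 := card_mul_log_two_le hH hF hc hε (by linarith : ε < 3 / 2)
  have hr := one_le_radiusConst hC hL hl
  have hp := potentialConst_pos hC hL hl
  have hτ := feedbackConst_pos hC hL hl
  have he : 0 < episodeConst C L lam := by unfold episodeConst; positivity
  have h3 : episodeConst C L lam ≤ mainConst C L lam * (1 / 4) := by
    unfold mainConst
    linarith
  have h4 : 1 / 4 ≤ Real.log 2 ^ 2 * Real.log 2 := by nlinarith
  set X : ℝ := ((Fintype.card (S × A) : ℕ) : ℝ)
  have h5 : Real.log 2 * max 1 (ε * X) ≤ max 1 (ε * Real.log (coverF H F ε)) := by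
    rw [mul_max_of_nonneg _ _ (by linarith)]
    refine max_le_max (by linarith) ?_
    calc _ = ε * (X * Real.log 2) := by ring
      _ ≤ _ := by gcongr
  refine le_trans ?_ hK
  unfold sampleBound
  have hc0 : 0 < mainConst C L lam := by unfold mainConst; positivity
  calc _ ≤ mainConst C L lam * (Real.log 2 ^ 2 * Real.log 2) * (logFactor H K ε δ ^ 4 * H ^ 4 *
        X ^ 2 * max 1 (ε * X) / ε ^ 2) := by
        gcongr
        exact h3.trans (by gcongr)
    _ = mainConst C L lam * logFactor H K ε δ ^ 4 * (H ^ 4 * (X * Real.log 2) ^ 2 / ε ^ 2) *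
        (Real.log 2 * max 1 (ε * X)) := by ring
    _ ≤ _ := by gcongr

/-- This bounds `log |S × A|` by the logarithmic factor. -/
theorem card_le_of_episodeConst_mul_le (hH : 0 < H) (hC : 1 ≤ C) (hL : 1 ≤ L) (hl : 0 < lam)
    (hε : 0 < ε) (hε1 : ε < 1) (hδ : 0 < δ)
    (hK : episodeConst C L lam * (logFactor H K ε δ ^ 4 * H ^ 4 * Fintype.card (S × A) ^ 2 *
      max 1 (ε * Fintype.card (S × A)) / ε ^ 2) ≤ K) : Fintype.card (S × A) ≤ K := by
  have hℓ := one_le_logFactor (H := H) (K := K) hε hδ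
  have hH1 : (1 : ℝ) ≤ H := Nat.one_le_cast.2 hH
  have hX : (1 : ℝ) ≤ Fintype.card (S × A) := Nat.one_le_cast.2 Fintype.card_pos
  have hr := one_le_radiusConst hC hL hl
  have hp := potentialConst_pos hC hL hl
  have hτ := feedbackConst_pos hC hL hl
  have he : 1 ≤ episodeConst C L lam := by
    unfold episodeConst
    have : 1 ≤ C ^ 2 := one_le_pow₀ hC
    have : 0 ≤ 32 * C * radiusConst C L lam ^ 2 * potentialConst C L lam / feedbackConst C L lam +
      128 * C * potentialConst C L lam := by positivity
    linarith
  rw [← Nat.cast_le (α := ℝ)]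
  refine le_trans ?_ hK
  have h1 : (1 : ℝ) ≤ max 1 (ε * Fintype.card (S × A)) := le_max_left _ _
  calc (Fintype.card (S × A) : ℝ) = 1 * (1 ^ 4 * 1 ^ 4 * Fintype.card (S × A) ^ 1 * 1 / 1) := by
        ring
    _ ≤ _ := by
        gcongr
        · norm_num
        · exact pow_le_one₀ hε.le hε1.le

/-- The value of the confidence radius in both phases. -/
def radius (C L lam : ℝ) (H K X : ℕ) (ε δ : ℝ) : ℝ :=
  radiusConst C L lam * logFactor H K ε δ * √(H * X)

/-- The covering number `N_V` depends on the confidence radius, but only polynomially, because the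
bonus class consists of bounded functions on a finite set. This is why a radius that is consistent
with its own covering number exists. -/
theorem log_coverV_le (hH : 0 < H) (hK : 0 < K) (hb : BoundedClass H F L) (hC : 1 ≤ C)
    (hL : 1 ≤ L) (hl : 0 < lam) (hε : 0 < ε) (hε1 : ε < 1) (hδ : 0 < δ) (hδ1 : δ < 1)
    (hO : IsBonusOracle H F lam C Dbar) (hX : Fintype.card (S × A) ≤ K) :
    Real.log (coverV H F Dbar (2 * radius C L lam H K (Fintype.card (S × A)) ε δ) ε) ≤
      coverConst C L lam * (Fintype.card (S × A) * logFactor H K ε δ) := by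
  have hℓ := one_le_logFactor (H := H) (K := K) hε hδ
  have hlH := log_natCast_le_right hH hK hε hε1 hδ hδ1
  have hlK := log_natCast_le_left hH hK hε hε1 hδ hδ1
  have hlε := log_one_div_eps_le hH hK hε hδ hδ1
  have hX1 : (1 : ℝ) ≤ Fintype.card (S × A) := Nat.one_le_cast.2 Fintype.card_pos
  have hH1 : (1 : ℝ) ≤ H := Nat.one_le_cast.2 hH
  have hlX : Real.log (Fintype.card (S × A)) ≤ logFactor H K ε δ :=
    (Real.log_le_log (by linarith) (Nat.cast_le.2 hX)).trans hlK
  have hr := one_le_radiusConst hC hL hl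
  have hm := bonusBound_nonneg (lam := lam) hC hL
  have hβ1 : 1 ≤ radius C L lam H K (Fintype.card (S × A)) ε δ := by
    unfold radius
    have : 1 ≤ √((H : ℝ) * Fintype.card (S × A)) :=
      Real.one_le_sqrt.2 (one_le_mul_of_one_le_of_one_le hH1 hX1)
    exact one_le_mul_of_one_le_of_one_le (one_le_mul_of_one_le_of_one_le hr hℓ) this
  have hlβ : Real.log (radius C L lam H K (Fintype.card (S × A)) ε δ) ≤
      radiusConst C L lam - 1 + 2 * logFactor H K ε δ - 1 := by
    unfold radius
    rw [Real.log_mul (by positivity) (by positivity), Real.log_mul (by positivity) (by positivity),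
      Real.log_sqrt (by positivity), Real.log_mul (by positivity) (by positivity)]
    have h1 := Real.log_le_sub_one_of_pos (show 0 < radiusConst C L lam by linarith)
    have h2 := Real.log_le_sub_one_of_pos (show 0 < logFactor H K ε δ by linarith)
    linarith
  set β := radius C L lam H K (Fintype.card (S × A)) ε δ
  set X := Fintype.card (S × A)
  set ℓ := logFactor H K ε δ
  have h1 : Real.log (coverF H F (ε / 2)) ≤ X * (2 * L + ℓ) := by
    refine (log_coverF_le (by linarith) hb (by positivity)).trans ?_
    rw [div_div_eq_mul_div, mul_comm L 2]
    gcongr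
    exact log_div_add_one_le (by positivity) hε hε1 hlε
  have hB : ∀ f ∈ bonusClass H Dbar, ∀ z, 0 ≤ f z ∧ f z ≤ bonusBound C L lam := by
    rintro _ ⟨h, hh, D, hD, rfl⟩ z
    obtain ⟨h3, h4⟩ := hO h hh D hD z
    refine ⟨(Real.sqrt_nonneg _).trans h3, h4.trans ?_⟩
    unfold bonusBound
    gcongr
    refine (Real.sqrt_le_sqrt (uncertaintySq_le_div (hb h hh) hl hL D z)).trans (le_of_eq ?_)
    rw [Real.sqrt_div (sq_nonneg L), Real.sqrt_sq (by linarith)]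
  have h2 : Real.log (coveringNumber (bonusClass H Dbar) (ε / (2 * (2 * β)))) ≤
      X * (4 * bonusBound C L lam + ℓ + (radiusConst C L lam - 1 + 2 * ℓ - 1)) := by
    refine (log_natCast_le_of_le_floor (by positivity) (coveringNumber_le (by positivity)
      hB)).trans ?_
    gcongr
    have h3 : bonusBound C L lam / (ε / (2 * (2 * β))) + 1 ≤
        (4 * bonusBound C L lam / ε + 1) * β := by
      have : bonusBound C L lam / (ε / (2 * (2 * β))) = 4 * bonusBound C L lam / ε * β := by
        field_simp; ring
      rw [this]
      linarith
    calc _ ≤ Real.log ((4 * bonusBound C L lam / ε + 1) * β) :=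
          Real.log_le_log (by positivity) h3
      _ = Real.log (4 * bonusBound C L lam / ε + 1) + Real.log β :=
          Real.log_mul (by positivity) (by positivity)
      _ ≤ _ := by
          have := log_div_add_one_le (y := 4 * bonusBound C L lam) (by positivity) hε hε1 hlε
          linarith
  have h3 : Real.log (coverV H F Dbar (2 * β) ε) ≤ Real.log (coverF H F (ε / 2)) +
      Real.log (coveringNumber (bonusClass H Dbar) (ε / (2 * (2 * β)))) := by
    unfold coverV
    rw [Nat.cast_mul]
    rcases eq_or_ne (coverF H F (ε / 2) : ℝ) 0 with h | h
    · rw [h, zero_mul, Real.log_zero, zero_add]; exact Real.log_natCast_nonneg _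
    rcases eq_or_ne (coveringNumber (bonusClass H Dbar) (ε / (2 * (2 * β))) : ℝ) 0 with h' | h'
    · rw [h', mul_zero, Real.log_zero, add_zero]; exact Real.log_natCast_nonneg _
    exact (Real.log_mul h h').le
  have h4 : (2 * L + ℓ) + (4 * bonusBound C L lam + ℓ + (radiusConst C L lam - 1 + 2 * ℓ - 1)) ≤
      coverConst C L lam * ℓ := by
    have h5 : 2 * L ≤ 2 * L * ℓ := le_mul_of_one_le_right (by linarith) hℓ
    have h6 : 4 * bonusBound C L lam ≤ 4 * bonusBound C L lam * ℓ :=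
      le_mul_of_one_le_right (by linarith) hℓ
    have h7 : radiusConst C L lam ≤ radiusConst C L lam * ℓ :=
      le_mul_of_one_le_right (by linarith) hℓ
    unfold coverConst
    linarith
  calc _ ≤ X * (2 * L + ℓ) +
        X * (4 * bonusBound C L lam + ℓ + (radiusConst C L lam - 1 + 2 * ℓ - 1)) := by linarith
    _ = X * ((2 * L + ℓ) +
        (4 * bonusBound C L lam + ℓ + (radiusConst C L lam - 1 + 2 * ℓ - 1))) := by ring
    _ ≤ X * (coverConst C L lam * ℓ) := by gcongr
    _ = _ := by ring

theorem radius_sq (C L lam : ℝ) (H K X : ℕ) (ε δ : ℝ) : radius C L lam H K X ε δ ^ 2 =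
    radiusConst C L lam ^ 2 * logFactor H K ε δ ^ 2 * (H * X) := by
  rw [radius, mul_pow, mul_pow, Real.sq_sqrt (by positivity)]

theorem radius_nonneg (hC : 1 ≤ C) (hL : 1 ≤ L) (hl : 0 < lam) (hε : 0 < ε) (hδ : 0 < δ)
    (X : ℕ) : 0 ≤ radius C L lam H K X ε δ := by
  have := one_le_radiusConst hC hL hl
  have := one_le_logFactor (H := H) (K := K) hε hδ
  unfold radius
  positivity

/-- The radius dominates `√(H y)` for every `y` of the order of `log N_V(ε)`. -/
theorem sqrt_mul_le_radius (hC : 1 ≤ C) (hL : 1 ≤ L) (hl : 0 < lam) (hε : 0 < ε) (hδ : 0 < δ)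
    {X : ℕ} {y : ℝ} (hy : y ≤ coverConst C L lam * (X * logFactor H K ε δ)) :
    √(H * y) ≤ radius C L lam H K X ε δ := by
  have hℓ := one_le_logFactor (H := H) (K := K) hε hδ
  have h1 := (le_radiusConst_sq hC hL hl).2
  refine Real.sqrt_le_iff.2 ⟨radius_nonneg hC hL hl hε hδ X, ?_⟩
  rw [radius_sq]
  calc (H : ℝ) * y ≤ H * (coverConst C L lam * (X * logFactor H K ε δ)) := by gcongr
    _ ≤ H * (radiusConst C L lam ^ 2 * (X * logFactor H K ε δ ^ 2)) := by
        gcongr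
        exact le_self_pow₀ hℓ two_ne_zero
    _ = _ := by ring

theorem radius_le (hC : 1 ≤ C) (hL : 1 ≤ L) (hl : 0 < lam) (hε : 0 < ε) (hδ : 0 < δ)
    {X : ℕ} {y : ℝ} (hy : X * Real.log 2 ≤ y) :
    radius C L lam H K X ε δ ≤ mainConst C L lam * logFactor H K ε δ ^ 4 * √(H * y) := by
  have hℓ := one_le_logFactor (H := H) (K := K) hε hδ
  have hr := one_le_radiusConst hC hL hl
  have hp := potentialConst_pos hC hL hl
  have hτ := feedbackConst_pos hC hL hl
  have he : 0 < episodeConst C L lam := by unfold episodeConst; positivity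
  have h1 : √((H : ℝ) * X) ≤ 2 * √(H * y) := by
    refine Real.sqrt_le_iff.2 ⟨by positivity, ?_⟩
    have hlog2 := Real.log_two_gt_d9
    have hX0 : (0 : ℝ) ≤ X := Nat.cast_nonneg _
    have hy0 : 0 ≤ y := le_trans (by positivity) hy
    rw [mul_pow, Real.sq_sqrt (by positivity)]
    calc (H : ℝ) * X ≤ H * (4 * y) := by gcongr; nlinarith
      _ = _ := by ring
  have h2 : 2 * radiusConst C L lam ≤ mainConst C L lam := by unfold mainConst; linarith
  unfold radius
  calc _ ≤ radiusConst C L lam * logFactor H K ε δ ^ 4 * (2 * √(H * y)) := by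
        gcongr
        exact le_self_pow₀ hℓ (by norm_num)
    _ = 2 * radiusConst C L lam * logFactor H K ε δ ^ 4 * √(H * y) := by ring
    _ ≤ _ := by gcongr

/-! ### Success with the chosen radius -/

/-- The radius of order `√(H |S × A|)` makes planning succeed, once the number of episodes exceeds
the bound in terms of `|S × A|`. -/
theorem success_probability (hH : 0 < H) (hε : 0 < ε) (hε1 : ε < 1) (hδ : 0 < δ) (hδ1 : δ < 1)
    (hC : 1 ≤ C) (hL : 1 ≤ L) (hl : 0 < lam) (hb : BoundedClass H F L)
    (hO : IsBonusOracle H F lam C Dbar) (hR : IsRegression H F erm) (hG : IsArgmax greedy)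
    {β : ℝ} (hβ : β = radius C L lam H K (Fintype.card (S × A)) ε δ) (hK : 0 < K)
    (hKR : episodeConst C L lam * (logFactor H K ε δ ^ 4 * H ^ 4 * Fintype.card (S × A) ^ 2 *
      max 1 (ε * Fintype.card (S × A)) / ε ^ 2) ≤ K)
    (P : ℕ → S × A → PMF S) (μ : PMF S) (hP : Complete H F P) :
    ENNReal.ofReal (1 - δ) ≤
      (exploration (gfaRfe H F Dbar erm greedy ε β β) P μ K).toOuterMeasure
        {D | PlansWell (gfaRfe H F Dbar erm greedy ε β β) P μ ε D} := by
  have hH1 : (1 : ℝ) ≤ H := Nat.one_le_cast.2 hH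
  have hX1 : (1 : ℝ) ≤ Fintype.card (S × A) := Nat.one_le_cast.2 Fintype.card_pos
  have hℓ := one_le_logFactor (H := H) (K := K) hε hδ
  have hm := bonusBound_nonneg (lam := lam) hC hL
  have hτ := feedbackConst_pos hC hL hl
  have hNV := log_coverV_le hH hK hb hC hL hl hε hε1 hδ hδ1 hO
    (card_le_of_episodeConst_mul_le hH hC hL hl hε hε1 hδ hKR)
  rw [← hβ] at hNV
  obtain ⟨hcc, hΛ⟩ := log_confCount_le (S := S) (A := A) (K := K) hH hK hε hε1 hδ hδ1 hL
  have hβ2 : β ^ 2 = radiusConst C L lam ^ 2 * logFactor H K ε δ ^ 2 *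
      (H * Fintype.card (S × A)) := by rw [hβ, radius_sq]
  have hβ0 : 0 ≤ β := hβ ▸ radius_nonneg hC hL hl hε hδ _
  set I := gfaRfe H F Dbar erm greedy ε β β with hI
  set X : ℝ := ((Fintype.card (S × A) : ℕ) : ℝ)
  set ℓ := logFactor H K ε δ
  set Λ := Real.log (2 / δ * confCount S A H K L) with hΛdef
  have hrad : 16 * H * Λ + 5 + lam ≤ β ^ 2 := by
    have h1 := (le_radiusConst_sq hC hL hl).1
    have h2 : 1 ≤ ℓ ^ 2 * (H * X) :=
      one_le_mul_of_one_le_of_one_le (one_le_pow₀ hℓ) (one_le_mul_of_one_le_of_one_le hH1 hX1)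
    rw [hβ2]
    calc 16 * H * Λ + 5 + lam ≤ 16 * H * ((2 * L + 8) * (X * ℓ)) + (5 + lam) * 1 := by
          rw [add_assoc, mul_one]; gcongr
      _ ≤ 16 * H * ((2 * L + 8) * (X * ℓ ^ 2)) + (5 + lam) * (ℓ ^ 2 * (H * X)) := by
          gcongr
          exact le_self_pow₀ hℓ two_ne_zero
      _ = (16 * (2 * L + 8) + 5 + lam) * (ℓ ^ 2 * (H * X)) := by ring
      _ ≤ radiusConst C L lam ^ 2 * (ℓ ^ 2 * (H * X)) := by gcongr
      _ = _ := by ring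
  have hβ1 : 1 ≤ β := by
    have h1 := one_le_radiusConst hC hL hl
    refine (one_le_sq_iff₀ hβ0).1 ?_
    rw [hβ2]
    exact one_le_mul_of_one_le_of_one_le
      (one_le_mul_of_one_le_of_one_le (one_le_pow₀ h1) (one_le_pow₀ hℓ))
      (one_le_mul_of_one_le_of_one_le hH1 hX1)
  have M : Setting I F P C L lam Λ :=
    { H_pos := hH, lam_pos := hl, one_le_L := hL, one_le_C := hC, bounded := hb, oracle := hO
      regression := hR, argmax := hG, complete := hP, α_eq := rfl, betaP_eq := rfl, γ_eq := rfl
      logNV_nonneg := Real.log_natCast_nonneg _, one_le_betaE := hβ1, radius := hrad }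
  have hn : Real.log (2 / δ) ≤ 2 * ℓ := by
    have h1 := log_one_div_delta_le hH hK hε hε1 hδ
    rw [show (2 / δ : ℝ) = 2 * (1 / δ) by ring, Real.log_mul (by positivity) (by positivity)]
    linarith [Real.log_two_lt_d9]
  have hn0 : 0 ≤ Real.log (2 / δ) := Real.log_nonneg (by rw [le_div_iff₀ hδ]; linarith)
  -- this `θ` makes the variance term `4 θ H³ K` of the noise equal to `ε K / (32 C)`
  have hθ : 0 < ε / (128 * C * H ^ 3) := by positivity
  set w := max 1 (ε * (X * ℓ)) with hw
  have hw1 : 1 ≤ w := le_max_left _ _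
  have ht : 0 < feedbackConst C L lam * ε / (H * w) := by positivity
  refine ofReal_one_sub_le_exploration (N := 128 * C * H ^ 3 / ε * Real.log (2 / δ) +
    ε * K / (32 * C)) M hK hδ hθ ?_ (le_of_eq ?_) fun l hl' hg hN => ?_
  · rw [hΛdef, Real.exp_neg, Real.exp_log (by positivity)]
    change confCount S A H K L * _ ≤ _
    field_simp
    exact le_rfl
  · change Real.log (2 / δ) / (ε / (128 * C * H ^ 3)) + 4 * (ε / (128 * C * H ^ 3)) * H ^ 3 * K = _
    field_simp
    ring
  · refine (total_value_le_of_small M hK hl' hg ht ?_ (by positivity) hN).trans ?_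
    · change feedbackConst C L lam * ε / (H * w) *
        Real.log (coverV H F Dbar (2 * β) ε) * (H * (bonusBound C L lam + 41)) ≤ 1 / 2
      have h1 := (feedbackConst_le hC hL hl).2
      have h2 := one_le_coverConst hC hL hl
      calc _ ≤ feedbackConst C L lam * ε / (H * w) * (coverConst C L lam * (X * ℓ)) *
            (H * (bonusBound C L lam + 41)) := by gcongr
        _ = feedbackConst C L lam * coverConst C L lam * (bonusBound C L lam + 41) *
            (ε * (X * ℓ) / w) := by field_simp
        _ ≤ 1 / 2 * 1 := by
            gcongr
            exact (div_le_one (by positivity)).2 (le_max_right _ _)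
        _ = 1 / 2 := mul_one _
    · refine parameter_choice hC hL hl hH1 hX1 hℓ hε hε1 hKR hβ2 ?_ ?_ hn rfl
      · have : 0 ≤ Real.log (1 + K * I.H / lam) :=
          Real.log_nonneg (le_add_of_nonneg_right (by positivity))
        positivity
      · have h1 := log_one_add_div_le (H := H) (K := K) hε hε1 hδ hδ1 hl
        change 2 * C ^ 2 * L ^ 2 * (H * (X * Real.log (1 + K * H / lam))) ≤ _
        unfold potentialConst
        change _ ≤ 2 * C ^ 2 * L ^ 2 * (1 + 1 / lam) * (H * X * ℓ)
        calc _ ≤ 2 * C ^ 2 * L ^ 2 * (H * (X * ((1 + 1 / lam) * ℓ))) := by gcongr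
          _ = _ := by ring

end

end

end

end GFARFE

theorem mainTheorem3 :
    ∃ p : ℕ, ∀ C L lam : ℝ, 0 < lam → ∃ c : ℝ, 0 < c ∧
      ∀ (S : Type u) (A : Type v) [Nonempty S] [Nonempty A] (H : ℕ)
        (F : ℕ → Set (S × A → ℝ))
        (Dbar : ℕ → List ((S × A) × ℝ) → S × A → ℝ)
        (erm : ℕ → List ((S × A) × ℝ × ℝ) → S × A → ℝ)
        (greedy : (A → ℝ) → A) (ε δ : ℝ),
        0 < H → 0 < ε → ε < 1 → 0 < δ → δ < 1 →
        GFARFE.BoundedClass H F L →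
        (∀ h < H, GFARFE.HasFiniteCovers (F h)) →
        GFARFE.IsBonusOracle H F lam C Dbar →
        GFARFE.HasFiniteCovers (GFARFE.bonusClass H Dbar) →
        GFARFE.IsRegression H F erm →
        GFARFE.IsArgmax greedy →
        (∃ P : ℕ → S × A → PMF S, GFARFE.Complete H F P) →
        (∃ K : ℕ, 1 ≤ K ∧ GFARFE.sampleBound c p H F lam ε δ K ≤ K ∧
          K ≤ 2 * GFARFE.sampleBound c p H F lam ε δ K) ∧
        ∀ K : ℕ, 1 ≤ K → GFARFE.sampleBound c p H F lam ε δ K ≤ K →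
          ∃ βE βP : ℝ,
            √(H * Real.log (GFARFE.coverV H F Dbar (2 * βE) ε)) ≤ βE ∧
            βE ≤ c * GFARFE.logFactor H K ε δ ^ p *
              √(H * Real.log (GFARFE.coverV H F Dbar (2 * βE) ε)) ∧
            √(H * Real.log (GFARFE.coverF H F ε)) ≤ βP ∧
            βP ≤ c * GFARFE.logFactor H K ε δ ^ p * √(H * Real.log (GFARFE.coverF H F ε)) ∧
            ∀ (P : ℕ → S × A → PMF S) (μ : PMF S), GFARFE.Complete H F P →
              ENNReal.ofReal (1 - δ) ≤
                (GFARFE.exploration (GFARFE.gfaRfe H F Dbar erm greedy ε βE βP) P μ K).toOuterMeasure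
                  {D | GFARFE.PlansWell (GFARFE.gfaRfe H F Dbar erm greedy ε βE βP) P μ ε D} := by
  open GFARFE in
  -- `max` keeps the constant positive for all `C` and `L`; the hypotheses force `1 ≤ C` and `4 ≤ L`
  refine ⟨4, fun C L lam hl => ⟨mainConst (max C 1) (max L 1) lam, ?_, ?_⟩⟩
  · have h1 := one_le_radiusConst (le_max_right C 1) (le_max_right L 1) hl
    have h2 := potentialConst_pos (le_max_right C 1) (le_max_right L 1) hl
    have h3 := feedbackConst_pos (le_max_right C 1) (le_max_right L 1) hl
    have h4 : 1 ≤ max C 1 := le_max_right _ _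
    unfold mainConst episodeConst
    positivity
  intro S A _ _ H F Dbar erm greedy ε δ hH hε hε1 hδ hδ1 hb hF hO hB hR hG ⟨P₀, hP₀⟩
  have hc : ∀ h < H, ∀ B, corner B ∈ F h := fun h hh B => corner_mem hP₀ hh B
  have hfin : Finite (S × A) := finite_of_corner_mem (hF 0 hH) (hc 0 hH)
  have : Finite S := Finite.prod_left A
  have : Finite A := Finite.prod_right S
  have : Fintype S := Fintype.ofFinite S
  have : Fintype A := Fintype.ofFinite A
  have hL : 1 ≤ L := by linarith [four_le_of_boundedClass hH hb hc]
  have hC : 1 ≤ C := one_le_of_isBonusOracle hH hb hl hO hc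
  rw [max_eq_left hC, max_eq_left hL]
  have hc4 : 4 ≤ mainConst C L lam := by
    have h1 := one_le_radiusConst hC hL hl
    have h2 := potentialConst_pos hC hL hl
    have h3 := feedbackConst_pos hC hL hl
    have h4 : 0 ≤ episodeConst C L lam := by unfold episodeConst; positivity
    unfold mainConst
    linarith
  refine ⟨exists_episode_number hH hF hc hb hl hL hε hε1 hδ hδ1 hc4 4, fun K hK hT => ?_⟩
  have hKR := episodeConst_mul_le hH hF hc hC hL hl hε hε1 hδ hT
  have hXK := card_le_of_episodeConst_mul_le hH hC hL hl hε hε1 hδ hKR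
  have hNV := log_coverV_le hH hK hb hC hL hl hε hε1 hδ hδ1 hO hXK
  have hℓ := one_le_logFactor (H := H) (K := K) hε hδ
  have hlε := log_one_div_eps_le hH hK hε hδ hδ1
  have hNF : Real.log (coverF H F ε) ≤
      coverConst C L lam * (Fintype.card (S × A) * logFactor H K ε δ) := by
    have h1 := log_coverF_le (by linarith) hb hε
    have h2 := log_div_add_one_le (by linarith : 0 ≤ L) hε hε1 hlε
    have h3 := bonusBound_nonneg (lam := lam) hC hL
    have h4 := one_le_radiusConst hC hL hl
    have h5 : L + logFactor H K ε δ ≤ coverConst C L lam * logFactor H K ε δ := by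
      have h6 : L ≤ L * logFactor H K ε δ := le_mul_of_one_le_right (by linarith) hℓ
      have h7 : L + 1 ≤ coverConst C L lam := by unfold coverConst; linarith
      have h8 := mul_le_mul_of_nonneg_right h7 (by linarith : 0 ≤ logFactor H K ε δ)
      linarith
    calc _ ≤ _ := h1
      _ ≤ Fintype.card (S × A) * (coverConst C L lam * logFactor H K ε δ) := by
          gcongr
          linarith
      _ = _ := by ring
  have hlowF := card_mul_log_two_le hH hF hc hε (by linarith : ε < 3 / 2)
  have hβ1 := radius_nonneg (H := H) (K := K) hC hL hl hε hδ (Fintype.card (S × A))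
  have hlowV : Fintype.card (S × A) * Real.log 2 ≤ Real.log (coverV H F Dbar
      (2 * radius C L lam H K (Fintype.card (S × A)) ε δ) ε) := by
    have h1 := card_mul_log_two_le hH hF hc (by linarith : 0 < ε / 2) (by linarith)
    refine h1.trans ?_
    have h2 : 0 < radius C L lam H K (Fintype.card (S × A)) ε δ := by
      have := one_le_radiusConst hC hL hl
      have hX : 0 < Fintype.card (S × A) := Fintype.card_pos
      unfold radius
      positivity
    have h3 : 1 ≤ coveringNumber (bonusClass H Dbar)
        (ε / (2 * (2 * radius C L lam H K (Fintype.card (S × A)) ε δ))) :=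
      one_le_coveringNumber hB ⟨_, 0, hH, [], by simp, rfl⟩ (by positivity)
    have h4 := two_pow_le_coverF hH hF hc (by linarith : 0 < ε / 2) (by linarith)
    refine Real.log_le_log (Nat.cast_pos.2 (lt_of_lt_of_le (by positivity) h4)) (Nat.cast_le.2 ?_)
    exact Nat.le_mul_of_pos_right _ h3
  refine ⟨_, _, sqrt_mul_le_radius hC hL hl hε hδ hNV, radius_le hC hL hl hε hδ hlowV,
    sqrt_mul_le_radius hC hL hl hε hδ hNF, radius_le hC hL hl hε hδ hlowF, fun P μ hP => ?_⟩
  exact success_probability hH hε hε1 hδ hδ1 hC hL hl hb hO hR hG rfl hK hKR P μ hP
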